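/- **Setting.** Let $A$ be a commutative $\mathbb{Q}$-algebra with commuting derivations $\partial_n=\partial/\partial t_n$ ($n\ge 1$), $t_1=x$, $\partial_x=\partial_1$ (a ring of functions of $x$ and $\boldsymbol t=(t_2,t_3,\dots)$), and let $\mathcal E$ be the ring of formal pseudo-differential operators $\sum_{n\ll\infty}a_n\partial_x^n$, $a_n\in A$, multiplied by the generalized Leibniz rule; $(P)_{\ge0}$ denotes the differential-operator part of $P\in\mathcal E$, and $\mathrm{Ad}_G(L)=GLG^{-1}$. * $L=\partial_x+\sum_{j\ge1}u_{j+1}\partial_x^{-j}$ *solves the KP hierarchy* if $\partial_nL=[(L^n)_{\ge0},L]$ for all $n\ge2$. * $W=1+\sum_{j\ge1}w_j\partial_x^{-j}$ is a *wave operator* of $L$ if $L=W\partial_xW^{-1}$ and $\partial_nW=(W\partial_x^nW^{-1})_{\ge0}W-W\partial_x^n$ for all $n\ge2$. * An invertible $\tau\in A$ is a *$\tau$-function* corresponding to $W$ if $1+\sum_jw_j\lambda^{-j}=\tau(x-\lambda^{-1},\boldsymbol t-[\lambda^{-1}])/\tau(x,\boldsymbol t)$ as formal power series in $\lambda^{-1}$,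 where $\boldsymbol t-[\lambda^{-1}]=(t_n-\lambda^{-n}/n)_{n\ge2}$ and the shift is the formal Taylor series $\exp(-\sum_{n\ge1}\frac{\lambda^{-n}}n\partial_n)\tau$. It is a $\tau$-function of $L$ if it corresponds to some wave operator of $L$. * $\varphi\in A$ is an *eigenfunction* of $L$ if $\partial_n\varphi=(L^n)_{\ge0}\varphi$ for all $n\ge2$. * Given eigenfunctions $\varphi_1,\dots,\varphi_N$ ($N\ge0$), put $G_0=1$, $\varphi_k^{[k-1,\dots,1]}=G_{k-1}\varphi_k$, $G_k=G_{\varphi_k^{[k-1,\dots,1]}}\,G_{k-1}$ with $G_\varphi=\varphi\,\partial_x\,\varphi^{-1}$. The $N$-fold Darboux transformation is *defined* if all $\varphi_k^{[k-1,\dots,1]}$, $1\le k\le N$, are invertible in $A$. * $\mathcal W(\varphi_1,\dots,\varphi_N)=\det(\partial_x^{j-1}\varphi_i)_{1\le i,j\le N}$. **Part 1.** Let $L$ solve the KP hierarchy, let $W$ be a wave operator of $L$ and $\tau$ a $\tau$-function corresponding to $W$, and let $\varphi_1,\dots,\varphi_N$ be eigenfunctions of $L$ whose $N$-fold Darboux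 transformation is defined. Then $G_N$ is invertible in $\mathcal E$, $\mathrm{Ad}_{G_N}(L)$ solves the KP hierarchy with wave operator $G_NW\partial_x^{-N}$, and $$\tilde\tau=\mathcal W(\varphi_1,\dots,\varphi_N)\,\tau$$ is a $\tau$-function of $\mathrm{Ad}_{G_N}(L)$. More precisely, the $\tau$-functions corresponding to $G_NW\partial_x^{-N}$ are exactly the elements $c\,\mathcal W(\varphi_1,\dots,\varphi_N)\,\tau$ with $c\in A$ invertible and $\partial_nc=0$ for all $n\ge1$. **Part 2.** Let $\Lambda\subset\mathbb C$ be a lattice with Weierstrass functions $\sigma$, $\zeta=\sigma'/\sigma$, $\wp=-\zeta'$, let $\wp(z)=z^{-2}+\sum_{n\ge0}a_nz^n$ near $0$, and put $$Q(x,\boldsymbol t)=\tfrac12\sum_{i,j\ge1}q_{ij}t_it_j+\sum_{i\ge2}s_it_i\quad(t_1=x),\qquad q_{mn}=\frac{(-1)^m(m+n-2)!\,a_{m+n-2}}{(m-1)!\,(n-1)!},\qquad s_n=\frac n2\sum_{j=1}^{n-1}\frac{q_{n-j,j}}{j(n-j)},$$ $$\Psi(x,\boldsymbol t;k)=\frac{\sigma(x+k)}{\sigma(x)}e^{-\zeta(k)x}\exp\Big[\sum_{j\ge0}\Big\{\frac{\wp^{(j)}(k)}{(j+1)!}-\frac{a_j}{j+1}\Big\}t_{j+2}\Big]\quad(k\notin\Lambda),$$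 $$V_0=1+\sum_{n\ge1}v_{0,n}(x)\partial_x^{-n},\qquad 1+\sum_{n\ge1}v_{0,n}(x)\lambda^{-n}=\frac{\sigma(x-\lambda^{-1})}{\sigma(x)}e^{(\zeta(\lambda^{-1})-\lambda)x},\qquad L_0=V_0\partial_xV_0^{-1}.$$ Let times $(x,\boldsymbol t)$ have finitely many nonzero entries, let $U$ be a set of such points with $x\notin\Lambda$ which is open in every finite-dimensional coordinate slice, and let $A=\mathcal O(U)$ be the ring of functions on $U$ that are analytic on every finite-dimensional coordinate slice. Then the coefficients of $V_0$ and $\tau_V=e^{-Q}\sigma(x)$ lie in $\mathcal O(U)$, $L_0$ solves the KP hierarchy, and $\tau_V$ is a $\tau$-function of $L_0$. For all $N,M\ge 0$, $k_1,\dots,k_M\in\mathbb C\setminus\Lambda$ and $\gamma_{ij}\in\mathbb C$, the functions $\varphi_i=\sum_{j=1}^M\gamma_{ij}\Psi(x,\boldsymbol t;k_j)$ ($1\le i\le N$) are eigenfunctions of $L_0$ in $\mathcal O(U)$. For any eigenfunctions $\varphi_1,\dots,\varphi_N\in\mathcal O(U)$ of $L_0$ (in particular these) whose $N$-fold Darboux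 transformation is defined in $\mathcal O(U)$, $G_N$ is invertible, $\mathrm{Ad}_{G_N}(L_0)$ solves the KP hierarchy, and $$\tilde\tau_V=e^{-Q(x,\boldsymbol t)}\,\sigma(x)\,\mathcal W(\varphi_1,\dots,\varphi_N)$$ is a $\tau$-function of $\mathrm{Ad}_{G_N}(L_0)$. -/

import Mathlib

set_option linter.unusedSectionVars false

/-- A ring of functions of `x = t₁, t₂, t₃, …`: a commutative `ℚ`-algebra together with commuting
derivations `∂ₙ = ∂/∂tₙ` (`n = 1, 2, 3, …`), where `∂₁ = ∂/∂x`. -/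
class FlowAlgebra (A : Type*) [CommRing A] [Algebra ℚ A] where
  /-- the derivation `∂/∂tₙ` -/
  d : ℕ+ → Derivation ℚ A A
  d_comm : ∀ (m n : ℕ+) (a : A), d m (d n a) = d n (d m a)

section PseudoDifferentialOperators

variable (A : Type*) [CommRing A] [Algebra ℚ A] [FlowAlgebra A]

/-- The families `(aₙ)_{n ∈ ℤ}` in `A` that vanish for all sufficiently large `n`. -/
def boundedAbove : AddSubgroup (ℤ → A) where
  carrier := {a | ∃ N : ℤ, ∀ n, N < n → a n = 0}
  zero_mem' := ⟨0, fun _ _ => rfl⟩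
  add_mem' := by
    rintro a b ⟨N, hN⟩ ⟨M, hM⟩
    refine ⟨max N M, fun n hn => ?_⟩
    simp [hN n (lt_of_le_of_lt (le_max_left _ _) hn), hM n (lt_of_le_of_lt (le_max_right _ _) hn)]
  neg_mem' := by
    rintro a ⟨N, hN⟩
    exact ⟨N, fun n hn => by simp [hN n hn]⟩

/-- The formal pseudo-differential operators `∑_{n ≪ ∞} aₙ ∂ₓⁿ` with coefficients in `A`. -/
def PDO : Type _ := boundedAbove A

instance : AddCommGroup (PDO A) := inferInstanceAs (AddCommGroup (boundedAbove A))

variable {A}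

/-- The derivation `∂ₓ = ∂/∂x` of `A`. -/
def dx (a : A) : A := FlowAlgebra.d (1 : ℕ+) a

namespace PDO

/-- The coefficient `aₙ` of `∂ₓⁿ` in `∑ aₙ ∂ₓⁿ`. -/
def coeff (P : PDO A) (n : ℤ) : A := P.1 n

theorem exists_bound (P : PDO A) : ∃ N : ℤ, ∀ n, N < n → P.coeff n = 0 := P.2

@[ext] theorem ext {P Q : PDO A} (h : ∀ n, P.coeff n = Q.coeff n) : P = Q :=
  Subtype.ext (funext h)

@[simp] theorem coeff_add (P Q : PDO A) (n : ℤ) : (P + Q).coeff n = P.coeff n + Q.coeff n := rfl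

@[simp] theorem coeff_zero (n : ℤ) : (0 : PDO A).coeff n = 0 := rfl

/-- The operator `a ∂ₓⁿ`. -/
def monomial (a : A) (n : ℤ) : PDO A :=
  ⟨fun m => if m = n then a else 0, n, fun _ hm => if_neg hm.ne'⟩

theorem coeff_monomial (a : A) (n m : ℤ) :
    (monomial a n).coeff m = if m = n then a else 0 := rfl

/-- The coefficient of `∂ₓᵏ` in the product of `P = ∑ aₙ ∂ₓⁿ` and `Q = ∑ bₘ ∂ₓᵐ`, that is, the sum
of `(n choose r) aₙ ∂ₓʳ(bₘ)` over all `n`, `m`, `r` with `n + m - r = k`. -/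
noncomputable def mulCoeff (P Q : PDO A) (k : ℤ) : A :=
  ∑ᶠ p : ℤ × ℕ, Ring.choose p.1 p.2 • (P.coeff p.1 * dx^[p.2] (Q.coeff (k - p.1 + p.2)))

theorem iterate_dx_zero (r : ℕ) : dx^[r] (0 : A) = 0 :=
  Function.iterate_fixed (by simp [dx]) r

theorem iterate_dx_add (r : ℕ) (a b : A) : dx^[r] (a + b) = dx^[r] a + dx^[r] b := by
  induction r generalizing a b with
  | zero => rfl
  | succ r ih => simp only [Function.iterate_succ_apply, dx, map_add] at *; exact ih _ _

theorem iterate_dx_zsmul (r : ℕ) (z : ℤ) (a : A) : dx^[r] (z • a) = z • dx^[r] a := by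
  induction r generalizing a with
  | zero => rfl
  | succ r ih => simp only [Function.iterate_succ_apply, dx, map_zsmul] at *; exact ih _

theorem iterate_dx_sum {ι : Type*} (r : ℕ) (s : Finset ι) (f : ι → A) :
    dx^[r] (∑ i ∈ s, f i) = ∑ i ∈ s, dx^[r] (f i) := by
  classical
  induction s using Finset.induction_on with
  | empty => simpa using iterate_dx_zero r
  | insert i s hi ih => rw [Finset.sum_insert hi, Finset.sum_insert hi, iterate_dx_add, ih]

theorem iterate_dx_mul (r : ℕ) (a b : A) :
    dx^[r] (a * b) = ∑ p ∈ Finset.HasAntidiagonal.antidiagonal r, r.choose p.1 • (dx^[p.1] a * dx^[p.2] b) := by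
  induction r generalizing a b with
  | zero => simp
  | succ r ih =>
    have h1 : dx (a * b) = dx a * b + a * dx b := by
      simp only [dx, Derivation.leibniz, smul_eq_mul]; ring
    rw [Function.iterate_succ_apply, h1, iterate_dx_add, ih, ih]
    have := Finset.sum_antidiagonal_choose_succ_nsmul
      (fun i j => dx^[i] a * dx^[j] b) r
    rw [this, add_comm]
    congr 1
    refine Finset.sum_congr rfl fun p hp => ?_
    rw [← Nat.choose_symm_of_eq_add (Finset.HasAntidiagonal.mem_antidiagonal.mp hp).symm]
    rfl

/-- The term of index `(m, n)` in the coefficient of `∂ₓᵏ` of a product. -/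
noncomputable def term (a : A) (m : ℤ) (b : A) (n k : ℤ) : A :=
  if k ≤ m + n then Ring.choose m (m + n - k).toNat • (a * dx^[(m + n - k).toNat] b) else 0

theorem mulCoeff_eq_sum (P Q : PDO A) (k a b : ℤ) (hP : ∀ n, a < n → P.coeff n = 0)
    (hQ : ∀ n, b < n → Q.coeff n = 0) (I J : Finset ℤ) (hI : Finset.Icc (k - b) a ⊆ I)
    (hJ : Finset.Icc (k - a) b ⊆ J) :
    mulCoeff P Q k = ∑ m ∈ I, ∑ n ∈ J, term (P.coeff m) m (Q.coeff n) n k := by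
  classical
  have h0 : mulCoeff P Q k = ∑ p ∈ (I ×ˢ J).filter (fun p => k ≤ p.1 + p.2),
      Ring.choose p.1 (p.1 + p.2 - k).toNat •
        (P.coeff p.1 * dx^[(p.1 + p.2 - k).toNat] (Q.coeff p.2)) := by
    rw [mulCoeff, finsum_eq_sum_of_support_subset
      (s := ((I ×ˢ J).filter (fun p => k ≤ p.1 + p.2)).image
        (fun p => (p.1, (p.1 + p.2 - k).toNat)))]
    · rw [Finset.sum_image]
      · refine Finset.sum_congr rfl fun p hp => ?_
        have := (Finset.mem_filter.mp hp).2
        have e : k - p.1 + ((p.1 + p.2 - k).toNat : ℤ) = p.2 := by omega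
        simp only [e]
      · rintro ⟨m, n⟩ h ⟨m', n'⟩ h' heq
        simp only [Finset.coe_filter, Set.mem_ofPred_eq, Prod.mk.injEq] at h h' heq ⊢
        omega
    · rintro ⟨m, r⟩ h
      have hm : m ≤ a := by
        by_contra hc
        exact h (by simp [hP m (by omega)])
      have hn : k - m + r ≤ b := by
        by_contra hc
        exact h (by simp [hQ (k - m + r) (by omega), iterate_dx_zero])
      simp only [Finset.coe_image, Set.mem_image, Finset.mem_coe, Finset.mem_filter,
        Finset.mem_product, Prod.mk.injEq, Prod.exists]
      refine ⟨m, k - m + r, ⟨⟨hI ?_, hJ ?_⟩, by omega⟩, rfl, by omega⟩ <;>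
        rw [Finset.mem_Icc] <;> omega
  rw [h0, Finset.sum_filter, Finset.sum_product]
  rfl

/-- The product of pseudo-differential operators given by the generalized Leibniz rule. -/
noncomputable instance : Mul (PDO A) where
  mul P Q := ⟨mulCoeff P Q, by
    obtain ⟨a, ha⟩ := P.exists_bound
    obtain ⟨b, hb⟩ := Q.exists_bound
    refine ⟨a + b, fun k hk => ?_⟩
    rw [mulCoeff_eq_sum P Q k a b ha hb _ _ subset_rfl subset_rfl]
    refine Finset.sum_eq_zero fun m hm => Finset.sum_eq_zero fun n hn => ?_
    rw [Finset.mem_Icc] at hm hn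
    omega⟩

theorem coeff_mul (P Q : PDO A) (k : ℤ) : (P * Q).coeff k = mulCoeff P Q k := rfl

instance : One (PDO A) := ⟨monomial 1 0⟩

theorem one_def : (1 : PDO A) = monomial 1 0 := rfl

theorem term_add_left (a a' : A) (m : ℤ) (b : A) (n k : ℤ) :
    term (a + a') m b n k = term a m b n k + term a' m b n k := by
  unfold term; split_ifs <;> simp [add_mul]

theorem term_add_right (a : A) (m : ℤ) (b b' : A) (n k : ℤ) :
    term a m (b + b') n k = term a m b n k + term a m b' n k := by
  unfold term; split_ifs <;> simp [iterate_dx_add, mul_add]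

theorem term_zero_left (m : ℤ) (b : A) (n k : ℤ) : term 0 m b n k = 0 := by simp [term]

theorem term_zero_right (a : A) (m n k : ℤ) : term a m 0 n k = 0 := by
  simp [term, iterate_dx_zero]

theorem term_sum_left {ι : Type*} (s : Finset ι) (f : ι → A) (m : ℤ) (b : A) (n k : ℤ) :
    term (∑ i ∈ s, f i) m b n k = ∑ i ∈ s, term (f i) m b n k := by
  classical
  induction s using Finset.induction_on with
  | empty => simp [term_zero_left]
  | insert i s hi ih => rw [Finset.sum_insert hi, Finset.sum_insert hi, term_add_left, ih]

theorem term_sum_right {ι : Type*} (a : A) (m : ℤ) (s : Finset ι) (f : ι → A) (n k : ℤ) :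
    term a m (∑ i ∈ s, f i) n k = ∑ i ∈ s, term a m (f i) n k := by
  classical
  induction s using Finset.induction_on with
  | empty => simp [term_zero_right]
  | insert i s hi ih => rw [Finset.sum_insert hi, Finset.sum_insert hi, term_add_right, ih]

theorem sum_triple (K : ℕ) (f : ℕ → ℕ → ℕ → A) :
    ∑ p ∈ Finset.HasAntidiagonal.antidiagonal K, ∑ q ∈ Finset.HasAntidiagonal.antidiagonal p.2, f p.1 q.1 q.2 =
      ∑ p ∈ Finset.HasAntidiagonal.antidiagonal K, ∑ q ∈ Finset.HasAntidiagonal.antidiagonal p.1, f q.1 q.2 p.2 := by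
  rw [Finset.sum_sigma', Finset.sum_sigma']
  refine Finset.sum_bij' (fun x _ => ⟨(x.1.1 + x.2.1, x.2.2), (x.1.1, x.2.1)⟩)
    (fun x _ => ⟨(x.2.1, x.2.2 + x.1.2), (x.2.2, x.1.2)⟩) ?_ ?_ ?_ ?_ ?_ <;>
    rintro ⟨⟨a, b⟩, ⟨c, d⟩⟩ h <;>
    simp only [Finset.mem_sigma, Finset.HasAntidiagonal.mem_antidiagonal] at h ⊢
  · obtain ⟨rfl, rfl⟩ := h; exact ⟨by omega, trivial⟩
  · obtain ⟨rfl, rfl⟩ := h; exact ⟨by omega, trivial⟩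
  · obtain ⟨_, rfl⟩ := h; rfl
  · obtain ⟨_, rfl⟩ := h; rfl

theorem sum_Icc_eq_antidiagonal (lo hi u v : ℤ) (hlo : lo ≤ v) (hhi : u ≤ hi) (huv : v ≤ u)
    (f : ℕ → ℕ → A) :
    ∑ p ∈ Finset.Icc lo hi,
      (if v ≤ p ∧ p ≤ u then f (u - p).toNat (p - v).toNat else 0) =
    ∑ q ∈ Finset.HasAntidiagonal.antidiagonal (u - v).toNat, f q.1 q.2 := by
  rw [← Finset.sum_filter]
  refine Finset.sum_bij' (fun p _ => ((u - p).toNat, (p - v).toNat)) (fun q _ => u - q.1)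
    ?_ ?_ ?_ ?_ ?_
  · intro p hp
    simp only [Finset.mem_filter, Finset.mem_Icc, Finset.HasAntidiagonal.mem_antidiagonal] at hp ⊢
    omega
  · rintro ⟨i, j⟩ hq
    simp only [Finset.mem_filter, Finset.mem_Icc, Finset.HasAntidiagonal.mem_antidiagonal] at hq ⊢
    omega
  · intro p hp
    simp only [Finset.mem_filter, Finset.mem_Icc] at hp ⊢
    omega
  · rintro ⟨i, j⟩ hq
    simp only [Finset.HasAntidiagonal.mem_antidiagonal, Prod.mk.injEq] at hq ⊢
    omega
  · intros; rfl

theorem term_assoc_aux (a b c : A) (m n : ℤ) (K : ℕ) :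
    ∑ q ∈ Finset.HasAntidiagonal.antidiagonal K, Ring.choose (m + n - q.1) q.2 •
      ((Ring.choose m q.1 • (a * dx^[q.1] b)) * dx^[q.2] c) =
    ∑ q ∈ Finset.HasAntidiagonal.antidiagonal K, Ring.choose m q.1 •
      (a * dx^[q.1] (Ring.choose n q.2 • (b * dx^[q.2] c))) := by
  have hL : ∀ q ∈ Finset.HasAntidiagonal.antidiagonal K, Ring.choose (m + n - q.1) q.2 •
      ((Ring.choose m q.1 • (a * dx^[q.1] b)) * dx^[q.2] c) =
      ∑ p ∈ Finset.HasAntidiagonal.antidiagonal q.2, (Ring.choose m q.1 * Ring.choose (m - q.1) p.1 *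
        Ring.choose n p.2) • (a * (dx^[q.1] b * dx^[p.1 + p.2] c)) := by
    intro q _
    have e : m + n - (q.1 : ℤ) = (m - q.1) + n := by ring
    rw [e, Ring.add_choose_eq _ (Commute.all _ _), Finset.sum_smul]
    refine Finset.sum_congr rfl fun p hp => ?_
    rw [Finset.HasAntidiagonal.mem_antidiagonal.mp hp]
    simp only [zsmul_eq_mul]
    push_cast
    ring
  have hR : ∀ q ∈ Finset.HasAntidiagonal.antidiagonal K, Ring.choose m q.1 •
      (a * dx^[q.1] (Ring.choose n q.2 • (b * dx^[q.2] c))) =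
      ∑ p ∈ Finset.HasAntidiagonal.antidiagonal q.1, (Ring.choose m p.1 * Ring.choose (m - p.1) p.2 *
        Ring.choose n q.2) • (a * (dx^[p.1] b * dx^[p.2 + q.2] c)) := by
    intro q _
    rw [iterate_dx_zsmul, iterate_dx_mul, Finset.smul_sum, Finset.mul_sum, Finset.smul_sum]
    refine Finset.sum_congr rfl fun p hp => ?_
    have hp' := Finset.HasAntidiagonal.mem_antidiagonal.mp hp
    have h := Ring.choose_smul_choose m (n := q.1) (k := p.1) (by omega)
    have e : q.1 - p.1 = p.2 := by omega
    rw [e] at h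
    rw [← h, ← Function.iterate_add_apply]
    simp only [zsmul_eq_mul, nsmul_eq_mul]
    push_cast
    ring
  rw [Finset.sum_congr rfl hL, Finset.sum_congr rfl hR]
  exact sum_triple K fun i j l => (Ring.choose m i * Ring.choose (m - i) j *
        Ring.choose n l) • (a * (dx^[i] b * dx^[j + l] c))

theorem term_assoc (a b c : A) (m n l k lo hi lo' hi' : ℤ) (h1 : lo ≤ k - l) (h2 : m + n ≤ hi)
    (h3 : lo' ≤ k - m) (h4 : n + l ≤ hi') :
    ∑ p ∈ Finset.Icc lo hi, term (term a m b n p) p c l k =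
      ∑ p ∈ Finset.Icc lo' hi', term a m (term b n c l p) p k := by
  by_cases hk : k ≤ m + n + l
  · have e1 := sum_Icc_eq_antidiagonal lo hi (m + n) (k - l) h1 h2 (by omega)
      (fun i j => Ring.choose (m + n - i) j • ((Ring.choose m i • (a * dx^[i] b)) * dx^[j] c))
    have e2 := sum_Icc_eq_antidiagonal lo' hi' (n + l) (k - m) h3 h4 (by omega)
      (fun i j => Ring.choose m j • (a * dx^[j] (Ring.choose n i • (b * dx^[i] c))))
    have e3 : (n + l - (k - m)).toNat = (m + n - (k - l)).toNat := by congr 1; ring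
    have e4 := term_assoc_aux a b c m n (m + n - (k - l)).toNat
    rw [e3, ← Finset.Nat.sum_antidiagonal_swap] at e2
    refine Eq.trans (Eq.trans ?_ (e1.trans (e4.trans e2.symm))) ?_
    · refine Finset.sum_congr rfl fun p _ => ?_
      unfold term
      by_cases ha : p ≤ m + n
      · by_cases hb : k ≤ p + l
        · have e5 : m + n - ((m + n - p).toNat : ℤ) = p := by omega
          have e6 : p + l - k = p - (k - l) := by ring
          rw [if_pos ha, if_pos hb, if_pos ⟨by omega, ha⟩, e5, e6]
        · rw [if_neg hb, if_neg (by omega)]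
      · rw [if_neg ha, if_neg (by omega : ¬ (k - l ≤ p ∧ p ≤ m + n))]
        simp
    · refine Finset.sum_congr rfl fun p _ => ?_
      unfold term
      by_cases ha : p ≤ n + l
      · by_cases hb : k ≤ m + p
        · have e6 : p - (k - m) = m + p - k := by ring
          rw [if_pos ha, if_pos hb, if_pos ⟨by omega, ha⟩, e6]
        · rw [if_neg hb, if_neg (by omega)]
      · rw [if_neg ha, if_neg (by omega : ¬ (k - m ≤ p ∧ p ≤ n + l))]
        simp [iterate_dx_zero]
  · rw [Finset.sum_eq_zero, Finset.sum_eq_zero]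
    · intro p _
      unfold term
      split_ifs <;> first | omega | simp [iterate_dx_zero]
    · intro p _
      unfold term
      split_ifs <;> first | omega | simp

theorem mul_assoc' (P Q R : PDO A) : P * Q * R = P * (Q * R) := by
  obtain ⟨a, ha⟩ := P.exists_bound
  obtain ⟨b, hb⟩ := Q.exists_bound
  obtain ⟨c, hc⟩ := R.exists_bound
  have hab : ∀ n, a + b < n → (P * Q).coeff n = 0 := fun k hk => by
    rw [coeff_mul, mulCoeff_eq_sum P Q k a b ha hb _ _ subset_rfl subset_rfl]
    refine Finset.sum_eq_zero fun m hm => Finset.sum_eq_zero fun n hn => ?_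
    rw [Finset.mem_Icc] at hm hn
    omega
  have hbc : ∀ n, b + c < n → (Q * R).coeff n = 0 := fun k hk => by
    rw [coeff_mul, mulCoeff_eq_sum Q R k b c hb hc _ _ subset_rfl subset_rfl]
    refine Finset.sum_eq_zero fun m hm => Finset.sum_eq_zero fun n hn => ?_
    rw [Finset.mem_Icc] at hm hn
    omega
  ext k
  have hle : ∀ {lo lo' hi hi' : ℤ}, lo' ≤ lo → hi ≤ hi' →
      Finset.Icc lo hi ⊆ Finset.Icc lo' hi' := fun h h' => Finset.Icc_subset_Icc h h'
  let I := Finset.Icc (k - b - c) a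
  let J := Finset.Icc (k - a - c) b
  let S := Finset.Icc (k - a - b) c
  have L : (P * Q * R).coeff k = ∑ m ∈ I, ∑ n ∈ J, ∑ l ∈ S, ∑ p ∈ Finset.Icc (k - c) (a + b),
      term (term (P.coeff m) m (Q.coeff n) n p) p (R.coeff l) l k := by
    rw [coeff_mul, mulCoeff_eq_sum (P * Q) R k (a + b) c hab hc (Finset.Icc (k - c) (a + b)) S
      subset_rfl (hle (by omega) le_rfl)]
    have : ∀ p ∈ Finset.Icc (k - c) (a + b), ∑ l ∈ S, term ((P * Q).coeff p) p (R.coeff l) l k =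
        ∑ l ∈ S, ∑ m ∈ I, ∑ n ∈ J,
          term (term (P.coeff m) m (Q.coeff n) n p) p (R.coeff l) l k := by
      intro p hp
      rw [Finset.mem_Icc] at hp
      refine Finset.sum_congr rfl fun l _ => ?_
      rw [coeff_mul, mulCoeff_eq_sum P Q p a b ha hb I J (hle (by omega) le_rfl)
        (hle (by omega) le_rfl), term_sum_left]
      simp only [term_sum_left]
    rw [Finset.sum_congr rfl this, Finset.sum_comm]
    simp only [Finset.sum_comm (s := Finset.Icc (k - c) (a + b))]
    rw [Finset.sum_comm]
    refine Finset.sum_congr rfl fun m _ => ?_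
    rw [Finset.sum_comm]
  have Rr : (P * (Q * R)).coeff k = ∑ m ∈ I, ∑ n ∈ J, ∑ l ∈ S, ∑ p ∈ Finset.Icc (k - a) (b + c),
      term (P.coeff m) m (term (Q.coeff n) n (R.coeff l) l p) p k := by
    rw [coeff_mul, mulCoeff_eq_sum P (Q * R) k a (b + c) ha hbc I (Finset.Icc (k - a) (b + c))
      (hle (by omega) le_rfl) subset_rfl]
    refine Finset.sum_congr rfl fun m _ => ?_
    have : ∀ p ∈ Finset.Icc (k - a) (b + c), term (P.coeff m) m ((Q * R).coeff p) p k =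
        ∑ n ∈ J, ∑ l ∈ S, term (P.coeff m) m (term (Q.coeff n) n (R.coeff l) l p) p k := by
      intro p hp
      rw [Finset.mem_Icc] at hp
      rw [coeff_mul, mulCoeff_eq_sum Q R p b c hb hc J S (hle (by omega) le_rfl)
        (hle (by omega) le_rfl), term_sum_right]
      simp only [term_sum_right]
    rw [Finset.sum_congr rfl this, Finset.sum_comm]
    refine Finset.sum_congr rfl fun n _ => ?_
    rw [Finset.sum_comm]
  rw [L, Rr]
  refine Finset.sum_congr rfl fun m hm => Finset.sum_congr rfl fun n hn =>
    Finset.sum_congr rfl fun l hl => ?_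
  simp only [I, J, S, Finset.mem_Icc] at hm hn hl
  exact term_assoc _ _ _ m n l k _ _ _ _ (by omega) (by omega) (by omega) (by omega)

theorem left_distrib' (P Q R : PDO A) : P * (Q + R) = P * Q + P * R := by
  obtain ⟨a, ha⟩ := P.exists_bound
  obtain ⟨b, hb⟩ := Q.exists_bound
  obtain ⟨c, hc⟩ := R.exists_bound
  have hb' : ∀ n, max b c < n → Q.coeff n = 0 := fun n hn => hb n (by omega)
  have hc' : ∀ n, max b c < n → R.coeff n = 0 := fun n hn => hc n (by omega)
  ext k
  rw [coeff_add, coeff_mul, coeff_mul, coeff_mul,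
    mulCoeff_eq_sum P Q k a _ ha hb' _ _ subset_rfl subset_rfl,
    mulCoeff_eq_sum P R k a _ ha hc' _ _ subset_rfl subset_rfl,
    mulCoeff_eq_sum P (Q + R) k a (max b c) ha
      (fun n hn => by rw [coeff_add, hb' n hn, hc' n hn, add_zero]) _ _ subset_rfl subset_rfl]
  simp only [coeff_add, term_add_right, Finset.sum_add_distrib]

theorem right_distrib' (P Q R : PDO A) : (P + Q) * R = P * R + Q * R := by
  obtain ⟨a, ha⟩ := P.exists_bound
  obtain ⟨b, hb⟩ := Q.exists_bound
  obtain ⟨c, hc⟩ := R.exists_bound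
  have ha' : ∀ n, max a b < n → P.coeff n = 0 := fun n hn => ha n (by omega)
  have hb' : ∀ n, max a b < n → Q.coeff n = 0 := fun n hn => hb n (by omega)
  ext k
  rw [coeff_add, coeff_mul, coeff_mul, coeff_mul,
    mulCoeff_eq_sum P R k _ c ha' hc _ _ subset_rfl subset_rfl,
    mulCoeff_eq_sum Q R k _ c hb' hc _ _ subset_rfl subset_rfl,
    mulCoeff_eq_sum (P + Q) R k (max a b) c
      (fun n hn => by rw [coeff_add, ha' n hn, hb' n hn, add_zero]) hc _ _ subset_rfl subset_rfl]
  simp only [coeff_add, term_add_left, Finset.sum_add_distrib]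

theorem zero_mul' (P : PDO A) : 0 * P = 0 := by
  have h := right_distrib' 0 0 P
  rwa [add_zero, eq_comm, add_eq_left] at h

theorem mul_zero' (P : PDO A) : P * 0 = 0 := by
  have h := left_distrib' P 0 0
  rwa [add_zero, eq_comm, add_eq_left] at h

theorem one_mul' (P : PDO A) : 1 * P = P := by
  ext k
  rw [coeff_mul, mulCoeff, finsum_eq_single _ ((0, 0) : ℤ × ℕ)]
  · simp [one_def, coeff_monomial]
  · rintro ⟨n, r⟩ h
    by_cases hn : n = 0
    · subst hn
      have hr : 0 < r := Nat.pos_of_ne_zero fun hr => h (by rw [hr])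
      simp [Ring.choose_zero_pos ℤ hr]
    · simp [one_def, coeff_monomial, hn]

theorem mul_one' (P : PDO A) : P * 1 = P := by
  ext k
  rw [coeff_mul, mulCoeff, finsum_eq_single _ ((k, 0) : ℤ × ℕ)]
  · simp [one_def, coeff_monomial]
  · rintro ⟨n, r⟩ h
    by_cases hn : k - n + r = 0
    · have hr : r ≠ 0 := fun hr => h (by subst hr; simp; omega)
      obtain ⟨s, rfl⟩ := Nat.exists_eq_succ_of_ne_zero hr
      have h1 : dx (1 : A) = 0 := by simp [dx]
      simp only [hn, one_def, coeff_monomial, if_true, Nat.succ_eq_add_one,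
        Function.iterate_succ_apply, h1, iterate_dx_zero, mul_zero, smul_zero]
    · simp [one_def, coeff_monomial, hn, iterate_dx_zero]

/-- Pseudo-differential operators form an (associative, noncommutative) ring. -/
noncomputable instance : Ring (PDO A) :=
  { (inferInstance : AddCommGroup (PDO A)) with
    mul := (· * ·)
    one := 1
    mul_assoc := mul_assoc'
    one_mul := one_mul'
    mul_one := mul_one'
    left_distrib := left_distrib'
    right_distrib := right_distrib'
    zero_mul := zero_mul'
    mul_zero := mul_zero' }

end PDO
end PseudoDifferentialOperators

section Functions

/-- The space of all `t = (t₁, t₂, t₃, …)` with finitely many nonzero entries; `x = t₁`. -/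
abbrev TimeSpace : Type := ℕ+ →₀ ℂ

/-- The point `s + ∑ⱼ vⱼ e_{iⱼ}` of the finite-dimensional slice through `s` in the coordinate
directions `i₁, …, iₘ`. -/
noncomputable def slice (s : TimeSpace) {m : ℕ} (i : Fin m → ℕ+) (v : Fin m → ℂ) : TimeSpace :=
  s + ∑ j, Finsupp.single (i j) (v j)

/-- Open subsets of the space of times: those that meet every finite-dimensional coordinate slice in
an open set. -/
def IsFinOpen (U : Set TimeSpace) : Prop :=
  ∀ (s : TimeSpace) (m : ℕ) (i : Fin m → ℕ+), IsOpen {v : Fin m → ℂ | slice s i v ∈ U}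

/-- Bundled open subsets of the space of times. -/
structure TimeDomain where
  carrier : Set TimeSpace
  isFinOpen : IsFinOpen carrier

/-- Extension by zero of a function on `U` (only its values near points of `U` matter). -/
noncomputable def extendZero {U : Set TimeSpace} (f : U → ℂ) (t : TimeSpace) : ℂ := by
  classical exact if h : t ∈ U then f ⟨t, h⟩ else 0

/-- `f` is analytic: its restriction to every finite-dimensional coordinate slice is an analytic
function of several complex variables. -/
def IsFinAnalytic {U : Set TimeSpace} (f : U → ℂ) : Prop :=
  ∀ (s : U) (m : ℕ) (i : Fin m → ℕ+), AnalyticAt ℂ (fun v => extendZero f (slice s.1 i v)) 0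

theorem extendZero_of_mem {U : Set TimeSpace} (f : U → ℂ) {t : TimeSpace} (h : t ∈ U) :
    extendZero f t = f ⟨t, h⟩ := by simp [extendZero, h]

theorem extendZero_val {U : Set TimeSpace} (f : U → ℂ) (s : U) : extendZero f s.1 = f s :=
  extendZero_of_mem f s.2

theorem extendZero_add {U : Set TimeSpace} (f g : U → ℂ) :
    extendZero (f + g) = extendZero f + extendZero g := by
  funext t; by_cases h : t ∈ U <;> simp [extendZero, h]

theorem extendZero_mul {U : Set TimeSpace} (f g : U → ℂ) :
    extendZero (f * g) = extendZero f * extendZero g := by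
  funext t; by_cases h : t ∈ U <;> simp [extendZero, h]

theorem slice_zero (s : TimeSpace) {m : ℕ} (i : Fin m → ℕ+) : slice s i 0 = s := by
  simp [slice]

theorem TimeDomain.eventually_mem (U : TimeDomain) (s : U.carrier) {m : ℕ} (i : Fin m → ℕ+) :
    ∀ᶠ v in nhds (0 : Fin m → ℂ), slice s.1 i v ∈ U.carrier :=
  (U.isFinOpen s.1 m i).mem_nhds (by simp [slice_zero])

/-- The algebra `𝒪(U)` of analytic functions on an open set `U` of times. -/
def analyticFunctions (U : TimeDomain) : Subalgebra ℂ (U.carrier → ℂ) where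
  carrier := {f | IsFinAnalytic f}
  mul_mem' := by
    intro f g hf hg s m i
    simp only [extendZero_mul]
    exact (hf s m i).mul (hg s m i)
  add_mem' := by
    intro f g hf hg s m i
    simp only [extendZero_add]
    exact (hf s m i).add (hg s m i)
  algebraMap_mem' := by
    intro c s m i
    refine (analyticAt_const (v := c)).congr ?_
    filter_upwards [U.eventually_mem s i] with v hv
    simp [extendZero, hv]

/-- The partial derivative `∂f/∂tₙ`. -/
noncomputable def partialDeriv {U : Set TimeSpace} (n : ℕ+) (f : U → ℂ) (s : U) : ℂ :=
  deriv (fun z : ℂ => extendZero f (s.1 + Finsupp.single n z)) 0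

theorem slice_cons (s : TimeSpace) {m : ℕ} (n : ℕ+) (i : Fin m → ℕ+) (z : ℂ) (v : Fin m → ℂ) :
    slice s (Fin.cons n i : Fin (m + 1) → ℕ+) (Fin.cons z v : Fin (m + 1) → ℂ) =
      slice s i v + Finsupp.single n z := by
  simp only [slice, Fin.sum_univ_succ, Fin.cons_zero, Fin.cons_succ]
  abel

/-- The inclusion `v ↦ (0, v)`. -/
noncomputable def consZero (m : ℕ) : (Fin m → ℂ) →L[ℂ] (Fin (m + 1) → ℂ) :=
  ContinuousLinearMap.pi (Fin.cons 0 fun j => ContinuousLinearMap.proj j)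

theorem consZero_apply (m : ℕ) (v : Fin m → ℂ) :
    consZero m v = (Fin.cons 0 v : Fin (m + 1) → ℂ) := by
  funext j
  refine Fin.cases ?_ (fun j => ?_) j <;> simp [consZero]

theorem cons_eq (m : ℕ) (v : Fin m → ℂ) (z : ℂ) :
    (Fin.cons z v : Fin (m + 1) → ℂ) = consZero m v + z • Pi.single 0 1 := by
  rw [consZero_apply]
  funext j
  refine Fin.cases ?_ (fun j => ?_) j <;> simp

theorem partialDeriv_slice (U : TimeDomain) {f : U.carrier → ℂ} (hf : IsFinAnalytic f) (n : ℕ+)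
    (s : U.carrier) {m : ℕ} (i : Fin m → ℕ+) :
    (fun v => extendZero (partialDeriv n f) (slice s.1 i v)) =ᶠ[nhds 0] fun v =>
      fderiv ℂ (fun w => extendZero f (slice s.1 (Fin.cons n i : Fin (m + 1) → ℕ+) w))
        (consZero m v) (Pi.single 0 1) := by
  have h1 := (hf s (m + 1) (Fin.cons n i)).eventually_analyticAt
  have h2 : Filter.Tendsto (consZero m) (nhds 0) (nhds 0) := by
    simpa using (consZero m).continuous.tendsto 0
  filter_upwards [U.eventually_mem s i, h2.eventually h1] with v hv hv'
  rw [extendZero_of_mem _ hv, partialDeriv]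
  have h3 := hv'.differentiableAt.hasFDerivAt
  have h4 : HasDerivAt (fun z : ℂ => consZero m v + z • (Pi.single 0 1 : Fin (m + 1) → ℂ))
      (Pi.single 0 1) 0 := by
    simpa using ((hasDerivAt_id (0 : ℂ)).smul_const
      (Pi.single 0 1 : Fin (m + 1) → ℂ)).const_add (consZero m v)
  have h5 : HasFDerivAt (fun w => extendZero f (slice s.1 (Fin.cons n i : Fin (m + 1) → ℕ+) w))
      (fderiv ℂ (fun w => extendZero f (slice s.1 (Fin.cons n i : Fin (m + 1) → ℕ+) w))
        (consZero m v)) (consZero m v + (0 : ℂ) • (Pi.single 0 1 : Fin (m + 1) → ℂ)) := by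
    simpa using h3
  have h6 := (h5.comp_hasDerivAt (0 : ℂ) h4).deriv
  rw [← h6]
  congr 1
  funext z
  simp only [Function.comp, ← cons_eq, slice_cons]

theorem isFinAnalytic_partialDeriv (U : TimeDomain) {f : U.carrier → ℂ} (hf : IsFinAnalytic f)
    (n : ℕ+) : IsFinAnalytic (partialDeriv n f) := by
  intro s m i
  refine AnalyticAt.congr ?_ (partialDeriv_slice U hf n s i).symm
  have h1 : AnalyticAt ℂ (fderiv ℂ
      (fun w => extendZero f (slice s.1 (Fin.cons n i : Fin (m + 1) → ℕ+) w)))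
      (consZero m 0) := by
    rw [map_zero]
    exact (hf s (m + 1) (Fin.cons n i)).fderiv
  have h2 := h1.comp ((consZero m).analyticAt 0)
  exact (ContinuousLinearMap.apply ℂ ℂ (Pi.single 0 1 : Fin (m + 1) → ℂ)).analyticAt _ |>.comp h2

theorem differentiableAt_line (U : TimeDomain) {f : U.carrier → ℂ} (hf : IsFinAnalytic f)
    (n : ℕ+) (s : U.carrier) :
    DifferentiableAt ℂ (fun z : ℂ => extendZero f (s.1 + Finsupp.single n z)) 0 := by
  have h := (hf s 1 (fun _ => n)).differentiableAt
  have h2 : DifferentiableAt ℂ (fun z : ℂ => (fun _ : Fin 1 => z)) 0 := by fun_prop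
  have h3 := DifferentiableAt.comp (0 : ℂ)
    (g := fun v : Fin 1 → ℂ => extendZero f (slice s.1 (fun _ => n) v)) h h2
  simpa [Function.comp_def, slice] using h3

theorem partialDeriv_comm (U : TimeDomain) {f : U.carrier → ℂ} (hf : IsFinAnalytic f)
    (m n : ℕ+) : partialDeriv m (partialDeriv n f) = partialDeriv n (partialDeriv m f) := by
  have key : ∀ (a b : ℕ+) (s : U.carrier),
      partialDeriv a (partialDeriv b f) s =
        fderiv ℂ (fderiv ℂ fun w : Fin 2 → ℂ => extendZero f (slice s.1 ![b, a] w)) 0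
          (Pi.single 1 1) (Pi.single 0 1) := by
    intro a b s
    have h1 := partialDeriv_slice U hf b s (fun _ : Fin 1 => a)
    have hv : (Fin.cons b (fun _ : Fin 1 => a) : Fin 2 → ℕ+) = ![b, a] := by
      funext j; fin_cases j <;> rfl
    rw [hv] at h1
    have h2 : Filter.Tendsto (fun z : ℂ => (fun _ : Fin 1 => z)) (nhds 0) (nhds 0) :=
      (by fun_prop : Continuous fun z : ℂ => (fun _ : Fin 1 => z)).tendsto' _ _ rfl
    have h3 := h2.eventually h1
    have h4 : (fun z : ℂ => extendZero (partialDeriv b f) (s.1 + Finsupp.single a z)) =ᶠ[nhds 0]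
        fun z => fderiv ℂ (fun w : Fin 2 → ℂ => extendZero f (slice s.1 ![b, a] w))
          (z • Pi.single 1 1) (Pi.single 0 1) := by
      filter_upwards [h3] with z hz
      have e : consZero 1 (fun _ => z) = z • (Pi.single 1 1 : Fin 2 → ℂ) := by
        rw [consZero_apply]; funext j; fin_cases j <;> simp
      rw [e] at hz
      rw [← hz]
      simp [slice]
    rw [partialDeriv, h4.deriv_eq]
    have h5 := (hf s 2 ![b, a]).fderiv.differentiableAt.hasFDerivAt
    have h6 : HasDerivAt (fun z : ℂ => z • (Pi.single 1 1 : Fin 2 → ℂ)) (Pi.single 1 1) 0 := by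
      simpa using (hasDerivAt_id (0 : ℂ)).smul_const (Pi.single 1 1 : Fin 2 → ℂ)
    have h7 : HasFDerivAt (fderiv ℂ fun w : Fin 2 → ℂ => extendZero f (slice s.1 ![b, a] w))
        (fderiv ℂ (fderiv ℂ fun w : Fin 2 → ℂ => extendZero f (slice s.1 ![b, a] w)) 0)
        ((0 : ℂ) • (Pi.single 1 1 : Fin 2 → ℂ)) := by simpa using h5
    have h8 := h7.comp_hasDerivAt (0 : ℂ) h6
    exact (((ContinuousLinearMap.apply ℂ ℂ
      (Pi.single 0 1 : Fin 2 → ℂ)).hasFDerivAt).comp_hasDerivAt (0 : ℂ) h8).deriv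
  funext s
  rw [key m n s, key n m s]
  have hsym : IsSymmSndFDerivAt ℂ (fun w : Fin 2 → ℂ => extendZero f (slice s.1 ![n, m] w)) 0 :=
    ContDiffAt.isSymmSndFDerivAt_of_omega (hf s 2 ![n, m]).contDiffAt
  rw [hsym.eq]
  let σ : (Fin 2 → ℂ) →L[ℂ] (Fin 2 → ℂ) :=
    ContinuousLinearMap.pi fun j => ContinuousLinearMap.proj (Equiv.swap 0 1 j)
  set F : (Fin 2 → ℂ) → ℂ := fun w => extendZero f (slice s.1 ![n, m] w) with hF
  have hFan : AnalyticAt ℂ F 0 := hf s 2 ![n, m]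
  have hσ0 : σ 0 = 0 := map_zero σ
  have hG : (fun w : Fin 2 → ℂ => extendZero f (slice s.1 ![m, n] w)) = F ∘ σ := by
    funext w
    simp only [hF, Function.comp, slice, Fin.sum_univ_two]
    simp [σ, add_comm]
  have h1 : fderiv ℂ (F ∘ σ) =ᶠ[nhds 0] fun w => (fderiv ℂ F (σ w)).comp σ := by
    have ht : Filter.Tendsto σ (nhds 0) (nhds 0) := by
      simpa using σ.continuous.tendsto 0
    filter_upwards [ht.eventually hFan.eventually_analyticAt] with w hw
    exact (hw.differentiableAt.hasFDerivAt.comp w σ.hasFDerivAt).fderiv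
  have h2 : HasFDerivAt (fderiv ℂ F) (fderiv ℂ (fderiv ℂ F) 0) (σ 0) := by
    rw [hσ0]; exact hFan.fderiv.differentiableAt.hasFDerivAt
  have h3 := (((ContinuousLinearMap.compL ℂ (Fin 2 → ℂ) (Fin 2 → ℂ) ℂ).flip σ).hasFDerivAt).comp
    (0 : Fin 2 → ℂ) (h2.comp (0 : Fin 2 → ℂ) σ.hasFDerivAt)
  have h4 := (h1.fderiv_eq (𝕜 := ℂ)).trans h3.fderiv
  rw [hG, h4]
  have e0 : σ (Pi.single 0 1) = Pi.single 1 1 := by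
    funext j; fin_cases j <;> simp [σ]
  have e1 : σ (Pi.single 1 1) = Pi.single 0 1 := by
    funext j; fin_cases j <;> simp [σ]
  simp [e0, e1]

/-- The derivation `∂/∂tₙ` of the algebra of analytic functions on `U`. -/
noncomputable def partialDerivation (U : TimeDomain) (n : ℕ+) :
    Derivation ℂ (analyticFunctions U) (analyticFunctions U) :=
  Derivation.mk'
    { toFun := fun f => ⟨partialDeriv n f.1, isFinAnalytic_partialDeriv U f.2 n⟩
      map_add' := by
        intro f g
        apply Subtype.ext
        funext s
        have h := deriv_add (differentiableAt_line U f.2 n s) (differentiableAt_line U g.2 n s)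
        change partialDeriv n (f.1 + g.1) s = partialDeriv n f.1 s + partialDeriv n g.1 s
        simp only [partialDeriv, extendZero_add]
        exact h
      map_smul' := by
        intro c f
        apply Subtype.ext
        funext s
        have e : extendZero (c • f.1) = fun t => c * extendZero f.1 t := by
          funext t; by_cases h : t ∈ U.carrier <;> simp [extendZero, h]
        have h := deriv_const_mul c (differentiableAt_line U f.2 n s)
        change partialDeriv n (c • f.1) s = c * partialDeriv n f.1 s
        simp only [partialDeriv, e]
        exact h }
    (by
      intro f g
      apply Subtype.ext
      funext s
      have h := deriv_mul (differentiableAt_line U f.2 n s) (differentiableAt_line U g.2 n s)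
      simp only [Finsupp.single_zero, add_zero, extendZero_val] at h
      have e : partialDeriv n (f.1 * g.1) s =
          partialDeriv n f.1 s * g.1 s + f.1 s * partialDeriv n g.1 s := by
        simp only [partialDeriv, extendZero_mul]
        exact h
      change partialDeriv n (f.1 * g.1) s =
        f.1 s * partialDeriv n g.1 s + g.1 s * partialDeriv n f.1 s
      rw [e]; ring)

noncomputable instance (U : TimeDomain) : FlowAlgebra (analyticFunctions U) where
  d n := (partialDerivation U n).restrictScalars ℚ
  d_comm m n f := Subtype.ext (partialDeriv_comm U f.2 m n)

end Functions

section KPHierarchy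

variable {A : Type*} [CommRing A] [Algebra ℚ A] [FlowAlgebra A]

namespace PDO

/-- The operator `∂ₓ`. -/
def D : PDO A := monomial 1 1

/-- The multiplication operator by `a ∈ A`. -/
def C (a : A) : PDO A := monomial a 0

/-- The differential-operator part `(P)_{≥ 0}` of `P`. -/
def plus (P : PDO A) : PDO A :=
  ⟨fun n => if 0 ≤ n then P.coeff n else 0, by
    obtain ⟨N, hN⟩ := P.exists_bound
    exact ⟨N, fun n hn => by simp [hN n hn]⟩⟩

/-- The action `∑ aₙ ∂ₓⁿ(f)` of a differential operator `P = ∑_{n ≥ 0} aₙ ∂ₓⁿ` on `f ∈ A`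
(only used for differential operators). -/
noncomputable def act (P : PDO A) (f : A) : A := ∑ᶠ n : ℕ, P.coeff n * dx^[n] f

/-- The coefficientwise derivative `∂P/∂tₙ`. -/
def dt (n : ℕ+) (P : PDO A) : PDO A :=
  ⟨fun k => FlowAlgebra.d n (P.coeff k), by
    obtain ⟨N, hN⟩ := P.exists_bound
    exact ⟨N, fun k hk => by simp [hN k hk]⟩⟩

/-- The adjoint action `Ad_G(L) = G L G⁻¹` (for invertible `G`). -/
noncomputable def Ad (G L : PDO A) : PDO A := G * L * Ring.inverse G

end PDO

open PDO

/-- `L = ∂ₓ + u₂ ∂ₓ⁻¹ + u₃ ∂ₓ⁻² + ⋯` is a solution of the KP hierarchy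
`∂L/∂tₙ = [Bₙ, L]`, `Bₙ = (Lⁿ)_{≥ 0}`, `n = 2, 3, …`. -/
structure IsKPSolution (L : PDO A) : Prop where
  coeff_gt_one : ∀ n : ℤ, 1 < n → L.coeff n = 0
  coeff_one : L.coeff 1 = 1
  coeff_zero : L.coeff 0 = 0
  lax : ∀ n : ℕ+, 2 ≤ n → dt n L = plus (L ^ (n : ℕ)) * L - L * plus (L ^ (n : ℕ))

/-- `W = 1 + w₁ ∂ₓ⁻¹ + w₂ ∂ₓ⁻² + ⋯` is a wave operator of `L`: `L = W ∂ₓ W⁻¹`, and `W` satisfies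
the Sato–Wilson equation `∂W/∂tₙ = Bₙ W - W ∂ₓⁿ`, `Bₙ = (W ∂ₓⁿ W⁻¹)_{≥ 0}`, `n = 2, 3, …`. -/
structure IsWaveOperator (W L : PDO A) : Prop where
  coeff_pos : ∀ n : ℤ, 0 < n → W.coeff n = 0
  coeff_zero : W.coeff 0 = 1
  lax_eq : L = Ad W D
  satoWilson : ∀ n : ℕ+, 2 ≤ n → dt n W = plus (Ad W (D ^ (n : ℕ))) * W - W * D ^ (n : ℕ)

/-- The operator-valued power series `-∑_{n ≥ 1} (zⁿ / n) ∂/∂tₙ`. -/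
noncomputable def shiftGenerator (A : Type*) [CommRing A] [Algebra ℚ A] [FlowAlgebra A] :
    PowerSeries (Module.End ℚ A) :=
  PowerSeries.mk fun n =>
    if h : 0 < n then -((1 / n : ℚ) • (FlowAlgebra.d ⟨n, h⟩ : Derivation ℚ A A).toLinearMap) else 0

/-- The coefficient of `zʲ = λ⁻ʲ` in the formal Taylor expansion
`f(x - λ⁻¹, t - [λ⁻¹]) = exp(-∑_{n ≥ 1} (zⁿ / n) ∂/∂tₙ) f`, where
`t - [λ⁻¹] = (t₂ - λ⁻² / 2, t₃ - λ⁻³ / 3, …)`. The `k`-th power of the generator starts with `zᵏ`,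
so only `k ≤ j` contributes. -/
noncomputable def shiftCoeff (j : ℕ) (f : A) : A :=
  ∑ k ∈ Finset.range (j + 1),
    (1 / k.factorial : ℚ) • (PowerSeries.coeff j (shiftGenerator A ^ k)) f

/-- `τ` is a `τ`-function corresponding to `W = 1 + ∑ wⱼ ∂ₓ⁻ʲ`: `τ` is invertible and
`1 + ∑ wⱼ λ⁻ʲ = τ(x - λ⁻¹, t - [λ⁻¹]) / τ(x, t)` as formal power series in `λ⁻¹`. -/
structure IsTauOfWave (W : PDO A) (τ : A) : Prop where
  isUnit : IsUnit τ
  coeff_eq : ∀ j : ℕ, W.coeff (-(j : ℤ)) = shiftCoeff j τ * Ring.inverse τ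

/-- `τ` is a `τ`-function corresponding to `L`. -/
def IsTauFunction (L : PDO A) (τ : A) : Prop :=
  ∃ W : PDO A, IsWaveOperator W L ∧ IsTauOfWave W τ

/-- `φ` is an eigenfunction of `L`: `∂φ/∂tₙ = Bₙ φ` with `Bₙ = (Lⁿ)_{≥ 0}`, `n = 2, 3, …`. -/
def IsEigenfunction (L : PDO A) (φ : A) : Prop :=
  ∀ n : ℕ+, 2 ≤ n → FlowAlgebra.d n φ = act (plus (L ^ (n : ℕ))) φ

/-- The operator `G_φ = φ ∂ₓ φ⁻¹ = ∂ₓ - φ' / φ` of the elementary Darboux transformation. -/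
noncomputable def elementaryDarboux (φ : A) : PDO A := C φ * D * C (Ring.inverse φ)

/-- The operator `G_N = G_{φ_N^{[N-1,…,1]}} ⋯ G_{φ₂^{[1]}} G_{φ₁}` of the `N`-fold iterated Darboux
transformation, where `φ_k^{[k-1,…,1]} = G_{k-1} φ_k`. -/
noncomputable def darboux : (N : ℕ) → (Fin N → A) → PDO A
  | 0, _ => 1
  | N + 1, φ =>
    elementaryDarboux (act (darboux N fun i => φ i.castSucc) (φ (Fin.last N))) *
      darboux N fun i => φ i.castSucc

/-- The iterated Darboux transformation is defined: each `φ_k^{[k-1,…,1]}` is invertible. -/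
def DarbouxDefined : (N : ℕ) → (Fin N → A) → Prop
  | 0, _ => True
  | N + 1, φ =>
    DarbouxDefined N (fun i => φ i.castSucc) ∧
      IsUnit (act (darboux N fun i => φ i.castSucc) (φ (Fin.last N)))

/-- The Wronskian determinant `det(∂ₓʲ φᵢ)`. -/
def wronskian {N : ℕ} (φ : Fin N → A) : A :=
  (Matrix.of fun i j : Fin N => dx^[(j : ℕ)] (φ i)).det

end KPHierarchy

section EllipticFunctions

/-- The Weierstrass function `σ(z) = z ∏_{l ≠ 0} (1 - z / l) exp(z / l + z² / (2 l²))`. -/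
noncomputable def weierstrassSigma (Λ : PeriodPair) (z : ℂ) : ℂ := by
  classical exact z * ∏' l : Λ.lattice,
    if (l : ℂ) = 0 then 1 else (1 - z / l) * Complex.exp (z / l + z ^ 2 / (2 * (l : ℂ) ^ 2))

/-- The Weierstrass function `ζ = σ' / σ`. -/
noncomputable def weierstrassZeta (Λ : PeriodPair) (z : ℂ) : ℂ :=
  deriv (weierstrassSigma Λ) z / weierstrassSigma Λ z

/-- The coefficient `aₙ` in the Laurent expansion `℘(z) = z⁻² + ∑_{n ≥ 0} aₙ zⁿ` at `0`;
`weierstrassPExcept 0` is `℘(z) - z⁻²`, which is analytic at `0`. -/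
noncomputable def laurentCoeff (Λ : PeriodPair) (n : ℕ) : ℂ :=
  iteratedDeriv n (Λ.weierstrassPExcept 0) 0 / n.factorial

/-- The coefficients `q_{mn} = (-1)ᵐ (m + n - 2)! a_{m + n - 2} / ((m - 1)! (n - 1)!)`
for `m, n ≥ 1`. -/
noncomputable def quadraticCoeff (Λ : PeriodPair) (m n : ℕ) : ℂ :=
  (-1) ^ m * (m + n - 2).factorial * laurentCoeff Λ (m + n - 2) /
    ((m - 1).factorial * (n - 1).factorial)

/-- The coefficients `sₙ = (n / 2) ∑_{j = 1}^{n - 1} q_{n - j, j} / (j (n - j))`. -/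
noncomputable def linearCoeff (Λ : PeriodPair) (n : ℕ) : ℂ :=
  (n / 2 : ℂ) * ∑ j ∈ Finset.Ico 1 n, quadraticCoeff Λ (n - j) j / (j * (n - j : ℕ))

/-- The quadratic function `Q(x, t) = ½ ∑_{i, j ≥ 1} q_{ij} tᵢ tⱼ + ∑_{i ≥ 2} sᵢ tᵢ` with
`x = t₁` (note `s₁ = 0`). -/
noncomputable def quadraticQ (Λ : PeriodPair) (t : TimeSpace) : ℂ :=
  (1 / 2 : ℂ) * (t.sum fun i u => t.sum fun j v => quadraticCoeff Λ i j * u * v) +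
    t.sum fun i u => linearCoeff Λ i * u

/-- The Lamé function `Φ(x; k) = σ(x + k) / σ(x) · exp(-ζ(k) x)`. -/
noncomputable def lameFunction (Λ : PeriodPair) (k x : ℂ) : ℂ :=
  weierstrassSigma Λ (x + k) / weierstrassSigma Λ x * Complex.exp (-weierstrassZeta Λ k * x)

/-- The function
`Ψ(x, t; k) = Φ(x; k) exp(∑_{n ≥ 2} (℘⁽ⁿ⁻²⁾(k) / (n - 1)! - a_{n-2} / (n - 1)) tₙ)`. -/
noncomputable def lamePlaneWave (Λ : PeriodPair) (k : ℂ) (t : TimeSpace) : ℂ :=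
  lameFunction Λ k (t 1) * Complex.exp (t.sum fun n u =>
    if n = 1 then 0 else
      (iteratedDeriv (n - 2 : ℕ) Λ.weierstrassP k / ((n - 1 : ℕ).factorial : ℂ) -
        laurentCoeff Λ (n - 2 : ℕ) / (n - 1 : ℕ)) * u)

/-- The coefficient `v_{0,n}(x)` of `zⁿ = λ⁻ⁿ` in the Taylor expansion at `z = 0` of
`v̂₀(x; λ) = σ(x - z) / σ(x) · exp((ζ(z) - 1 / z) x)`; the function `ζ(z) - 1 / z` has a removable
singularity at `0` with value `0`. -/
noncomputable def stationaryWaveCoeff (Λ : PeriodPair) (n : ℕ) (x : ℂ) : ℂ := by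
  classical exact iteratedDeriv n (fun z : ℂ =>
    weierstrassSigma Λ (x - z) / weierstrassSigma Λ x *
      Complex.exp ((if z = 0 then 0 else weierstrassZeta Λ z - 1 / z) * x)) 0 / n.factorial

end EllipticFunctions

/-! ### Order filtration, differential operators and their action, inversion in the ring of
pseudo-differential operators -/

section PDOBasics

variable {A : Type*} [CommRing A] [Algebra ℚ A] [FlowAlgebra A]

namespace PDO

/-! Part 1 reduces to a single elementary Darboux step. Differentiating G φ = 0 in tₙ, with G = φ ∂
φ⁻¹, shows that the differential operator ∂ₙG + G Bₙ kills φ, hence is divisible by G on the right.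
The quotient differs from (Ad_G L)ⁿ by an operator of negative order, so it is the new Bₙ
(`darboux_intertwine`). This identity yields both the Sato–Wilson equation for G W ∂⁻¹ and the fact
that Gψ is again an eigenfunction; the Lax equation follows from Sato–Wilson
(`IsWaveOperator.isKPSolution`).

For the τ-function, put ŵ(z) = 1 + Σ wⱼ zʲ with z = λ⁻¹. The formal shift f(t − [z]) is the unique
series with constant term f that is killed by the derivation F = d/dz + Σ zⁿ ∂ₙ₊₁ of A⟦z⟧
(`eq_shiftSeries`); the kernel of a derivation is a subring, so the shift is multiplicative. The
operator G W ∂⁻¹ has series ŵ + z (∂ₓŵ − (φ'/φ) ŵ), so φτ is its τ-function once φ(t − [z]) = φ + z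
(φ p − φ') with p = ∂ₓ log ŵ. That difference equation (`IsEigenfunction.shiftSeries_eq`) holds
because F kills its right side, which is the generating-function form of a recursion for the Bₙ
(`IsWaveOperator.plus_pow_succ`). Under iteration the factors multiply up to the Wronskian: G_N is
monic of order N and kills φ₁, …, φ_N, so a column operation splits off one factor at a time
(`wronskian_succ`). Two τ-functions of one W differ by a shift-invariant unit, that is, by a unit
killed by every ∂ₙ.

For Part 2 it remains to produce a wave operator of L₀ with τ-function e^{-Q}σ, and to treat the Ψ.
The addition theorem for ζ, proved by Liouville's theorem, gives (∂² − 2℘) V₀ = V₀ ℘(∂⁻¹) and a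
third-order analogue for −℘'(∂⁻¹) (`second_order_intertwining`, `third_order_intertwining`). The
equation ℘'' = 6℘² − g₂/2 then produces differential operators Pₙ with Pₙ V₀ = V₀ (−1)ⁿ ℘⁽ⁿ⁾(∂⁻¹)
for all n (`exists_intertwinesP`). The combination P_m/(m+1)! − a_m/(m+1) is the conjugate by V₀ of
∂^{m+2} + Σⱼ (q_{j,m+2}/j) ∂⁻ʲ, so it equals the differential part of L₀^{m+2}, and the tail has
constant coefficients (`exists_plus_pow_eq`). Since V₀ depends on x only, V = V₀ exp(Σ_{n≥2} tₙ Σⱼ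
(q_{jn}/j) ∂⁻ʲ) satisfies Sato–Wilson, and it still dresses ∂ to L₀. Shifting e^{-Q} produces the
same exponents because Q is quadratic, so e^{-Q}σ corresponds to V. Finally the Lamé function is an
eigenvector of every Pₙ with eigenvalue ℘⁽ⁿ⁾(k), which makes Ψ an eigenfunction of L₀. -/

@[simp] theorem coeff_neg (P : PDO A) (n : ℤ) : (-P).coeff n = -P.coeff n := rfl

@[simp] theorem coeff_sub (P Q : PDO A) (n : ℤ) : (P - Q).coeff n = P.coeff n - Q.coeff n := rfl

/-- The coefficient of `∂ₓⁿ` as an additive map. -/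
def coeffHom (n : ℤ) : PDO A →+ A where
  toFun P := P.coeff n
  map_zero' := rfl
  map_add' _ _ := rfl

theorem coeff_sum {ι : Type*} (s : Finset ι) (f : ι → PDO A) (n : ℤ) :
    (∑ i ∈ s, f i).coeff n = ∑ i ∈ s, (f i).coeff n :=
  map_sum (coeffHom n) f s

theorem dx_zero : dx (0 : A) = 0 := by simp [dx]

theorem dx_one : dx (1 : A) = 0 := by simp [dx]

theorem dx_add (a b : A) : dx (a + b) = dx a + dx b := by simp [dx]

theorem dx_mul (a b : A) : dx (a * b) = dx a * b + a * dx b := by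
  simp only [dx, Derivation.leibniz, smul_eq_mul]; ring

theorem iterate_dx_of_dx_eq_zero {a : A} (h : dx a = 0) {r : ℕ} (hr : r ≠ 0) :
    dx^[r] a = 0 := by
  obtain ⟨s, rfl⟩ := Nat.exists_eq_succ_of_ne_zero hr
  rw [Function.iterate_succ_apply, h, iterate_dx_zero]

/-- `P` has order at most `a`. -/
def OrdLE (P : PDO A) (a : ℤ) : Prop := ∀ n, a < n → P.coeff n = 0

/-- `P` is a differential operator. -/
def IsDiff (P : PDO A) : Prop := ∀ n, n < 0 → P.coeff n = 0

theorem OrdLE.mono {P : PDO A} {a b : ℤ} (h : OrdLE P a) (hab : a ≤ b) : OrdLE P b :=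
  fun n hn => h n (by omega)

theorem OrdLE.sub {P Q : PDO A} {a : ℤ} (hP : OrdLE P a) (hQ : OrdLE Q a) : OrdLE (P - Q) a :=
  fun n hn => by rw [coeff_sub, hP n hn, hQ n hn, sub_zero]

theorem coeff_mul_eq_sum {P Q : PDO A} {a b : ℤ} (hP : OrdLE P a) (hQ : OrdLE Q b) (k : ℤ) :
    (P * Q).coeff k = ∑ m ∈ Finset.Icc (k - b) a, ∑ n ∈ Finset.Icc (k - a) b,
      term (P.coeff m) m (Q.coeff n) n k :=
  mulCoeff_eq_sum P Q k a b hP hQ _ _ subset_rfl subset_rfl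

theorem OrdLE.mul {P Q : PDO A} {a b : ℤ} (hP : OrdLE P a) (hQ : OrdLE Q b) :
    OrdLE (P * Q) (a + b) := fun k hk => by
  rw [coeff_mul_eq_sum hP hQ]
  refine Finset.sum_eq_zero fun m hm => Finset.sum_eq_zero fun n hn => ?_
  rw [Finset.mem_Icc] at hm hn
  omega

/-- In the top order no derivative falls on `Q`, so leading coefficients multiply as in a
commutative ring. -/
theorem coeff_mul_top {P Q : PDO A} {a b : ℤ} (hP : OrdLE P a) (hQ : OrdLE Q b) :
    (P * Q).coeff (a + b) = P.coeff a * Q.coeff b := by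
  rw [coeff_mul_eq_sum hP hQ]
  simp [term]

theorem ordLE_monomial (a : A) (n : ℤ) : OrdLE (monomial a n) n :=
  fun m hm => by rw [coeff_monomial, if_neg hm.ne']

theorem ordLE_zero (a : ℤ) : OrdLE (0 : PDO A) a := fun _ _ => rfl

theorem ordLE_one : OrdLE (1 : PDO A) 0 := ordLE_monomial 1 0

theorem OrdLE.pow {P : PDO A} {a : ℤ} (hP : OrdLE P a) (n : ℕ) : OrdLE (P ^ n) (n * a) := by
  induction n with
  | zero => simpa using ordLE_one
  | succ n ih =>
    rw [pow_succ]
    exact (ih.mul hP).mono (by push_cast; linarith)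

theorem IsDiff.add {P Q : PDO A} (hP : IsDiff P) (hQ : IsDiff Q) : IsDiff (P + Q) :=
  fun n hn => by rw [coeff_add, hP n hn, hQ n hn, add_zero]

theorem IsDiff.sub {P Q : PDO A} (hP : IsDiff P) (hQ : IsDiff Q) : IsDiff (P - Q) :=
  fun n hn => by rw [coeff_sub, hP n hn, hQ n hn, sub_zero]

theorem isDiff_zero : IsDiff (0 : PDO A) := fun _ _ => rfl

theorem isDiff_monomial (a : A) {n : ℤ} (hn : 0 ≤ n) : IsDiff (monomial a n) :=
  fun m hm => by rw [coeff_monomial, if_neg (by omega)]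

theorem isDiff_one : IsDiff (1 : PDO A) := isDiff_monomial 1 le_rfl

theorem isDiff_C (a : A) : IsDiff (C a) := isDiff_monomial a le_rfl

theorem isDiff_D : IsDiff (D : PDO A) := isDiff_monomial 1 zero_le_one

theorem IsDiff.sum {ι : Type*} (s : Finset ι) (f : ι → PDO A) (h : ∀ i ∈ s, IsDiff (f i)) :
    IsDiff (∑ i ∈ s, f i) :=
  fun n hn => by rw [coeff_sum]; exact Finset.sum_eq_zero fun i hi => h i hi n hn

theorem IsDiff.mul {P Q : PDO A} (hP : IsDiff P) (hQ : IsDiff Q) : IsDiff (P * Q) := by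
  obtain ⟨a, ha⟩ := P.exists_bound
  obtain ⟨b, hb⟩ := Q.exists_bound
  intro k hk
  rw [coeff_mul_eq_sum ha hb]
  refine Finset.sum_eq_zero fun m _ => Finset.sum_eq_zero fun n _ => ?_
  rcases lt_or_ge m 0 with hm | hm
  · rw [hP m hm, term_zero_left]
  rcases lt_or_ge n 0 with hn | hn
  · rw [hQ n hn, term_zero_right]
  rw [term, if_pos (by omega)]
  obtain ⟨m', rfl⟩ := Int.eq_ofNat_of_zero_le hm
  -- A negative total degree forces more derivatives than the order m ≥ 0 of the left factor, and
  -- then the binomial coefficient vanishes.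
  rw [Ring.choose_natCast, Nat.choose_eq_zero_of_lt (by omega)]
  simp

theorem IsDiff.pow {P : PDO A} (hP : IsDiff P) (n : ℕ) : IsDiff (P ^ n) := by
  induction n with
  | zero => simpa using isDiff_one
  | succ n ih => rw [pow_succ]; exact ih.mul hP

theorem coeff_C_mul (a : A) (P : PDO A) (k : ℤ) : (C a * P).coeff k = a * P.coeff k := by
  rw [coeff_mul, mulCoeff, finsum_eq_single _ ((0, 0) : ℤ × ℕ)]
  · simp [C, coeff_monomial]
  · rintro ⟨n, r⟩ h
    by_cases hn : n = 0
    · subst hn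
      have hr : 0 < r := Nat.pos_of_ne_zero fun hr => h (by rw [hr])
      simp [Ring.choose_zero_pos ℤ hr]
    · simp [C, coeff_monomial, hn]

/-- For a coefficient constant in x all Leibniz corrections vanish, so right multiplication only
shifts indices. -/
theorem coeff_mul_monomial {c : A} (hc : dx c = 0) (P : PDO A) (n k : ℤ) :
    (P * monomial c n).coeff k = P.coeff (k - n) * c := by
  rw [coeff_mul, mulCoeff, finsum_eq_single _ ((k - n, 0) : ℤ × ℕ)]
  · simp [coeff_monomial]
  · rintro ⟨m, r⟩ h
    by_cases hm : k - m + r = n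
    · have hr : r ≠ 0 := fun hr => h (by subst hr; simp; omega)
      simp only [hm, coeff_monomial, if_true, iterate_dx_of_dx_eq_zero hc hr, mul_zero, smul_zero]
    · simp [coeff_monomial, hm, iterate_dx_zero]

theorem coeff_D_mul (P : PDO A) (k : ℤ) :
    (D * P).coeff k = P.coeff (k - 1) + dx (P.coeff k) := by
  classical
  rw [coeff_mul, mulCoeff,
    finsum_eq_sum_of_support_subset (s := {((1 : ℤ), 0), ((1 : ℤ), 1)})]
  · rw [Finset.sum_pair (by simp)]
    simp [D, coeff_monomial]
  · rintro ⟨n, r⟩ h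
    rw [Function.mem_support] at h
    have hn : n = 1 := by
      by_contra hn
      exact h (by simp [D, coeff_monomial, hn])
    subst hn
    have hr : r < 2 := by
      by_contra hr
      apply h
      rw [← Nat.cast_one, Ring.choose_natCast, Nat.choose_eq_zero_of_lt (by omega)]
      simp
    interval_cases r <;> simp

theorem monomial_mul_monomial (a : A) (m : ℤ) {c : A} (hc : dx c = 0) (n : ℤ) :
    monomial a m * monomial c n = monomial (a * c) (m + n) := by
  ext k
  rw [coeff_mul_monomial hc, coeff_monomial, coeff_monomial]
  split_ifs <;> first | rfl | omega | simp

theorem C_mul_C (a b : A) : (C a : PDO A) * C b = C (a * b) := by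
  ext k
  rw [coeff_C_mul, C, C, coeff_monomial, coeff_monomial]
  split_ifs <;> simp

theorem C_one : (C 1 : PDO A) = 1 := rfl

theorem C_add (a b : A) : (C (a + b) : PDO A) = C a + C b := by
  ext k
  simp only [C, coeff_add, coeff_monomial]
  split_ifs <;> simp

theorem C_zero : (C 0 : PDO A) = 0 := by
  ext k
  simp [C, coeff_monomial]

theorem C_sub (a b : A) : (C (a - b) : PDO A) = C a - C b := by
  ext k
  simp only [C, coeff_sub, coeff_monomial]
  split_ifs <;> simp

theorem C_mul_comm_of_dx {c : A} (hc : dx c = 0) (P : PDO A) : C c * P = P * C c := by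
  ext k
  rw [coeff_C_mul, C, coeff_mul_monomial hc, sub_zero, mul_comm]

theorem D_mul_C (a : A) : (D : PDO A) * C a = C a * D + C (dx a) := by
  ext k
  rw [coeff_D_mul, coeff_add, coeff_C_mul]
  simp only [C, D, coeff_monomial]
  by_cases h0 : k = 0
  · subst h0; simp
  · by_cases h1 : k = 1
    · subst h1; simp [dx_zero]
    · have : k - 1 ≠ 0 := by omega
      simp [h0, h1, this, dx_zero]

theorem D_pow (n : ℕ) : (D : PDO A) ^ n = monomial 1 n := by
  induction n with
  | zero => rfl
  | succ n ih =>
    rw [pow_succ, ih, D, monomial_mul_monomial _ _ dx_one, mul_one]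
    congr 1

/-- The unit `∂ₓ` of the ring of pseudo-differential operators. -/
def unitMonomial (n : ℤ) : (PDO A)ˣ where
  val := monomial 1 n
  inv := monomial 1 (-n)
  val_inv := by rw [monomial_mul_monomial _ _ dx_one, mul_one, add_neg_cancel]; rfl
  inv_val := by rw [monomial_mul_monomial _ _ dx_one, mul_one, neg_add_cancel]; rfl

theorem isUnit_monomial (n : ℤ) : IsUnit (monomial (1 : A) n) := ⟨unitMonomial n, rfl⟩

theorem isUnit_D : IsUnit (D : PDO A) := isUnit_monomial 1

theorem isUnit_C {a : A} (ha : IsUnit a) : IsUnit (C a : PDO A) := by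
  obtain ⟨u, rfl⟩ := ha
  exact ⟨⟨C u, C ↑u⁻¹, by rw [C_mul_C, u.mul_inv, C_one], by rw [C_mul_C, u.inv_mul, C_one]⟩, rfl⟩

/-- The sum of the geometric series `∑ Nʲ` of an operator `N` of negative order. -/
noncomputable def geom (N : PDO A) : PDO A :=
  ⟨fun k => ∑ j ∈ Finset.range ((-k).toNat + 1), if k ≤ 0 then (N ^ j).coeff k else 0,
    0, fun k hk => by simp [not_le.mpr hk]⟩

/-- The power `N ^ j` has order at most -j, so only j ≤ -k contributes to the coefficient of ∂ᵏ.
This is what makes the infinite geometric series meaningful. -/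
theorem geom_sub {N : PDO A} (hN : OrdLE N (-1)) (K : ℕ) :
    OrdLE (geom N - ∑ j ∈ Finset.range (K + 1), N ^ j) (-K - 1) := by
  intro k hk
  rw [coeff_sub, coeff_sum]
  have hz : ∀ j : ℕ, -(j : ℤ) < k → (N ^ j).coeff k = 0 := fun j hj => hN.pow j k (by omega)
  have e : (geom N).coeff k =
      ∑ j ∈ Finset.range ((-k).toNat + 1), if k ≤ 0 then (N ^ j).coeff k else 0 := rfl
  rw [e]
  by_cases h : k ≤ 0
  · simp only [h, if_true]
    rw [sub_eq_zero]
    refine Finset.sum_subset (fun j hj => ?_) fun j _ hj => hz j ?_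
    · rw [Finset.mem_range] at *; omega
    · rw [Finset.mem_range] at hj; omega
  · simp only [h, if_false, Finset.sum_const_zero, zero_sub, neg_eq_zero]
    exact Finset.sum_eq_zero fun j _ => hz j (by omega)

/-- The order filtration is separated; limits of partial sums can therefore be compared modulo
arbitrarily negative order. -/
theorem eq_of_forall_ordLE {P Q : PDO A} (h : ∀ K : ℕ, OrdLE (P - Q) (-K)) : P = Q := by
  ext k
  rw [← sub_eq_zero, ← coeff_sub]
  exact h ((-k).toNat + 1) k (by omega)

theorem geom_mul {N : PDO A} (hN : OrdLE N (-1)) : geom N * (1 - N) = 1 := by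
  have h1 : OrdLE (1 - N) 0 := ordLE_one.sub (hN.mono (by omega))
  refine eq_of_forall_ordLE fun K => ?_
  have e : geom N * (1 - N) - 1 = (geom N - ∑ j ∈ Finset.range (K + 1), N ^ j) * (1 - N)
      - N ^ (K + 1) := by
    rw [sub_mul, geom_sum_mul_neg]; abel
  rw [e]
  refine OrdLE.sub (((geom_sub hN K).mul h1).mono (by omega)) ((hN.pow (K + 1)).mono ?_)
  push_cast; omega

theorem mul_geom {N : PDO A} (hN : OrdLE N (-1)) : (1 - N) * geom N = 1 := by
  have h1 : OrdLE (1 - N) 0 := ordLE_one.sub (hN.mono (by omega))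
  refine eq_of_forall_ordLE fun K => ?_
  have e : (1 - N) * geom N - 1 = (1 - N) * (geom N - ∑ j ∈ Finset.range (K + 1), N ^ j)
      - N ^ (K + 1) := by
    rw [mul_sub, mul_neg_geom_sum]; abel
  rw [e]
  refine OrdLE.sub ((h1.mul (geom_sub hN K)).mono (by omega)) ((hN.pow (K + 1)).mono ?_)
  push_cast; omega

/-- `P = 1 + O(∂ₓ⁻¹)`. -/
def IsMonic (P : PDO A) : Prop := OrdLE P 0 ∧ P.coeff 0 = 1

theorem IsMonic.sub_one {P : PDO A} (h : IsMonic P) : OrdLE (1 - P) (-1) := by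
  intro n hn
  rcases eq_or_ne n 0 with rfl | h0
  · rw [coeff_sub, h.2, one_def, coeff_monomial]; simp
  · rw [coeff_sub, h.1 n (by omega), one_def, coeff_monomial, if_neg h0, sub_zero]

theorem IsMonic.isUnit {P : PDO A} (h : IsMonic P) : IsUnit P := by
  have e : P = 1 - (1 - P) := by abel
  rw [e]
  exact ⟨⟨_, _, mul_geom h.sub_one, geom_mul h.sub_one⟩, rfl⟩

theorem isMonic_one : IsMonic (1 : PDO A) := ⟨ordLE_one, by simp [one_def, coeff_monomial]⟩

theorem IsMonic.mul {P Q : PDO A} (hP : IsMonic P) (hQ : IsMonic Q) : IsMonic (P * Q) :=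
  ⟨hP.1.mul hQ.1, by simpa [hP.2, hQ.2] using coeff_mul_top hP.1 hQ.1⟩

/-- The inverse is the geometric series in 1 - P, whose partial sum modulo order -1 is 1.
Consequently conjugation by a monic operator does not raise orders. -/
theorem IsMonic.inverse {P : PDO A} (h : IsMonic P) : IsMonic (Ring.inverse P) := by
  have e : Ring.inverse P = geom (1 - P) := by
    have h1 := geom_mul h.sub_one
    rw [sub_sub_cancel] at h1
    have h2 := congrArg (· * Ring.inverse P) h1
    simp only [mul_assoc, Ring.mul_inverse_cancel _ h.isUnit, mul_one, one_mul] at h2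
    exact h2.symm
  rw [e]
  have := geom_sub h.sub_one 0
  simp only [zero_add, Finset.range_one, Finset.sum_singleton, pow_zero, Nat.cast_zero, neg_zero,
    zero_sub] at this
  constructor
  · intro n hn
    have h1 := this n (by omega)
    rwa [coeff_sub, ordLE_one n hn, sub_zero] at h1
  · have h1 := this 0 (by omega)
    rw [coeff_sub, isMonic_one.2] at h1
    exact sub_eq_zero.mp h1

theorem d_comm_iterate (n : ℕ+) (r : ℕ) (a : A) :
    FlowAlgebra.d n (dx^[r] a) = dx^[r] (FlowAlgebra.d n a) := by
  induction r generalizing a with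
  | zero => rfl
  | succ r ih =>
    rw [Function.iterate_succ_apply, ih, Function.iterate_succ_apply]
    congr 1
    exact FlowAlgebra.d_comm _ _ _

@[simp] theorem coeff_dt (n : ℕ+) (P : PDO A) (k : ℤ) :
    (dt n P).coeff k = FlowAlgebra.d n (P.coeff k) := rfl

theorem OrdLE.dt {P : PDO A} {a : ℤ} (h : OrdLE P a) (n : ℕ+) : OrdLE (dt n P) a :=
  fun k hk => by rw [coeff_dt, h k hk, map_zero]

theorem dt_term (i : ℕ+) (a : A) (m : ℤ) (b : A) (n k : ℤ) :
    FlowAlgebra.d i (term a m b n k) =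
      term (FlowAlgebra.d i a) m b n k + term a m (FlowAlgebra.d i b) n k := by
  unfold term
  split_ifs
  · rw [map_zsmul, Derivation.leibniz, d_comm_iterate, ← smul_add, smul_eq_mul, smul_eq_mul]
    congr 1
    ring
  · simp

theorem dt_mul (i : ℕ+) (P Q : PDO A) : dt i (P * Q) = dt i P * Q + P * dt i Q := by
  obtain ⟨a, ha⟩ := P.exists_bound
  obtain ⟨b, hb⟩ := Q.exists_bound
  ext k
  rw [coeff_dt, coeff_add, coeff_mul_eq_sum ha hb, coeff_mul_eq_sum (OrdLE.dt ha i) hb,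
    coeff_mul_eq_sum ha (OrdLE.dt hb i), map_sum, ← Finset.sum_add_distrib]
  refine Finset.sum_congr rfl fun m _ => ?_
  rw [map_sum, ← Finset.sum_add_distrib]
  exact Finset.sum_congr rfl fun n _ => dt_term _ _ _ _ _ _

theorem dt_monomial (i : ℕ+) (a : A) (n : ℤ) :
    dt i (monomial a n) = monomial (FlowAlgebra.d i a) n := by
  ext k
  rw [coeff_dt, coeff_monomial, coeff_monomial]
  split_ifs <;> simp

theorem dt_monomial_one (i : ℕ+) (n : ℤ) : dt i (monomial (1 : A) n) = 0 := by
  rw [dt_monomial]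
  ext k
  simp [coeff_monomial]

theorem coeff_plus (P : PDO A) (n : ℤ) : (plus P).coeff n = if 0 ≤ n then P.coeff n else 0 := rfl

theorem isDiff_plus (P : PDO A) : IsDiff (plus P) :=
  fun n hn => by rw [coeff_plus, if_neg (by omega)]

theorem ordLE_sub_plus (P : PDO A) : OrdLE (P - plus P) (-1) :=
  fun n hn => by rw [coeff_sub, coeff_plus, if_pos (by omega), sub_self]

theorem plus_eq_of {P Q : PDO A} (hQ : IsDiff Q) (h : OrdLE (P - Q) (-1)) : plus P = Q := by
  ext n
  rw [coeff_plus]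
  split_ifs with hn
  · have := h n (by omega)
    rwa [coeff_sub, sub_eq_zero] at this
  · rw [hQ n (by omega)]

theorem plus_eq_of_ordLE {P : PDO A} (h : OrdLE P (-1)) : plus P = 0 :=
  plus_eq_of isDiff_zero (by rwa [sub_zero])

theorem plus_sub (P Q : PDO A) : plus (P - Q) = plus P - plus Q := by
  ext n
  simp only [coeff_plus, coeff_sub]
  split_ifs <;> simp

theorem IsDiff.plus_eq {P : PDO A} (h : IsDiff P) : plus P = P :=
  plus_eq_of h (by rw [sub_self]; exact ordLE_zero _)

/-- In P ∘ f the coefficient of ∂⁰ collects the terms in which all derivatives fall on f. Expressing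
the action through the ring product lets associativity and the Leibniz rule do the later work. -/
theorem act_eq (P : PDO A) (f : A) : act P f = (P * C f).coeff 0 := by
  have hinj : Function.Injective (fun n : ℕ => ((n : ℤ), n)) := fun a b h => by simpa using h
  have hsupp : Function.support (fun p : ℤ × ℕ => Ring.choose p.1 p.2 •
      (P.coeff p.1 * dx^[p.2] ((C f).coeff (0 - p.1 + p.2)))) ⊆
      Set.range fun n : ℕ => ((n : ℤ), n) := by
    rintro ⟨n, r⟩ h
    by_contra hc
    refine h ?_
    have : 0 - n + (r : ℤ) ≠ 0 := fun h0 => hc ⟨r, by simp; omega⟩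
    simp only [C, coeff_monomial, if_neg this, iterate_dx_zero, mul_zero, smul_zero]
  rw [act, coeff_mul, mulCoeff, ← Set.indicator_eq_self.mpr hsupp, ← finsum_mem_def,
    finsum_mem_range hinj]
  refine finsum_congr fun n => ?_
  simp [C, coeff_monomial, Ring.choose_natCast]

/-- Right division by ∂: after the constant term is removed, multiplication by ∂⁻¹ leaves a
differential operator. -/
theorem IsDiff.exists_eq {M : PDO A} (h : IsDiff M) :
    ∃ M' : PDO A, IsDiff M' ∧ M = C (M.coeff 0) + M' * D := by
  refine ⟨(M - C (M.coeff 0)) * monomial 1 (-1), fun n hn => ?_, ?_⟩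
  · rw [coeff_mul_monomial dx_one, coeff_sub, C, coeff_monomial]
    split_ifs with h0
    · rw [h0]; ring
    · rw [h _ (by omega)]; ring
  · rw [mul_assoc, D, monomial_mul_monomial _ _ dx_one, mul_one, neg_add_cancel, ← one_def,
      mul_one]
    abel

theorem coeff_zero_mul_D {M : PDO A} (h : IsDiff M) : (M * D).coeff 0 = 0 := by
  rw [D, coeff_mul_monomial dx_one, h _ (by omega), zero_mul]

/-- Write Q ∘ f as (Q f) + M ∂ with M differential. Composing with P on the left, the part ending in
∂ has no constant term and does not contribute. -/
theorem act_mul {P Q : PDO A} (hP : IsDiff P) (hQ : IsDiff Q) (f : A) :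
    act (P * Q) f = act P (act Q f) := by
  obtain ⟨M, hM, e⟩ := (hQ.mul (isDiff_C f)).exists_eq
  rw [act_eq, act_eq, act_eq, mul_assoc]
  conv_lhs => rw [e]
  rw [mul_add, coeff_add, ← mul_assoc, coeff_zero_mul_D (hP.mul hM), add_zero]

theorem act_add_left (P Q : PDO A) (f : A) : act (P + Q) f = act P f + act Q f := by
  simp only [act_eq, add_mul, coeff_add]

theorem act_sub_left (P Q : PDO A) (f : A) : act (P - Q) f = act P f - act Q f := by
  simp only [act_eq, sub_mul, coeff_sub]

theorem act_sum_left {ι : Type*} (s : Finset ι) (P : ι → PDO A) (f : A) :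
    act (∑ i ∈ s, P i) f = ∑ i ∈ s, act (P i) f := by
  simp only [act_eq, Finset.sum_mul, coeff_sum]

theorem act_C (a f : A) : act (C a) f = a * f := by
  rw [act_eq, C_mul_C, C, coeff_monomial, if_pos rfl]

theorem act_one (f : A) : act (1 : PDO A) f = f := by
  rw [← C_one, act_C, one_mul]

theorem act_add_right (P : PDO A) (f g : A) : act P (f + g) = act P f + act P g := by
  simp only [act_eq, C_add, mul_add, coeff_add]

theorem act_D (f : A) : act (D : PDO A) f = dx f := by
  rw [act_eq, D_mul_C, coeff_add, coeff_zero_mul_D (isDiff_C f), C, coeff_monomial, if_pos rfl,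
    zero_add]

theorem dt_C (i : ℕ+) (a : A) : dt i (C a) = C (FlowAlgebra.d i a) := dt_monomial i a 0

theorem d_act (i : ℕ+) (P : PDO A) (f : A) :
    FlowAlgebra.d i (act P f) = act (dt i P) f + act P (FlowAlgebra.d i f) := by
  rw [act_eq, ← coeff_dt, dt_mul, dt_C, coeff_add, ← act_eq, ← act_eq]

theorem ad_mul_ad {W : PDO A} (hW : IsUnit W) (P Q : PDO A) : Ad W (P * Q) = Ad W P * Ad W Q := by
  simp only [Ad, mul_assoc]
  rw [← mul_assoc (Ring.inverse W) W, Ring.inverse_mul_cancel _ hW, one_mul]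

theorem ad_pow {W : PDO A} (hW : IsUnit W) (P : PDO A) (n : ℕ) : Ad W (P ^ n) = Ad W P ^ n := by
  induction n with
  | zero => simp [Ad, Ring.mul_inverse_cancel _ hW]
  | succ n ih => rw [pow_succ, ad_mul_ad hW, ih, pow_succ]

theorem ad_mul_self {W : PDO A} (hW : IsUnit W) (P : PDO A) : Ad W P * W = W * P := by
  rw [Ad, mul_assoc, Ring.inverse_mul_cancel _ hW, mul_one]

theorem ad_ad {G W : PDO A} (hG : IsUnit G) (hW : IsUnit W) (P : PDO A) :
    Ad G (Ad W P) = Ad (G * W) P := by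
  have h : Ring.inverse (G * W) = Ring.inverse W * Ring.inverse G := by
    obtain ⟨u, rfl⟩ := hG
    obtain ⟨v, rfl⟩ := hW
    rw [← Units.val_mul, Ring.inverse_unit, Ring.inverse_unit, Ring.inverse_unit, mul_inv_rev,
      Units.val_mul]
  simp only [Ad, h, mul_assoc]

theorem eq_ad_of_mul {W P Q : PDO A} (hW : IsUnit W) (h : Q * W = W * P) : Q = Ad W P := by
  rw [Ad, ← h, mul_assoc, Ring.mul_inverse_cancel _ hW, mul_one]

end PDO

end PDOBasics

/-! ### The elementary Darboux transformation of wave operators and eigenfunctions -/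

section DarbouxStep

variable {A : Type*} [CommRing A] [Algebra ℚ A] [FlowAlgebra A]

open PDO

theorem IsWaveOperator.isMonic {W L : PDO A} (h : IsWaveOperator W L) : IsMonic W :=
  ⟨h.coeff_pos, h.coeff_zero⟩

theorem IsWaveOperator.isUnit {W L : PDO A} (h : IsWaveOperator W L) : IsUnit W :=
  h.isMonic.isUnit

theorem IsWaveOperator.pow_eq {W L : PDO A} (h : IsWaveOperator W L) (n : ℕ) :
    Ad W (D ^ n) = L ^ n := by
  rw [ad_pow h.isUnit, ← h.lax_eq]

theorem IsWaveOperator.mul_eq {W L : PDO A} (h : IsWaveOperator W L) : L * W = W * D := by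
  rw [h.lax_eq, ad_mul_self h.isUnit]

theorem PDO.coeff_D_mul_sub_mul_D (W : PDO A) (k : ℤ) :
    (D * W - W * D).coeff k = dx (W.coeff k) := by
  rw [coeff_sub, coeff_D_mul, D, coeff_mul_monomial dx_one]
  ring

theorem PDO.IsMonic.ordLE_D_mul_sub {W : PDO A} (h : IsMonic W) : OrdLE (D * W - W * D) (-1) := by
  intro k hk
  rw [coeff_D_mul_sub_mul_D]
  rcases eq_or_ne k 0 with rfl | h0
  · rw [h.2, dx_one]
  · rw [h.1 k (by omega), dx_zero]

/-- L - ∂ equals -[∂, W] W⁻¹, and the commutator differentiates coefficients, which kills the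
leading 1 of `W`. -/
theorem IsWaveOperator.ordLE_sub_D {W L : PDO A} (h : IsWaveOperator W L) :
    OrdLE (L - D) (-1) := by
  have e : L - D = -(D * W - W * D) * Ring.inverse W := by
    rw [neg_sub, ← h.mul_eq, ← sub_mul, mul_assoc, Ring.mul_inverse_cancel _ h.isUnit, mul_one]
  rw [e, neg_mul, ← zero_sub]
  refine (ordLE_zero _).sub ?_
  simpa using h.isMonic.ordLE_D_mul_sub.mul h.isMonic.inverse.1

/-- The Lax equation is the tₙ-derivative of L W = W ∂ with Sato–Wilson substituted and the
invertible `W` cancelled. Hence only wave operators need to be followed through Darboux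
transformations. -/
theorem IsWaveOperator.isKPSolution {W L : PDO A} (h : IsWaveOperator W L) :
    IsKPSolution L where
  coeff_gt_one n hn := by
    have := h.ordLE_sub_D n (by omega)
    rwa [coeff_sub, D, coeff_monomial, if_neg (by omega), sub_zero] at this
  coeff_one := by
    have := h.ordLE_sub_D 1 (by omega)
    rwa [coeff_sub, D, coeff_monomial, if_pos rfl, sub_eq_zero] at this
  coeff_zero := by
    have := h.ordLE_sub_D 0 (by omega)
    rwa [coeff_sub, D, coeff_monomial, if_neg (by omega), sub_zero] at this
  lax n hn := by
    have h1 := h.satoWilson n hn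
    rw [h.pow_eq] at h1
    have h2 := congrArg (dt n) h.mul_eq
    rw [dt_mul, dt_mul, h1] at h2
    have h3 : dt n (D : PDO A) = 0 := dt_monomial_one n 1
    rw [h3, mul_zero, add_zero] at h2
    have h4 : dt n L * W = (plus (L ^ (n : ℕ)) * L - L * plus (L ^ (n : ℕ))) * W := by
      rw [← sub_eq_zero]
      have e : dt n L * W - (plus (L ^ (n : ℕ)) * L - L * plus (L ^ (n : ℕ))) * W =
          dt n L * W + L * (plus (L ^ (n : ℕ)) * W - W * D ^ (n : ℕ))
          - plus (L ^ (n : ℕ)) * (L * W) + (L * W) * D ^ (n : ℕ) := by noncomm_ring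
      rw [e, h2, h.mul_eq]
      have e2 : W * D * D ^ (n : ℕ) = W * D ^ (n : ℕ) * D := by
        rw [mul_assoc, mul_assoc, ← pow_succ, ← pow_succ']
      rw [e2]
      noncomm_ring
    exact h.isUnit.mul_right_cancel h4

theorem isUnit_elementaryDarboux {φ : A} (h : IsUnit φ) : IsUnit (elementaryDarboux φ) :=
  ((isUnit_C h).mul isUnit_D).mul (isUnit_C h.ringInverse)

theorem dx_mul_inverse {φ : A} (h : IsUnit φ) :
    φ * dx (Ring.inverse φ) = -(dx φ * Ring.inverse φ) := by
  have := congrArg dx (Ring.mul_inverse_cancel φ h)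
  rw [dx_one, dx_mul] at this
  linear_combination this

theorem elementaryDarboux_eq {φ : A} (h : IsUnit φ) :
    elementaryDarboux φ = D - C (dx φ * Ring.inverse φ) := by
  rw [elementaryDarboux, mul_assoc, D_mul_C, mul_add, ← mul_assoc, C_mul_C, C_mul_C,
    Ring.mul_inverse_cancel _ h, C_one, one_mul, dx_mul_inverse h]
  rw [sub_eq_add_neg, add_right_inj, ← zero_sub, C_sub, C_zero, zero_sub]

theorem isDiff_elementaryDarboux (φ : A) : IsDiff (elementaryDarboux φ) :=
  ((isDiff_C φ).mul isDiff_D).mul (isDiff_C _)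

theorem ordLE_elementaryDarboux (φ : A) : OrdLE (elementaryDarboux φ) 1 := by
  simpa using! ((ordLE_monomial φ 0).mul (ordLE_monomial 1 1)).mul
    (ordLE_monomial (Ring.inverse φ) 0)

theorem coeff_one_elementaryDarboux {φ : A} (h : IsUnit φ) :
    (elementaryDarboux φ).coeff 1 = 1 := by
  rw [elementaryDarboux_eq h]
  simp [D, C, coeff_monomial]

theorem act_elementaryDarboux {φ : A} (h : IsUnit φ) (f : A) :
    act (elementaryDarboux φ) f = dx f - dx φ * Ring.inverse φ * f := by
  rw [elementaryDarboux_eq h, act_sub_left, act_D, act_C]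

theorem act_elementaryDarboux_self {φ : A} (h : IsUnit φ) : act (elementaryDarboux φ) φ = 0 := by
  rw [act_elementaryDarboux h, mul_assoc, Ring.inverse_mul_cancel _ h, mul_one, sub_self]

theorem ordLE_inverse_elementaryDarboux {φ : A} (h : IsUnit φ) :
    OrdLE (Ring.inverse (elementaryDarboux φ)) (-1) := by
  have e : Ring.inverse (elementaryDarboux φ) =
      C φ * monomial 1 (-1) * C (Ring.inverse φ) := by
    refine (isUnit_elementaryDarboux h).mul_left_cancel ?_
    rw [Ring.mul_inverse_cancel _ (isUnit_elementaryDarboux h), eq_comm]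
    have h1 : (C (Ring.inverse φ) : PDO A) * C φ = 1 := by
      rw [C_mul_C, Ring.inverse_mul_cancel _ h, C_one]
    have h2 : (C φ : PDO A) * C (Ring.inverse φ) = 1 := by
      rw [C_mul_C, Ring.mul_inverse_cancel _ h, C_one]
    have h3 : (D : PDO A) * monomial 1 (-1) = 1 := (unitMonomial 1).mul_inv
    calc elementaryDarboux φ * (C φ * monomial 1 (-1) * C (Ring.inverse φ))
        = C φ * D * (C (Ring.inverse φ) * C φ) * monomial 1 (-1) * C (Ring.inverse φ) := by
          simp only [elementaryDarboux, mul_assoc]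
      _ = C φ * (D * monomial 1 (-1)) * C (Ring.inverse φ) := by
          rw [h1, mul_one]; simp only [mul_assoc]
      _ = 1 := by rw [h3, mul_one, h2]
  rw [e]
  simpa using! ((ordLE_monomial φ 0).mul (ordLE_monomial 1 (-1))).mul
    (ordLE_monomial (Ring.inverse φ) 0)

/-- A differential operator that annihilates `φ` is divisible by `φ ∂ₓ φ⁻¹` on the right. -/
theorem exists_eq_mul_elementaryDarboux {φ : A} (h : IsUnit φ) {M : PDO A} (hM : IsDiff M)
    (h0 : act M φ = 0) : ∃ M' : PDO A, IsDiff M' ∧ M = M' * elementaryDarboux φ := by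
  obtain ⟨N, hN, e⟩ := (hM.mul (isDiff_C φ)).exists_eq
  rw [← act_eq, h0, C_zero, zero_add] at e
  refine ⟨N * C (Ring.inverse φ), hN.mul (isDiff_C _), ?_⟩
  have h1 : (C (Ring.inverse φ) : PDO A) * C φ = 1 := by
    rw [C_mul_C, Ring.inverse_mul_cancel _ h, C_one]
  have h2 : (C φ : PDO A) * C (Ring.inverse φ) = 1 := by
    rw [C_mul_C, Ring.mul_inverse_cancel _ h, C_one]
  calc M = M * C φ * C (Ring.inverse φ) := by rw [mul_assoc, h2, mul_one]
    _ = N * 1 * D * C (Ring.inverse φ) := by rw [e, mul_one]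
    _ = N * C (Ring.inverse φ) * elementaryDarboux φ := by
      rw [← h1]; simp only [elementaryDarboux, mul_assoc]

/-- The left side is a differential operator killing φ, hence a multiple M G of G. The quotient M is
identified by comparing orders: modulo negative order it agrees with the n-th power of the
transformed operator, so it must be its differential part. -/
theorem darboux_intertwine {L : PDO A} {φ : A} (hu : IsUnit φ) {n : ℕ+}
    (hφ : FlowAlgebra.d n φ = act (plus (L ^ (n : ℕ))) φ) :
    dt n (elementaryDarboux φ) + elementaryDarboux φ * plus (L ^ (n : ℕ)) =
      plus (Ad (elementaryDarboux φ) L ^ (n : ℕ)) * elementaryDarboux φ := by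
  set G := elementaryDarboux φ with hG
  have hGu : IsUnit G := isUnit_elementaryDarboux hu
  have hdt0 : OrdLE (dt n G) 0 := by
    intro k hk
    rcases eq_or_ne k 1 with rfl | h1
    · rw [coeff_dt, coeff_one_elementaryDarboux hu]; simp
    · rw [coeff_dt, ordLE_elementaryDarboux φ k (by omega), map_zero]
  have hdiff : IsDiff (dt n G + G * plus (L ^ (n : ℕ))) := by
    refine IsDiff.add (fun k hk => ?_) ((isDiff_elementaryDarboux φ).mul (isDiff_plus _))
    rw [coeff_dt, isDiff_elementaryDarboux φ k hk, map_zero]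
  -- This is the tₙ-derivative of G φ = 0, with the eigenfunction equation used for ∂ₙφ.
  have hact : act (dt n G + G * plus (L ^ (n : ℕ))) φ = 0 := by
    have := congrArg (FlowAlgebra.d n) (act_elementaryDarboux_self hu)
    rw [d_act, map_zero, hφ] at this
    rw [act_add_left, act_mul (isDiff_elementaryDarboux φ) (isDiff_plus _)]
    exact this
  obtain ⟨M, hM, e⟩ := exists_eq_mul_elementaryDarboux hu hdiff hact
  rw [e, plus_eq_of hM]
  have hpow : Ad G L ^ (n : ℕ) = G * L ^ (n : ℕ) * Ring.inverse G := by
    rw [← ad_pow hGu]; rfl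
  -- Both terms on the right have order at most -1: `L ^ n` is reduced to its negative part and G,
  -- G⁻¹ have orders 1 and -1, while ∂ₙG has order at most 0 because the leading coefficient of G is
  -- 1.
  have e2 : Ad G L ^ (n : ℕ) - M = G * (L ^ (n : ℕ) - plus (L ^ (n : ℕ))) * Ring.inverse G -
      dt n G * Ring.inverse G := by
    have : M = (dt n G + G * plus (L ^ (n : ℕ))) * Ring.inverse G := by
      rw [e, mul_assoc, Ring.mul_inverse_cancel _ hGu, mul_one]
    rw [hpow, this]
    noncomm_ring
  rw [e2]
  refine OrdLE.sub ?_ ?_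
  · simpa using ((ordLE_elementaryDarboux φ).mul (ordLE_sub_plus _)).mul
      (ordLE_inverse_elementaryDarboux hu)
  · simpa using hdt0.mul (ordLE_inverse_elementaryDarboux hu)

/-- The factor ∂⁻¹ restores a monic operator of order zero and commutes with ∂, so it changes
neither the dressed operator nor the form of the Sato–Wilson equation. -/
theorem IsWaveOperator.darbouxStep {W L : PDO A} (h : IsWaveOperator W L) {φ : A}
    (hu : IsUnit φ) (hφ : IsEigenfunction L φ) :
    IsWaveOperator (elementaryDarboux φ * W * monomial 1 (-1)) (Ad (elementaryDarboux φ) L) := by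
  set G := elementaryDarboux φ with hG
  have hGu : IsUnit G := isUnit_elementaryDarboux hu
  have hD : IsUnit (monomial (1 : A) (-1)) := isUnit_monomial _
  have hinv : (monomial (1 : A) (-1)) * D = 1 := (unitMonomial 1).inv_mul
  have hinv' : D * (monomial (1 : A) (-1)) = 1 := (unitMonomial 1).mul_inv
  have hcomm : ∀ n : ℕ, (D : PDO A) ^ n * monomial 1 (-1) = monomial 1 (-1) * D ^ n := fun n =>
    (Commute.pow_left (show Commute D (monomial (1 : A) (-1)) from by
      rw [Commute, SemiconjBy, hinv, hinv']) n)
  have hW1 : OrdLE (G * W) 1 := by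
    simpa using (ordLE_elementaryDarboux φ).mul h.isMonic.1
  have hU : IsUnit (G * W * monomial 1 (-1)) := (hGu.mul h.isUnit).mul hD
  have hLax : Ad G L = Ad (G * W * monomial 1 (-1)) D := by
    refine eq_ad_of_mul hU ?_
    rw [mul_assoc _ _ D, hinv, ← hinv', ← mul_assoc, ← mul_assoc (Ad G L), ad_mul_self hGu,
      ← mul_assoc, mul_assoc G L W, h.mul_eq, mul_assoc G W D]
  refine ⟨?_, ?_, hLax, fun n hn => ?_⟩
  · have := hW1.mul (ordLE_monomial 1 (-1))
    rwa [add_neg_cancel] at this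
  · have := coeff_mul_top hW1 (ordLE_monomial 1 (-1))
    have h1 := coeff_mul_top (ordLE_elementaryDarboux φ) h.isMonic.1
    rw [add_zero, coeff_one_elementaryDarboux hu, h.isMonic.2, mul_one] at h1
    rw [h1, coeff_monomial, if_pos rfl, mul_one] at this
    exact this
  · rw [ad_pow hU, ← hLax, dt_mul, dt_mul, dt_monomial_one, mul_zero, add_zero,
      h.satoWilson n hn, h.pow_eq]
    have h1 := darboux_intertwine hu (hφ n hn)
    rw [← hG] at h1
    have e : (dt n G * W + G * (plus (L ^ (n : ℕ)) * W - W * D ^ (n : ℕ))) =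
        (dt n G + G * plus (L ^ (n : ℕ))) * W - G * W * D ^ (n : ℕ) := by noncomm_ring
    rw [e, h1, sub_mul, mul_assoc (G * W) (D ^ (n : ℕ)), hcomm]
    simp only [mul_assoc]

/-- ∂ₙ(Gψ) = (∂ₙG + G Bₙ) ψ, and the intertwining relation for φ rewrites the bracket as the new Bₙ
times G. -/
theorem IsEigenfunction.darbouxStep {L : PDO A} {φ ψ : A} (hu : IsUnit φ)
    (hφ : IsEigenfunction L φ) (hψ : IsEigenfunction L ψ) :
    IsEigenfunction (Ad (elementaryDarboux φ) L) (act (elementaryDarboux φ) ψ) := by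
  intro n hn
  have h1 := darboux_intertwine hu (hφ n hn)
  rw [d_act, hψ n hn, ← act_mul (isDiff_elementaryDarboux φ) (isDiff_plus _), ← act_add_left, h1,
    act_mul (isDiff_plus _) (isDiff_elementaryDarboux φ)]

end DarbouxStep

/-! ### The formal Taylor shift as the kernel of a derivation of A⟦z⟧ -/

section FormalShift

open PowerSeries

/-- The coefficients of `exp G` satisfy the recursion given by `(exp G)' = G' exp G`. -/
theorem exp_coeff_recursion {K : Type*} [CommRing K] [Algebra ℚ K] (G : PowerSeries K)
    (hG : constantCoeff G = 0) (j : ℕ) :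
    ((j : ℚ) + 1) • ∑ k ∈ Finset.range (j + 2), (1 / k.factorial : ℚ) • coeff (j + 1) (G ^ k) =
      ∑ p ∈ Finset.HasAntidiagonal.antidiagonal j, (((p.1 : ℚ) + 1) • coeff (p.1 + 1) G) *
        ∑ k ∈ Finset.range (p.2 + 1), (1 / k.factorial : ℚ) • coeff p.2 (G ^ k) := by
  -- Powers of G gain one order of z each, so every truncated exponential sum may be extended to a
  -- common range and the two summations exchanged.
  have hz : ∀ m b : ℕ, b < m → coeff b (G ^ m) = 0 := fun m b h =>
    X_pow_dvd_iff.mp (pow_dvd_pow_of_dvd (X_dvd_iff.mpr hG) m) b h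
  have hd : ∀ (i : ℕ) (F : PowerSeries K), ((i : ℚ) + 1) • coeff (i + 1) F =
      coeff i (derivative K F) := fun i F => by
    rw [coeff_derivative, Algebra.smul_def]
    simp [mul_comm]
  have hS : ∀ b ≤ j, ∑ k ∈ Finset.range (b + 1), (1 / k.factorial : ℚ) • coeff b (G ^ k) =
      ∑ k ∈ Finset.range (j + 1), (1 / k.factorial : ℚ) • coeff b (G ^ k) := fun b hb => by
    refine Finset.sum_subset (fun k hk => ?_) fun k _ hk => ?_
    · rw [Finset.mem_range] at *; omega
    · rw [Finset.mem_range] at hk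
      rw [hz k b (by omega), smul_zero]
  have h1 : ∀ p ∈ Finset.HasAntidiagonal.antidiagonal j, (((p.1 : ℚ) + 1) • coeff (p.1 + 1) G) *
        ∑ k ∈ Finset.range (p.2 + 1), (1 / k.factorial : ℚ) • coeff p.2 (G ^ k) =
      ∑ k ∈ Finset.range (j + 1), (1 / k.factorial : ℚ) •
        (coeff p.1 (derivative K G) * coeff p.2 (G ^ k)) := fun p hp => by
    have := Finset.HasAntidiagonal.mem_antidiagonal.mp hp
    rw [hd, hS p.2 (by omega), Finset.mul_sum]
    exact Finset.sum_congr rfl fun k _ => mul_smul_comm _ _ _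
  rw [Finset.sum_congr rfl h1, Finset.sum_comm, Finset.sum_range_succ', smul_add, Finset.smul_sum]
  have h0 : ((j : ℚ) + 1) • (1 / (Nat.factorial 0) : ℚ) • coeff (j + 1) (G ^ 0) = 0 := by
    simp [coeff_one]
  rw [h0, add_zero]
  refine Finset.sum_congr rfl fun m _ => ?_
  rw [← Finset.smul_sum, ← coeff_mul, smul_comm, hd, Derivation.leibniz_pow]
  simp only [add_tsub_cancel_right, smul_eq_mul, map_nsmul]
  rw [mul_comm (G ^ m), ← Nat.cast_smul_eq_nsmul ℚ, smul_smul]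
  congr 1
  rw [Nat.factorial_succ]
  push_cast
  field_simp

variable {A : Type*} [CommRing A] [Algebra ℚ A]

theorem ratCast_smul_eq_mul (j : ℕ) (a : A) : ((j : ℚ) + 1) • a = a * (j + 1) := by
  rw [Algebra.smul_def]
  simp [mul_comm]

theorem mul_succ_cancel {j : ℕ} {a b : A} (h : a * (j + 1) = b * (j + 1)) : a = b := by
  rw [← ratCast_smul_eq_mul, ← ratCast_smul_eq_mul] at h
  have hj : ((j : ℚ) + 1) ≠ 0 := by positivity
  rw [← one_smul ℚ a, ← one_smul ℚ b, ← inv_mul_cancel₀ hj, mul_smul, mul_smul, h]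

variable [FlowAlgebra A]

theorem shiftCoeff_zero (f : A) : shiftCoeff 0 f = f := by
  simp [shiftCoeff]

/-- The endomorphism ring is noncommutative, whereas the rule (exp G)' = G' exp G is available over
commutative rings. The computation is therefore made in a commutative algebra `K` acting on `A` and
transported along ι. -/
theorem shiftCoeff_succ_of_hom {K : Type*} [CommRing K] [Algebra ℚ K]
    (ι : K →ₐ[ℚ] Module.End ℚ A) (dK : ℕ+ → K)
    (hd : ∀ n, ι (dK n) = (FlowAlgebra.d n : Derivation ℚ A A).toLinearMap) (j : ℕ) (f : A) :
    ((j : ℚ) + 1) • shiftCoeff (j + 1) f =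
      -∑ p ∈ Finset.HasAntidiagonal.antidiagonal j,
        FlowAlgebra.d (Nat.succPNat p.1) (shiftCoeff p.2 f) := by
  let G : PowerSeries K := PowerSeries.mk fun n =>
    if h : 0 < n then -((1 / n : ℚ) • dK ⟨n, h⟩) else 0
  have hG : shiftGenerator A = PowerSeries.map (ι : K →+* Module.End ℚ A) G := by
    ext1 n
    rw [shiftGenerator, coeff_mk, coeff_map, coeff_mk]
    split_ifs
    · simp only [RingHom.coe_coe, map_neg, map_smul]
      exact congrArg (fun T => -((1 / n : ℚ) • T)) (hd _).symm
    · simp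
  have hc : ∀ j k : ℕ, coeff j (shiftGenerator A ^ k) = ι (coeff j (G ^ k)) := fun j k => by
    rw [hG, ← map_pow, coeff_map]
    rfl
  have hS : ∀ j : ℕ, shiftCoeff j f =
      (ι (∑ k ∈ Finset.range (j + 1), (1 / k.factorial : ℚ) • coeff j (G ^ k))) f := fun j => by
    rw [shiftCoeff, map_sum, LinearMap.sum_apply]
    refine Finset.sum_congr rfl fun k _ => ?_
    rw [hc, map_smul]
    rfl
  have hG0 : constantCoeff G = 0 := by
    rw [← coeff_zero_eq_constantCoeff_apply, coeff_mk]
    simp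
  have e : ∀ m : ℕ, ((m : ℚ) + 1) • coeff (m + 1) G = -dK (Nat.succPNat m) := fun m => by
    rw [coeff_mk, dif_pos (Nat.succ_pos _), smul_neg, smul_smul]
    push_cast
    rw [mul_one_div_cancel (by positivity), one_smul]
    rfl
  have h := congrArg (fun a => ι a f) (exp_coeff_recursion G hG0 j)
  simp only [e] at h
  rw [map_smul, LinearMap.smul_apply, ← hS] at h
  rw [h, map_sum, LinearMap.sum_apply, ← Finset.sum_neg_distrib]
  refine Finset.sum_congr rfl fun p _ => ?_
  rw [hS p.2, map_mul, map_neg, hd]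
  rfl

open scoped IsMulCommutative in
-- The flows commute, so the algebra they generate inside the endomorphisms is commutative and can
-- serve as the auxiliary algebra.
theorem shiftCoeff_succ (j : ℕ) (f : A) :
    ((j : ℚ) + 1) • shiftCoeff (j + 1) f =
      -∑ p ∈ Finset.HasAntidiagonal.antidiagonal j,
        FlowAlgebra.d (Nat.succPNat p.1) (shiftCoeff p.2 f) := by
  set s : Set (Module.End ℚ A) :=
    Set.range fun n : ℕ+ => (FlowAlgebra.d n : Derivation ℚ A A).toLinearMap with hs
  have hcomm : ∀ a ∈ s, ∀ b ∈ s, a * b = b * a := by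
    rintro _ ⟨m, rfl⟩ _ ⟨n, rfl⟩
    exact LinearMap.ext fun a => FlowAlgebra.d_comm m n a
  have := Algebra.isMulCommutative_adjoin ℚ hcomm
  let dK : ℕ+ → Algebra.adjoin ℚ s := fun n =>
    ⟨(FlowAlgebra.d n : Derivation ℚ A A).toLinearMap, Algebra.subset_adjoin ⟨n, rfl⟩⟩
  exact shiftCoeff_succ_of_hom (Algebra.adjoin ℚ s).val dK (fun n => rfl) j f

/-- The coefficientwise action of a derivation on power series. -/
noncomputable def coeffDerivation (d : Derivation ℚ A A) :
    Derivation ℚ (PowerSeries A) (PowerSeries A) :=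
  Derivation.mk'
    { toFun := fun f => PowerSeries.mk fun n => d (coeff n f)
      map_add' := fun f g => by ext; simp
      map_smul' := fun q f => by ext; simp }
    (fun f g => by
      ext n
      simp only [LinearMap.coe_mk, AddHom.coe_mk, coeff_mk, coeff_mul, map_sum, map_add,
        Derivation.leibniz, smul_eq_mul, Finset.sum_add_distrib, mul_comm g]
      congr 1
      exact Finset.sum_congr rfl fun _ _ => mul_comm _ _)

@[simp] theorem coeff_coeffDerivation (d : Derivation ℚ A A) (f : PowerSeries A) (n : ℕ) :
    coeff n (coeffDerivation d f) = d (coeff n f) :=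
  coeff_mk n fun n => d (coeff n f)

/-- The series `∑_{n ≥ 0} zⁿ ∂ₙ₊₁ f`. -/
noncomputable def flowSum (f : PowerSeries A) : PowerSeries A :=
  PowerSeries.mk fun j => ∑ p ∈ Finset.HasAntidiagonal.antidiagonal j,
    FlowAlgebra.d (Nat.succPNat p.1) (coeff p.2 f)

/-- Each coefficient sees only finitely many flows, and a finite sum of derivations obeys the
Leibniz rule; the infinite sum inherits it coefficient by coefficient. -/
theorem coeff_flowSum (f : PowerSeries A) {j N : ℕ} (hN : j < N) :
    coeff j (flowSum f) = coeff j (∑ n ∈ Finset.range N,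
      X ^ n * coeffDerivation (FlowAlgebra.d (Nat.succPNat n)) f) := by
  rw [flowSum, coeff_mk, map_sum, Finset.Nat.sum_antidiagonal_eq_sum_range_succ_mk]
  simp only [coeff_X_pow_mul', coeff_coeffDerivation]
  rw [← Finset.sum_filter]
  refine Finset.sum_congr ?_ fun _ _ => rfl
  ext n
  simp only [Finset.mem_range, Finset.mem_filter]
  omega

/-- The derivation `d/dz + ∑_{n ≥ 0} zⁿ ∂ₙ₊₁` of `A⟦z⟧`. Its kernel consists of the shifted
elements `f(t - [z])`. -/
noncomputable def flowDerivation (A : Type*) [CommRing A] [Algebra ℚ A] [FlowAlgebra A] :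
    Derivation ℚ (PowerSeries A) (PowerSeries A) :=
  Derivation.mk'
    { toFun := fun f => derivative A f + flowSum f
      map_add' := fun f g => by
        ext j
        simp only [map_add, flowSum, coeff_mk, Finset.sum_add_distrib]
        ring
      map_smul' := fun q f => by
        ext j
        simp only [map_add, flowSum, coeff_mk, RingHom.id_apply, map_rat_smul,
          coeff_derivative, smul_add, Finset.smul_sum] }
    (fun f g => by
      ext j
      simp only [LinearMap.coe_mk, AddHom.coe_mk, Derivation.leibniz, smul_eq_mul]
      have key : coeff j (flowSum (f * g)) = coeff j (f * flowSum g + g * flowSum f) := by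
        rw [coeff_flowSum (f * g) (Nat.lt_succ_self j), map_add, coeff_mul, coeff_mul]
        have h : ∀ u v : PowerSeries A, ∑ p ∈ Finset.HasAntidiagonal.antidiagonal j,
            coeff p.1 u * coeff p.2 (flowSum v) = coeff j (u * ∑ n ∈ Finset.range (j + 1),
              X ^ n * coeffDerivation (FlowAlgebra.d (Nat.succPNat n)) v) := fun u v => by
          rw [coeff_mul]
          refine Finset.sum_congr rfl fun p hp => ?_
          have := Finset.HasAntidiagonal.mem_antidiagonal.mp hp
          rw [coeff_flowSum v (by omega : p.2 < j + 1)]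
        rw [h, h, ← map_add]
        congr 1
        rw [Finset.mul_sum, Finset.mul_sum, ← Finset.sum_add_distrib]
        refine Finset.sum_congr rfl fun n _ => ?_
        rw [Derivation.leibniz, smul_eq_mul, smul_eq_mul]
        ring
      rw [map_add, key, ← map_add]
      congr 1
      ring)

theorem flowDerivation_apply (f : PowerSeries A) :
    flowDerivation A f = derivative A f + flowSum f := rfl

theorem coeff_flowDerivation (f : PowerSeries A) (j : ℕ) :
    coeff j (flowDerivation A f) = coeff (j + 1) f * (j + 1) +
      ∑ p ∈ Finset.HasAntidiagonal.antidiagonal j,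
        FlowAlgebra.d (Nat.succPNat p.1) (coeff p.2 f) := by
  rw [flowDerivation_apply, map_add, coeff_derivative, flowSum, coeff_mk]

/-- The formal Taylor expansion `f(t - [z])`. -/
noncomputable def shiftSeries (f : A) : PowerSeries A := PowerSeries.mk fun j => shiftCoeff j f

@[simp] theorem coeff_shiftSeries (j : ℕ) (f : A) : coeff j (shiftSeries f) = shiftCoeff j f :=
  coeff_mk _ _

@[simp] theorem constantCoeff_shiftSeries (f : A) : constantCoeff (shiftSeries f) = f := by
  rw [← coeff_zero_eq_constantCoeff_apply, coeff_shiftSeries, shiftCoeff_zero]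

theorem flowDerivation_shiftSeries (f : A) : flowDerivation A (shiftSeries f) = 0 := by
  ext j
  rw [coeff_flowDerivation]
  simp only [coeff_shiftSeries]
  rw [← ratCast_smul_eq_mul, shiftCoeff_succ, neg_add_cancel, map_zero]

/-- A power series in the kernel of `d/dz + ∑ zⁿ ∂ₙ₊₁` is determined by its constant term. -/
theorem eq_of_flowDerivation_eq_zero {F G : PowerSeries A} (hF : flowDerivation A F = 0)
    (hG : flowDerivation A G = 0) (h : constantCoeff F = constantCoeff G) : F = G := by
  ext j
  induction j using Nat.strong_induction_on with
  | _ j ih =>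
    cases j with
    | zero => simpa using h
    | succ j =>
      have h1 := congrArg (coeff j) (hF.trans hG.symm)
      rw [coeff_flowDerivation, coeff_flowDerivation] at h1
      have h2 : ∑ p ∈ Finset.HasAntidiagonal.antidiagonal j,
          FlowAlgebra.d (Nat.succPNat p.1) (coeff p.2 F) =
          ∑ p ∈ Finset.HasAntidiagonal.antidiagonal j,
          FlowAlgebra.d (Nat.succPNat p.1) (coeff p.2 G) := by
        refine Finset.sum_congr rfl fun p hp => ?_
        have := Finset.HasAntidiagonal.mem_antidiagonal.mp hp
        rw [ih p.2 (by omega)]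
      rw [h2, add_left_inj] at h1
      exact mul_succ_cancel h1

/-- The working tool of the whole argument: to identify a shifted element it is enough to guess the
series, check that the derivation kills it and read off its constant term. -/
theorem eq_shiftSeries {F : PowerSeries A} (hF : flowDerivation A F = 0) :
    F = shiftSeries (constantCoeff F) :=
  eq_of_flowDerivation_eq_zero hF (flowDerivation_shiftSeries _) (by simp)

/-- A product of two elements in the kernel of a derivation lies in the kernel, and the constant
terms match. -/
theorem shiftSeries_mul (f g : A) : shiftSeries (f * g) = shiftSeries f * shiftSeries g := by
  refine eq_of_flowDerivation_eq_zero (flowDerivation_shiftSeries _) ?_ (by simp)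
  rw [Derivation.leibniz, flowDerivation_shiftSeries, flowDerivation_shiftSeries]
  simp

theorem flowDerivation_C (a : A) : flowDerivation A (PowerSeries.C a) =
    PowerSeries.mk fun n => FlowAlgebra.d (Nat.succPNat n) a := by
  ext j
  rw [coeff_flowDerivation, coeff_mk, Finset.sum_eq_single_of_mem ((j, 0) : ℕ × ℕ) (by simp)]
  · simp [coeff_C]
  · rintro ⟨m, n⟩ hp hne
    have := Finset.HasAntidiagonal.mem_antidiagonal.mp hp
    have hn : n ≠ 0 := by rintro rfl; simp at this; exact hne (by rw [this])
    simp [coeff_C, hn]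

theorem shiftSeries_eq_C {c : A} (hc : ∀ n, FlowAlgebra.d n c = 0) :
    shiftSeries c = PowerSeries.C c := by
  refine eq_of_flowDerivation_eq_zero (flowDerivation_shiftSeries _) ?_ (by simp)
  rw [flowDerivation_C]
  ext j
  simp [hc]

/-- On a constant series the derivation reads Σ zⁿ ∂ₙ₊₁c, so shift invariance forces every flow to
kill c. -/
theorem d_eq_zero_of_shiftSeries {c : A} (h : shiftSeries c = PowerSeries.C c) (n : ℕ+) :
    FlowAlgebra.d n c = 0 := by
  have h1 := flowDerivation_shiftSeries c
  rw [h, flowDerivation_C] at h1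
  have h2 := congrArg (coeff n.natPred) h1
  rw [coeff_mk, PNat.succPNat_natPred] at h2
  simpa using h2

theorem flowDerivation_coeffDerivation (n : ℕ+) (f : PowerSeries A) :
    flowDerivation A (coeffDerivation (FlowAlgebra.d n) f) =
      coeffDerivation (FlowAlgebra.d n) (flowDerivation A f) := by
  ext j
  simp only [coeff_flowDerivation, coeff_coeffDerivation, map_add, map_sum, Derivation.leibniz,
    smul_eq_mul]
  congr 1
  · have : (FlowAlgebra.d n : Derivation ℚ A A) ((j : A) + 1) = 0 := by simp
    simp [mul_comm]
  · exact Finset.sum_congr rfl fun p _ => FlowAlgebra.d_comm _ _ _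

end FormalShift

/-! ### The difference equation for eigenfunctions and the change of τ under a Darboux step -/

section TauStep

variable {A : Type*} [CommRing A] [Algebra ℚ A] [FlowAlgebra A]

open PDO

theorem PDO.coeff_mul_D_pow (P : PDO A) (n : ℕ) (k : ℤ) :
    (P * D ^ n).coeff k = P.coeff (k - n) := by
  rw [D_pow, coeff_mul_monomial dx_one, mul_one]

theorem PDO.plus_C_mul (a : A) (P : PDO A) : plus (C a * P) = C a * plus P := by
  ext k
  rw [coeff_plus, coeff_C_mul, coeff_C_mul, coeff_plus]
  split_ifs <;> simp

theorem PDO.plus_D_mul (P : PDO A) : plus (D * P) = D * plus P + C (P.coeff (-1)) := by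
  ext k
  rw [coeff_plus, coeff_D_mul, coeff_add, coeff_D_mul, coeff_plus, coeff_plus, C, coeff_monomial]
  rcases lt_trichotomy k 0 with h | h | h
  · rw [if_neg (by omega), if_neg (by omega), if_neg (by omega), if_neg (by omega), dx_zero]
    simp
  · subst h; simp [add_comm]
  · rw [if_pos (by omega), if_pos (by omega), if_pos (by omega), if_neg (by omega), add_zero]

theorem PDO.plus_sum {ι : Type*} (s : Finset ι) (f : ι → PDO A) :
    plus (∑ i ∈ s, f i) = ∑ i ∈ s, plus (f i) := by
  ext k
  simp only [coeff_plus, coeff_sum]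
  split_ifs <;> simp

/-- The power series `1 + ∑ wⱼ zʲ` of `W = 1 + ∑ wⱼ ∂ₓ⁻ʲ`. -/
noncomputable def waveSeries (W : PDO A) : PowerSeries A :=
  PowerSeries.mk fun j => W.coeff (-(j : ℤ))

@[simp] theorem coeff_waveSeries (W : PDO A) (j : ℕ) :
    PowerSeries.coeff j (waveSeries W) = W.coeff (-(j : ℤ)) := PowerSeries.coeff_mk _ _

/-- Clearing the denominator turns the coefficientwise definition into one identity of power series.
-/
theorem isTauOfWave_iff {W : PDO A} {τ : A} : IsTauOfWave W τ ↔
    IsUnit τ ∧ waveSeries W * PowerSeries.C τ = shiftSeries τ := by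
  refine ⟨fun h => ⟨h.isUnit, ?_⟩, fun h => ⟨h.1, fun j => ?_⟩⟩
  · ext j
    rw [PowerSeries.coeff_mul_C, coeff_waveSeries, coeff_shiftSeries, h.coeff_eq, mul_assoc,
      Ring.inverse_mul_cancel _ h.isUnit, mul_one]
  · have := congrArg (PowerSeries.coeff j) h.2
    rw [PowerSeries.coeff_mul_C, coeff_waveSeries, coeff_shiftSeries] at this
    rw [← this, mul_assoc, Ring.mul_inverse_cancel _ h.1, mul_one]

/-- The coefficientwise derivative `∂ₓ` of power series. -/
noncomputable abbrev dxSeries : Derivation ℚ (PowerSeries A) (PowerSeries A) :=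
  coeffDerivation (FlowAlgebra.d 1)

/-- If `∂ₓ ŵ = p ŵ`, then `∂ₓ = L + ∑ pᵢ L⁻ⁱ`, which gives a recursion for `(Lⁿ)_{≥ 0}`. -/
theorem IsWaveOperator.plus_pow_succ {W L : PDO A} (h : IsWaveOperator W L) {p : PowerSeries A}
    (hp : dxSeries (waveSeries W) = p * waveSeries W) (n : ℕ) :
    plus (L ^ (n + 1)) = D * plus (L ^ n) + C ((L ^ n).coeff (-1)) -
      ∑ q ∈ Finset.HasAntidiagonal.antidiagonal n,
        C (PowerSeries.coeff q.1 p) * plus (L ^ q.2) := by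
  have hLW : ∀ k : ℕ, L ^ k * W = W * D ^ k := fun k => by
    rw [← h.pow_eq, ad_mul_self h.isUnit]
  -- Multiplying by `W` replaces `L ^ k` by W ∂ᵏ. The series then becomes z⁻ⁿ times ∂ₓŵ minus the
  -- terms of p ŵ with index of p at most n, so only strictly positive powers of z, that is negative
  -- orders, survive.
  have hord : OrdLE ((D * L ^ n - L ^ (n + 1) - ∑ q ∈ Finset.HasAntidiagonal.antidiagonal n,
      C (PowerSeries.coeff q.1 p) * L ^ q.2) * W) (-1) := by
    intro j hj
    simp only [sub_mul, Finset.sum_mul, mul_assoc, hLW]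
    have e : D * (W * D ^ n) - W * D ^ (n + 1) = (D * W - W * D) * D ^ n := by
      rw [pow_succ', sub_mul, mul_assoc, mul_assoc]
    rw [e, coeff_sub, coeff_mul_D_pow, coeff_D_mul_sub_mul_D, coeff_sum]
    simp only [coeff_C_mul, coeff_mul_D_pow]
    rw [Finset.Nat.sum_antidiagonal_eq_sum_range_succ_mk]
    rcases lt_or_ge (n : ℤ) j with hnj | hnj
    · rw [h.isMonic.1 _ (by omega), dx_zero, Finset.sum_eq_zero, sub_zero]
      intro i hi
      rw [h.isMonic.1 _ (by omega), mul_zero]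
    · obtain ⟨l, hl⟩ : ∃ l : ℕ, (n : ℤ) - j = l := ⟨((n : ℤ) - j).toNat, by omega⟩
      have h1 := congrArg (PowerSeries.coeff l) hp
      rw [coeff_coeffDerivation, PowerSeries.coeff_mul, coeff_waveSeries,
        Finset.Nat.sum_antidiagonal_eq_sum_range_succ_mk] at h1
      have e2 : j - n = -(l : ℤ) := by omega
      rw [e2, dx, h1, sub_eq_zero]
      have : Finset.range l.succ ⊆ Finset.range n.succ := by
        intro i hi
        rw [Finset.mem_range] at *
        omega
      rw [← Finset.sum_subset this]
      · refine Finset.sum_congr rfl fun i hi => ?_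
        rw [Finset.mem_range] at hi
        rw [coeff_waveSeries]
        congr 2
        omega
      · intro i hi hi'
        rw [Finset.mem_range] at hi hi'
        rw [h.isMonic.1 _ (by omega), mul_zero]
  have hord2 := hord.mul h.isMonic.inverse.1
  rw [mul_assoc, Ring.mul_inverse_cancel _ h.isUnit, mul_one] at hord2
  have := plus_eq_of_ordLE hord2
  simp only [plus_sub, plus_sum, plus_C_mul, plus_D_mul] at this
  rw [sub_sub, sub_eq_zero] at this
  rw [this]
  abel

theorem IsWaveOperator.plus_self {W L : PDO A} (h : IsWaveOperator W L) : plus L = D :=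
  plus_eq_of isDiff_D h.ordLE_sub_D

/-- For n = 1 the Sato–Wilson equation is automatic, since the differential part of L is ∂. This
gives a form of the flows valid for every n ≥ 1, as the series in F requires. -/
theorem IsWaveOperator.dt_eq {W L : PDO A} (h : IsWaveOperator W L) (n : ℕ+) :
    dt n W = -((L ^ (n : ℕ) - plus (L ^ (n : ℕ))) * W) := by
  rcases eq_or_ne n 1 with rfl | hn
  · have : dt 1 W = D * W - W * D := by
      ext k
      rw [coeff_D_mul_sub_mul_D]
      rfl
    rw [this, PNat.one_coe, pow_one, h.plus_self, sub_mul, h.mul_eq]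
    abel
  · have h2 : 2 ≤ n := by
      have : (n : ℕ) ≠ 1 := fun h => hn (PNat.eq h)
      have := n.pos
      change 2 ≤ (n : ℕ)
      omega
    rw [h.satoWilson n h2, h.pow_eq, ← h.pow_eq, sub_mul, ad_mul_self h.isUnit, h.pow_eq]
    abel

/-- Compare coefficients of ∂⁻¹ in the Sato–Wilson equation: the negative part of `L ^ n` times the
monic `W` has the residue of `L ^ n` in that place. -/
theorem IsWaveOperator.d_coeff_neg_one {W L : PDO A} (h : IsWaveOperator W L) (n : ℕ+) :
    FlowAlgebra.d n (W.coeff (-1)) = -(L ^ (n : ℕ)).coeff (-1) := by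
  have h1 := coeff_mul_top (ordLE_sub_plus (L ^ (n : ℕ))) h.isMonic.1
  rw [add_zero, h.isMonic.2, mul_one, coeff_sub, coeff_plus, if_neg (by omega), sub_zero] at h1
  rw [← coeff_dt, h.dt_eq, coeff_neg, h1]

theorem IsEigenfunction.d_eq {W L : PDO A} (h : IsWaveOperator W L) {φ : A}
    (hφ : IsEigenfunction L φ) (n : ℕ+) :
    FlowAlgebra.d n φ = act (plus (L ^ (n : ℕ))) φ := by
  rcases eq_or_ne n 1 with rfl | hn
  · rw [PNat.one_coe, pow_one, h.plus_self, act_D]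
    rfl
  · have : (n : ℕ) ≠ 1 := fun h => hn (PNat.eq h)
    have := n.pos
    exact hφ n (show 2 ≤ (n : ℕ) by omega)

theorem flowDerivation_X : flowDerivation A PowerSeries.X = 1 := by
  ext j
  rw [coeff_flowDerivation, Finset.sum_eq_zero, add_zero, PowerSeries.coeff_X,
    PowerSeries.coeff_one]
  · by_cases hj : j = 0
    · simp [hj]
    · simp [hj]
  · rintro q _
    rw [PowerSeries.coeff_X]
    split_ifs <;> simp

theorem coeffDerivation_X (d : Derivation ℚ A A) : coeffDerivation d PowerSeries.X = 0 := by
  ext j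
  rw [coeff_coeffDerivation, PowerSeries.coeff_X]
  split_ifs <;> simp

theorem coeffDerivation_C (d : Derivation ℚ A A) (a : A) :
    coeffDerivation d (PowerSeries.C a) = PowerSeries.C (d a) := by
  ext j
  rw [coeff_coeffDerivation, PowerSeries.coeff_C, PowerSeries.coeff_C]
  split_ifs <;> simp

theorem isUnit_waveSeries {W : PDO A} (h : IsMonic W) : IsUnit (waveSeries W) := by
  rw [PowerSeries.isUnit_iff_constantCoeff, ← PowerSeries.coeff_zero_eq_constantCoeff_apply,
    coeff_waveSeries]
  simp [h.2]

theorem shiftCoeff_one (f : A) : shiftCoeff 1 f = -dx f := by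
  have := shiftCoeff_succ 0 f
  have e : Nat.succPNat 0 = 1 := rfl
  simpa [shiftCoeff_zero, dx, e] using this

/-- The difference equation for eigenfunctions: `φ(t - [z]) = φ + z (φ p - φ')` where
`p = ∂ₓ log ŵ`. -/
theorem IsEigenfunction.shiftSeries_eq {W L : PDO A} (h : IsWaveOperator W L) {τ φ : A}
    (hτ : IsTauOfWave W τ) (hφ : IsEigenfunction L φ) {p : PowerSeries A}
    (hp : dxSeries (waveSeries W) = p * waveSeries W) :
    shiftSeries φ = PowerSeries.C φ +
      PowerSeries.X * (PowerSeries.C φ * p - PowerSeries.C (dx φ)) := by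
  set F := flowDerivation A with hF
  have hT := (isTauOfWave_iff.mp hτ).2
  have hu := hτ.isUnit
  set T := shiftSeries τ with hTdef
  have hFT : F T = 0 := flowDerivation_shiftSeries τ
  have hTu : IsUnit T := by
    rw [← hT]
    exact (isUnit_waveSeries h.isMonic).mul (hu.map PowerSeries.C)
  have hw1 : W.coeff (-1) * τ = -dx τ := by
    have := congrArg (PowerSeries.coeff 1) hT
    rwa [PowerSeries.coeff_mul_C, coeff_waveSeries, coeff_shiftSeries, shiftCoeff_one] at this
  -- This is T p = ∂ₓT + w₁ T, obtained from T = ŵ τ and w₁ = -τ'/τ.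
  have hpT : T * p = dxSeries T + PowerSeries.C (W.coeff (-1)) * T := by
    rw [← hT, Derivation.leibniz, hp, smul_eq_mul, smul_eq_mul, coeffDerivation_C]
    have : PowerSeries.C (W.coeff (-1)) * PowerSeries.C τ = - PowerSeries.C (dx τ) := by
      rw [← map_mul, hw1, map_neg]
    have e : FlowAlgebra.d 1 τ = dx τ := rfl
    rw [e]
    linear_combination (-waveSeries W) * this
  -- F kills T and ∂ₓT, so applying F to the preceding relation leaves T F(p) = T F(w₁), and T is a
  -- unit.
  have hFp : F p = F (PowerSeries.C (W.coeff (-1))) := by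
    have := congrArg F hpT
    rw [map_add, Derivation.leibniz, Derivation.leibniz, hFT, flowDerivation_coeffDerivation,
      ← hF, hFT] at this
    simp only [smul_eq_mul, mul_zero, map_zero, add_zero, zero_add] at this
    exact hTu.mul_left_cancel this
  -- The generating series of Bₙφ. The eigenfunction equations turn it into φ + z F(φ).
  set b : PowerSeries A := PowerSeries.mk fun n => act (plus (L ^ n)) φ with hb
  have hb1 : b = PowerSeries.C φ + PowerSeries.X * F (PowerSeries.C φ) := by
    ext n
    rw [hb, PowerSeries.coeff_mk, hF, flowDerivation_C]
    cases n with
    | zero => simp [isDiff_one.plus_eq, act_one]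
    | succ n =>
      rw [map_add, PowerSeries.coeff_succ_X_mul, PowerSeries.coeff_mk, PowerSeries.coeff_C,
        if_neg (Nat.succ_ne_zero n), zero_add, hφ.d_eq h]
      rfl
  -- The recursion for Bₙ applied to φ, summed against zⁿ. The residues of `L ^ n` enter as the
  -- coefficients of -z F(p).
  have hb2 : F (PowerSeries.C φ) =
      dxSeries b - PowerSeries.X * F p * PowerSeries.C φ - p * b := by
    ext n
    have h1 : PowerSeries.coeff n (F (PowerSeries.C φ)) = act (plus (L ^ (n + 1))) φ := by
      rw [hF, flowDerivation_C, PowerSeries.coeff_mk, hφ.d_eq h]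
      rfl
    have h2 : PowerSeries.coeff n (PowerSeries.X * F p) = -(L ^ n).coeff (-1) := by
      cases n with
      | zero => simp [one_def, coeff_monomial]
      | succ n =>
        rw [PowerSeries.coeff_succ_X_mul, hFp, hF, flowDerivation_C, PowerSeries.coeff_mk,
          h.d_coeff_neg_one]
        rfl
    rw [h1, h.plus_pow_succ hp, act_sub_left, act_add_left, act_C,
      act_mul isDiff_D (isDiff_plus _), act_D, act_sum_left, map_sub, map_sub,
      coeff_coeffDerivation, PowerSeries.coeff_mul_C, h2, PowerSeries.coeff_mul]
    have h3 : ∀ q ∈ Finset.HasAntidiagonal.antidiagonal n,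
        act (C (PowerSeries.coeff q.1 p) * plus (L ^ q.2)) φ =
        PowerSeries.coeff q.1 p * PowerSeries.coeff q.2 b := fun q _ => by
      rw [act_mul (isDiff_C _) (isDiff_plus _), act_C, hb, PowerSeries.coeff_mk]
    rw [Finset.sum_congr rfl h3, hb, PowerSeries.coeff_mk, dx]
    ring
  rw [hb1] at hb2
  simp only [map_add, Derivation.leibniz, coeffDerivation_X, smul_eq_mul,
    coeffDerivation_C, mul_zero, add_zero] at hb2
  -- Expanding F by the Leibniz rule, with F(z) = 1, gives exactly the summed recursion.
  have key : F (PowerSeries.C φ +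
      PowerSeries.X * (PowerSeries.C φ * p - PowerSeries.C (dx φ))) = 0 := by
    have e1 : F (PowerSeries.C (dx φ)) = dxSeries (F (PowerSeries.C φ)) := by
      rw [hF, ← flowDerivation_coeffDerivation, coeffDerivation_C]
      rfl
    have e2 : F PowerSeries.X = 1 := flowDerivation_X
    have e3 : FlowAlgebra.d 1 φ = dx φ := rfl
    rw [e3] at hb2
    simp only [map_add, map_sub, Derivation.leibniz, smul_eq_mul, e1, e2]
    linear_combination hb2
  rw [eq_shiftSeries key]
  congr 1
  simp

/-- Multiplied by φτ, the series of the new wave operator becomes ŵτ · (φ + z(φp - φ')), which is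
the shift of τ times the shift of φ. -/
theorem IsTauOfWave.darbouxStep {W L : PDO A} (h : IsWaveOperator W L) {τ φ : A}
    (hτ : IsTauOfWave W τ) (hφ : IsEigenfunction L φ) (hu : IsUnit φ) :
    IsTauOfWave (elementaryDarboux φ * W * monomial 1 (-1)) (φ * τ) := by
  obtain ⟨v, hv⟩ := isUnit_waveSeries h.isMonic
  set p : PowerSeries A := dxSeries (waveSeries W) * ↑v⁻¹ with hpdef
  have hp : dxSeries (waveSeries W) = p * waveSeries W := by
    rw [hpdef, mul_assoc, ← hv, Units.inv_mul, mul_one]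
  have hT := isTauOfWave_iff.mp hτ
  refine isTauOfWave_iff.mpr ⟨hu.mul hT.1, ?_⟩
  have hw : waveSeries (elementaryDarboux φ * W * monomial 1 (-1)) = waveSeries W +
      PowerSeries.X * (dxSeries (waveSeries W) -
        PowerSeries.C (dx φ * Ring.inverse φ) * waveSeries W) := by
    ext j
    rw [coeff_waveSeries, coeff_mul_monomial dx_one, mul_one, elementaryDarboux_eq hu, sub_mul,
      coeff_sub, coeff_D_mul, coeff_C_mul, map_add, coeff_waveSeries]
    cases j with
    | zero =>
      have e1 : W.coeff 1 = 0 := h.isMonic.1 1 (by omega)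
      simp [e1, dx_zero]
    | succ j =>
      have e : -((j + 1 : ℕ) : ℤ) - -1 = -(j : ℤ) := by push_cast; ring
      have e' : -(j : ℤ) - 1 = -((j + 1 : ℕ) : ℤ) := by push_cast; ring
      rw [PowerSeries.coeff_succ_X_mul, map_sub, coeff_coeffDerivation, PowerSeries.coeff_C_mul,
        coeff_waveSeries, e, e', dx]
      ring
  have hm : ∀ a b : A, PowerSeries.C (a * b) = PowerSeries.C a * PowerSeries.C b := map_mul _
  have hi : PowerSeries.C (dx φ * Ring.inverse φ) * PowerSeries.C φ = PowerSeries.C (dx φ) := by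
    rw [← map_mul, mul_assoc, Ring.inverse_mul_cancel _ hu, mul_one]
  rw [shiftSeries_mul, hφ.shiftSeries_eq h hτ hp, ← hT.2, hw, hp, hm φ τ]
  linear_combination (-PowerSeries.X * waveSeries W * PowerSeries.C τ) * hi

/-- The quotient c of two τ-functions of the same `W` satisfies c(t − [z]) = c, which means that all
flows annihilate c. -/
theorem isTauOfWave_iff_of_isTauOfWave {W : PDO A} {τ : A} (h : IsTauOfWave W τ) (τ' : A) :
    IsTauOfWave W τ' ↔ ∃ c : A, IsUnit c ∧ (∀ n, FlowAlgebra.d n c = 0) ∧ τ' = c * τ := by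
  have hT := isTauOfWave_iff.mp h
  constructor
  · intro h'
    have hT' := isTauOfWave_iff.mp h'
    set c := τ' * Ring.inverse τ with hc
    have e : τ' = c * τ := by rw [hc, mul_assoc, Ring.inverse_mul_cancel _ h.isUnit, mul_one]
    have hcu : IsUnit c := hT'.1.mul h.isUnit.ringInverse
    refine ⟨c, hcu, fun n => d_eq_zero_of_shiftSeries ?_ n, e⟩
    have h1 := hT'.2
    rw [e, shiftSeries_mul, ← hT.2, map_mul] at h1
    have hu : IsUnit (waveSeries W * PowerSeries.C τ) := by
      rw [PowerSeries.isUnit_iff_constantCoeff, hT.2, constantCoeff_shiftSeries]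
      exact h.isUnit
    refine (hu.mul_right_cancel ?_).symm
    rw [← h1]
    ring
  · rintro ⟨c, hcu, hc, rfl⟩
    refine isTauOfWave_iff.mpr ⟨hcu.mul h.isUnit, ?_⟩
    rw [shiftSeries_mul, shiftSeries_eq_C hc, ← hT.2, map_mul]
    ring

end TauStep

/-! ### Iteration of Darboux steps and the Wronskian -/

section IteratedDarboux

variable {A : Type*} [CommRing A] [Algebra ℚ A] [FlowAlgebra A]

open PDO

theorem isDiff_darboux : ∀ (N : ℕ) (φ : Fin N → A), IsDiff (darboux N φ)
  | 0, _ => isDiff_one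
  | N + 1, _ => (isDiff_elementaryDarboux _).mul (isDiff_darboux N _)

theorem ordLE_darboux : ∀ (N : ℕ) (φ : Fin N → A), OrdLE (darboux N φ) N
  | 0, _ => by simpa using! ordLE_one
  | N + 1, _ =>
    ((ordLE_elementaryDarboux _).mul (ordLE_darboux N _)).mono (by push_cast; omega)

theorem coeff_darboux : ∀ (N : ℕ) (φ : Fin N → A), DarbouxDefined N φ →
    (darboux N φ).coeff N = 1
  | 0, _, _ => isMonic_one.2
  | N + 1, φ, h => by
    have := coeff_mul_top (ordLE_elementaryDarboux
      (act (darboux N fun i => φ i.castSucc) (φ (Fin.last N)))) (ordLE_darboux N fun i => φ i.castSucc)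
    rw [coeff_one_elementaryDarboux h.2, coeff_darboux N _ h.1, one_mul] at this
    rw [← this, darboux]
    congr 1
    push_cast
    ring

theorem isUnit_darboux : ∀ (N : ℕ) (φ : Fin N → A), DarbouxDefined N φ →
    IsUnit (darboux N φ)
  | 0, _, _ => isUnit_one
  | N + 1, _, h => (isUnit_elementaryDarboux h.2).mul (isUnit_darboux N _ h.1)

/-- The newest function is killed by the newest factor, the earlier ones already by the inner
operator. These N zeros make all but one entry of the modified Wronskian column vanish. -/
theorem act_darboux_eq_zero : ∀ (N : ℕ) (φ : Fin N → A), DarbouxDefined N φ → ∀ i,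
    act (darboux N φ) (φ i) = 0
  | 0, _, _, i => i.elim0
  | N + 1, φ, h, i => by
    rw [darboux, act_mul (isDiff_elementaryDarboux _) (isDiff_darboux N _)]
    refine Fin.lastCases ?_ (fun j => ?_) i
    · exact act_elementaryDarboux_self h.2
    · rw [act_darboux_eq_zero N (fun i => φ i.castSucc) h.1 j, act_elementaryDarboux h.2]
      simp [dx_zero]

theorem PDO.IsDiff.act_eq_sum {P : PDO A} {N : ℕ} (hN : OrdLE P N) (f : A) :
    act P f = ∑ n ∈ Finset.range (N + 1), P.coeff n * dx^[n] f := by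
  rw [act, finsum_eq_sum_of_support_subset]
  intro n hn
  simp only [Finset.coe_range, Set.mem_Iio]
  by_contra hc
  exact hn (by simp only [hN n (by omega), zero_mul])

/-- Factorization of the Wronskian determinant along the iterated Darboux transformation. -/
theorem wronskian_succ (N : ℕ) (φ : Fin (N + 1) → A) (h : DarbouxDefined N fun i => φ i.castSucc) :
    wronskian φ = act (darboux N fun i => φ i.castSucc) (φ (Fin.last N)) *
      wronskian fun i => φ i.castSucc := by
  set G := darboux N fun i => φ i.castSucc with hG
  set M : Matrix (Fin (N + 1)) (Fin (N + 1)) A :=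
    Matrix.of fun i j : Fin (N + 1) => dx^[(j : ℕ)] (φ i) with hM
  -- G is monic of order N, so its action on each φᵢ is the last column plus a combination of the
  -- earlier columns, and the determinant is unchanged.
  have h1 : M.det = (M.updateCol (Fin.last N) fun i => act G (φ i)).det := by
    have e : (fun i => act G (φ i)) =
        ∑ j : Fin (N + 1), G.coeff (j : ℕ) • M.col j := by
      funext i
      rw [IsDiff.act_eq_sum (ordLE_darboux N _), Finset.sum_range, Finset.sum_apply]
      rfl
    rw [e, Fin.sum_univ_castSucc, add_comm (∑ _, _)]
    have hlast : G.coeff ((Fin.last N : Fin (N + 1)) : ℕ) = 1 := coeff_darboux N _ h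
    rw [hlast, one_smul]
    have : ∀ s : Finset (Fin N), (M.updateCol (Fin.last N) (M.col (Fin.last N) +
        ∑ j ∈ s, G.coeff ((j.castSucc : Fin (N + 1)) : ℕ) • M.col j.castSucc)).det = M.det := by
      intro s
      induction s using Finset.induction_on with
      | empty =>
        rw [Finset.sum_empty, add_zero]
        congr 1
        exact Matrix.updateCol_eq_self M _
      | insert j s hj ih =>
        rw [Finset.sum_insert hj, add_comm (G.coeff _ • _), ← add_assoc,
          Matrix.det_updateCol_add, ih, Matrix.det_updateCol_smul,
          Matrix.det_zero_of_column_eq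
            (M := M.updateCol (Fin.last N) (M.col j.castSucc)) (Fin.castSucc_lt_last j).ne,
          mul_zero, add_zero]
        intro k
        rw [Matrix.updateCol_self, Matrix.updateCol_ne (Fin.castSucc_lt_last j).ne]
        rfl
    rw [this]
  -- Expansion along the modified column: only the corner entry survives, and its sign is +1.
  rw [wronskian, ← hM, h1, Matrix.det_succ_column _ (Fin.last N), Fin.sum_univ_castSucc,
    Finset.sum_eq_zero, zero_add]
  · rw [Matrix.updateCol_self]
    have e : Even ((Fin.last N : ℕ) + (Fin.last N : ℕ)) := ⟨_, rfl⟩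
    rw [e.neg_one_pow, one_mul]
    congr 1
    rw [wronskian]
    congr 1
    ext i j
    simp [hM, Fin.succAbove_last, (Fin.castSucc_lt_last j).ne]
  · intro i _
    rw [Matrix.updateCol_self, act_darboux_eq_zero N _ h i]
    simp

theorem wronskian_zero (φ : Fin 0 → A) : wronskian φ = 1 := Matrix.det_isEmpty

/-- The iterated Darboux transformation of a wave operator, its `τ`-function, and the remaining
eigenfunctions. -/
theorem darboux_main {L W : PDO A} {τ : A} (hW : IsWaveOperator W L) (hτ : IsTauOfWave W τ) :
    ∀ (N : ℕ) (φ : Fin N → A), (∀ i, IsEigenfunction L (φ i)) → DarbouxDefined N φ →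
      IsWaveOperator (darboux N φ * W * monomial 1 (-(N : ℤ))) (Ad (darboux N φ) L) ∧
      IsTauOfWave (darboux N φ * W * monomial 1 (-(N : ℤ))) (wronskian φ * τ) ∧
      ∀ ψ, IsEigenfunction L ψ → IsEigenfunction (Ad (darboux N φ) L) (act (darboux N φ) ψ)
  | 0, φ, _, _ => by
    have e1 : (monomial 1 (-((0 : ℕ) : ℤ)) : PDO A) = 1 := rfl
    have e2 : Ad (1 : PDO A) L = L := by
      rw [Ad, one_mul, Ring.inverse_one, mul_one]
    rw [wronskian_zero, e1, darboux, one_mul, mul_one, one_mul, e2]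
    exact ⟨hW, hτ, fun ψ hψ => by rwa [act_one]⟩
  | N + 1, φ, hφ, hd => by
    obtain ⟨h1, h2, h3⟩ := darboux_main hW hτ N _ (fun i => hφ i.castSucc) hd.1
    have hψ := h3 _ (hφ (Fin.last N))
    have hGu := isUnit_darboux N _ hd.1
    rw [wronskian_succ N φ hd.1, darboux]
    set G := darboux N fun i => φ i.castSucc with hG
    set ψ := act G (φ (Fin.last N)) with hψdef
    have e : elementaryDarboux ψ * (G * W * monomial 1 (-(N : ℤ))) * monomial 1 (-1) =
        elementaryDarboux ψ * G * W * monomial 1 (-((N + 1 : ℕ) : ℤ)) := by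
      have : (monomial (1 : A) (-((N + 1 : ℕ) : ℤ))) = monomial 1 (-(N : ℤ)) * monomial 1 (-1) := by
        rw [monomial_mul_monomial _ _ dx_one, mul_one]
        congr 1
        push_cast
        ring
      rw [this]
      simp only [mul_assoc]
    rw [← ad_ad (isUnit_elementaryDarboux hd.2) hGu, ← e, mul_assoc ψ]
    refine ⟨h1.darbouxStep hd.2 hψ, h2.darbouxStep h1 hψ hd.2, fun χ hχ => ?_⟩
    rw [act_mul (isDiff_elementaryDarboux _) (isDiff_darboux N _)]
    exact hψ.darbouxStep hd.2 (h3 χ hχ)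

end IteratedDarboux

/-! ### Products and series for σ and ζ, their derivatives and quasi-periodicity -/

section Sigma

open Filter Topology PeriodPair

/-- The elementary factor `(1 - z / l) exp(z / l + z² / (2 l²))` of `σ` (`1` if `l = 0`). -/
noncomputable def sigmaFactor (l z : ℂ) : ℂ := by
  classical exact if l = 0 then 1 else (1 - z / l) * Complex.exp (z / l + z ^ 2 / (2 * l ^ 2))

/-- The exponential cancels the Taylor terms of 1 - w through order two, leaving a cubic remainder
that is summable over a lattice of rank two. The constant 100 is not sharp. -/
theorem norm_elementary_factor_sub_one_le {w : ℂ} (hw : ‖w‖ ≤ 1) :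
    ‖(1 - w) * Complex.exp (w + w ^ 2 / 2) - 1‖ ≤ 100 * ‖w‖ ^ 3 := by
  set u := w + w ^ 2 / 2 with hu
  have hun : ‖u‖ ≤ 3 / 2 * ‖w‖ := by
    calc ‖u‖ ≤ ‖w‖ + ‖w ^ 2 / 2‖ := norm_add_le _ _
      _ = ‖w‖ + ‖w‖ * ‖w‖ / 2 := by
        rw [norm_div, norm_pow, sq]; norm_num
      _ ≤ ‖w‖ + ‖w‖ * 1 / 2 := by gcongr
      _ = 3 / 2 * ‖w‖ := by ring
  have h1 := Complex.norm_exp_sub_sum_le_norm_mul_exp u 3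
  set r := Complex.exp u - ∑ m ∈ Finset.range 3, u ^ m / (m.factorial : ℂ) with hr
  have he : Complex.exp u = r + (1 + u + u ^ 2 / 2) := by
    rw [hr]
    simp [Finset.sum_range_succ, Nat.factorial]
  have hexp : Real.exp ‖u‖ ≤ 9 := by
    have h2 : Real.exp ‖u‖ ≤ Real.exp 2 := Real.exp_le_exp.mpr (by linarith)
    have h3 : Real.exp 2 = Real.exp 1 ^ 2 := by rw [← Real.exp_nat_mul]; norm_num
    have h4 := Real.exp_one_lt_d9
    have h5 := Real.exp_pos 1
    nlinarith
  have hrn : ‖r‖ ≤ 243 / 8 * ‖w‖ ^ 3 := by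
    calc ‖r‖ ≤ ‖u‖ ^ 3 * Real.exp ‖u‖ := h1
      _ ≤ (3 / 2 * ‖w‖) ^ 3 * 9 := by gcongr
      _ = 243 / 8 * ‖w‖ ^ 3 := by ring
  -- The product of 1 - w with the quadratic Taylor polynomial of exp at w + w²/2 is 1 plus terms of
  -- degree at least three.
  have hid : (1 - w) * Complex.exp u - 1 =
      (1 - w) * r - w ^ 3 * (1 / 2 + 3 / 8 * w + 1 / 8 * w ^ 2) := by
    rw [he, hu]; ring
  rw [hid]
  have h1w : ‖1 - w‖ ≤ 2 := (norm_sub_le _ _).trans (by rw [norm_one]; linarith)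
  have hq : ‖(1 / 2 + 3 / 8 * w + 1 / 8 * w ^ 2 : ℂ)‖ ≤ 1 := by
    calc _ ≤ ‖(1 / 2 : ℂ)‖ + ‖(3 / 8 : ℂ) * w‖ + ‖(1 / 8 : ℂ) * w ^ 2‖ := norm_add₃_le
      _ = 1 / 2 + 3 / 8 * ‖w‖ + 1 / 8 * ‖w‖ ^ 2 := by
        rw [norm_mul, norm_mul, norm_pow]; norm_num
      _ ≤ 1 / 2 + 3 / 8 * 1 + 1 / 8 * 1 ^ 2 := by gcongr
      _ = 1 := by norm_num
  calc _ ≤ ‖(1 - w) * r‖ + ‖w ^ 3 * (1 / 2 + 3 / 8 * w + 1 / 8 * w ^ 2)‖ := norm_sub_le _ _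
    _ ≤ 2 * (243 / 8 * ‖w‖ ^ 3) + ‖w‖ ^ 3 * 1 := by
      rw [norm_mul, norm_mul, norm_pow]
      gcongr
    _ ≤ 100 * ‖w‖ ^ 3 := by nlinarith [pow_nonneg (norm_nonneg w) 3]

theorem norm_sigmaFactor_sub_one_le {r : ℝ} {l z : ℂ} (hz : ‖z‖ ≤ r) (hl : r ≤ ‖l‖) :
    ‖sigmaFactor l z - 1‖ ≤ 100 * r ^ 3 * ‖l‖ ^ (-3 : ℝ) := by
  have hr : 0 ≤ r := (norm_nonneg z).trans hz
  rw [sigmaFactor]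
  split_ifs with h
  · simp only [sub_self, norm_zero]
    positivity
  have hl0 : 0 < ‖l‖ := norm_pos_iff.mpr h
  have e : z / l + z ^ 2 / (2 * l ^ 2) = z / l + (z / l) ^ 2 / 2 := by
    field_simp
  rw [e]
  refine (norm_elementary_factor_sub_one_le ?_).trans ?_
  · rw [norm_div, div_le_one hl0]; linarith
  · rw [norm_div, div_pow, Real.rpow_neg hl0.le]
    norm_cast
    rw [div_eq_mul_inv, ← mul_assoc]
    gcongr

variable (Λ : PeriodPair)

theorem eventually_norm_ge (r : ℝ) : ∀ᶠ l : Λ.lattice in cofinite, r ≤ ‖(l : ℂ)‖ := by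
  rw [eventually_cofinite]
  refine (isCompact_iff_finite.mp (isCompact_closedBall (0 : Λ.lattice) r)).subset fun l hl => ?_
  simp only [not_le, Set.mem_ofPred_eq] at hl
  simpa using hl.le

theorem summable_norm_rpow_neg_three :
    Summable fun l : Λ.lattice => ‖(l : ℂ)‖ ^ (-3 : ℝ) :=
  ZLattice.summable_norm_rpow _ _ (by simp; norm_num)

/-- The function `σ(z) / z`. -/
noncomputable def sigmaQuotient (z : ℂ) : ℂ := ∏' l : Λ.lattice, sigmaFactor l z

theorem differentiable_sigmaFactor (l : ℂ) : Differentiable ℂ (sigmaFactor l) := by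
  unfold sigmaFactor
  split_ifs <;> fun_prop

/-- On a ball of radius r all but finitely many factors differ from 1 by a multiple of ‖l‖⁻³, so the
product form of the Weierstrass M-test applies. -/
theorem hasProdLocallyUniformlyOn_sigmaFactor (r : ℝ) :
    HasProdLocallyUniformlyOn (fun (l : Λ.lattice) z => sigmaFactor l z) (sigmaQuotient Λ)
      (Metric.ball 0 r) := by
  have h := Summable.hasProdLocallyUniformlyOn_one_add (f := fun (l : Λ.lattice) z => sigmaFactor l z - 1)
    (u := fun l : Λ.lattice => 100 * r ^ 3 * ‖(l : ℂ)‖ ^ (-3 : ℝ)) (K := Metric.ball (0 : ℂ) r)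
    Metric.isOpen_ball ((summable_norm_rpow_neg_three Λ).mul_left _) ?_ ?_
  · simpa [sigmaQuotient] using! h
  · filter_upwards [eventually_norm_ge Λ r] with l hl z hz
    exact norm_sigmaFactor_sub_one_le (mem_ball_zero_iff.mp hz).le hl
  · intro l
    exact ((differentiable_sigmaFactor l).sub_const 1).continuous.continuousOn

theorem differentiable_sigmaQuotient : Differentiable ℂ (sigmaQuotient Λ) := by
  intro z
  have h := hasProdLocallyUniformlyOn_sigmaFactor Λ (‖z‖ + 1)
  have h1 : DifferentiableOn ℂ (sigmaQuotient Λ) (Metric.ball 0 (‖z‖ + 1)) := by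
    refine TendstoLocallyUniformlyOn.differentiableOn
      (hasProdLocallyUniformlyOn_iff_tendstoLocallyUniformlyOn.mp h)
      (.of_forall fun s => ?_) Metric.isOpen_ball
    exact (DifferentiableOn.fun_finsetProd fun l _ => (differentiable_sigmaFactor l).differentiableOn)
  exact h1.differentiableAt (Metric.isOpen_ball.mem_nhds (by simp))

theorem sigmaFactor_ne_zero {l z : ℂ} (h : l ≠ 0 → z ≠ l) : sigmaFactor l z ≠ 0 := by
  rw [sigmaFactor]
  split_ifs with h0
  · exact one_ne_zero
  · refine mul_ne_zero (fun h1 => h h0 ?_) (Complex.exp_ne_zero _)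
    rw [sub_eq_zero, eq_div_iff h0, one_mul] at h1
    exact h1.symm

theorem sigmaQuotient_ne_zero {z : ℂ} (hz : z ∈ ((Λ.lattice : Set ℂ) \ {0})ᶜ) :
    sigmaQuotient Λ z ≠ 0 := by
  have h := tprod_one_add_ne_zero_of_summable
    (f := fun l : Λ.lattice => sigmaFactor l z - 1) ?_ ?_
  · simpa [sigmaQuotient] using h
  · intro l
    rw [add_sub_cancel]
    refine sigmaFactor_ne_zero fun h0 h1 => hz ⟨?_, ?_⟩
    · rw [h1]; exact l.2
    · rw [h1]; exact h0
  · refine Summable.of_norm_bounded_eventually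
      ((summable_norm_rpow_neg_three Λ).mul_left (100 * ‖z‖ ^ 3)) ?_
    filter_upwards [eventually_norm_ge Λ ‖z‖] with l hl
    rw [norm_norm]
    exact norm_sigmaFactor_sub_one_le le_rfl hl

theorem weierstrassSigma_eq (z : ℂ) : weierstrassSigma Λ z = z * sigmaQuotient Λ z := by
  simp only [weierstrassSigma, sigmaQuotient, sigmaFactor]

theorem differentiable_weierstrassSigma : Differentiable ℂ (weierstrassSigma Λ) := by
  have : weierstrassSigma Λ = fun z => z * sigmaQuotient Λ z := funext (weierstrassSigma_eq Λ)
  rw [this]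
  exact differentiable_id.mul (differentiable_sigmaQuotient Λ)

theorem weierstrassSigma_ne_zero {z : ℂ} (hz : z ∉ Λ.lattice) : weierstrassSigma Λ z ≠ 0 := by
  rw [weierstrassSigma_eq]
  refine mul_ne_zero (fun h => hz (h ▸ zero_mem _)) (sigmaQuotient_ne_zero Λ fun h => hz h.1)

/-- The summand of `ζ(z) - 1 / z`. -/
noncomputable def zetaSummand (l z : ℂ) : ℂ := by
  classical exact if l = 0 then 0 else 1 / (z - l) + 1 / l + z / l ^ 2

/-- The function `ζ(z) - 1 / z`. -/
noncomputable def zetaRegular (z : ℂ) : ℂ := ∑' l : Λ.lattice, zetaSummand l z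

/-- Each summand equals z²/((z - l) l²). For ‖l‖ ≥ 2r and ‖z‖ = r one has ‖z - l‖ ≥ ‖l‖/2, which
gives the majorant 2r²‖l‖⁻³. -/
theorem hasSumLocallyUniformly_zetaRegular :
    HasSumLocallyUniformly (fun (l : Λ.lattice) z => zetaSummand l z) (zetaRegular Λ) := by
  refine Λ.hasSumLocallyUniformly_aux (u := fun r l => 2 * r ^ 2 * ‖(l : ℂ)‖ ^ (-3 : ℝ)) _
    (fun _ _ => (summable_norm_rpow_neg_three Λ).mul_left _) fun r hr =>
    Filter.eventually_atTop.mpr ⟨2 * r, ?_⟩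
  rintro _ h s hs l rfl
  rw [zetaSummand]
  split_ifs with h0
  · simp only [norm_zero]; positivity
  have hl0 : 0 < ‖(l : ℂ)‖ := norm_pos_iff.mpr h0
  have hne : s - l ≠ 0 := by
    rw [sub_ne_zero]; rintro rfl; linarith
  have e : 1 / (s - l) + 1 / l + s / (l : ℂ) ^ 2 = s ^ 2 / ((s - l) * (l : ℂ) ^ 2) := by
    field_simp
    ring
  have h2 : ‖(l : ℂ)‖ / 2 ≤ ‖s - l‖ := by
    rw [norm_sub_rev]
    exact le_trans (by linarith) (norm_sub_norm_le (l : ℂ) s)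
  rw [e, norm_div, norm_mul, norm_pow, norm_pow, Real.rpow_neg hl0.le]
  norm_cast
  calc ‖s‖ ^ 2 / (‖s - l‖ * ‖(l : ℂ)‖ ^ 2) ≤ r ^ 2 / (‖(l : ℂ)‖ / 2 * ‖(l : ℂ)‖ ^ 2) := by
        gcongr
    _ = 2 * r ^ 2 * (‖(l : ℂ)‖ ^ 3)⁻¹ := by field_simp

theorem hasDerivAt_zetaSummand {l z : ℂ} (h : l ≠ 0 → z ≠ l) :
    HasDerivAt (zetaSummand l) (-(if l = 0 then 0 else (1 / (z - l) ^ 2 - 1 / l ^ 2))) z := by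
  have e : zetaSummand l = if l = 0 then fun _ => 0 else fun z => 1 / (z - l) + 1 / l + z / l ^ 2 := by
    funext z; rw [zetaSummand]; split_ifs <;> rfl
  rw [e]
  split_ifs with h0
  · simpa using hasDerivAt_const z (0 : ℂ)
  · have hne : z - l ≠ 0 := sub_ne_zero.mpr (h h0)
    have h1 : HasDerivAt (fun z : ℂ => z - l) 1 z := (hasDerivAt_id z).sub_const l
    have h2 := ((h1.inv hne).add_const (1 / l)).add ((hasDerivAt_id z).div_const (l ^ 2))
    refine (h2.congr_deriv (by ring)).congr_of_eventuallyEq (.of_forall fun w => ?_)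
    simp

/-- Locally uniform convergence permits termwise differentiation, and the differentiated terms are
the negatives of those of ℘ without its pole at 0. -/
theorem hasDerivAt_zetaRegular {z : ℂ} (hz : z ∈ ((Λ.lattice : Set ℂ) \ {0})ᶜ) :
    HasDerivAt (zetaRegular Λ) (-Λ.weierstrassPExcept 0 z) z := by
  have hne : ∀ w ∈ ((Λ.lattice : Set ℂ) \ {0})ᶜ, ∀ l : Λ.lattice, (l : ℂ) ≠ 0 → w ≠ l := by
    rintro w hw l h0 rfl
    exact hw ⟨l.2, h0⟩
  have hopen : IsOpen ((Λ.lattice : Set ℂ) \ {0})ᶜ := Λ.isOpen_compl_lattice_sdiff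
  have hS := (hasSumLocallyUniformly_zetaRegular Λ).tendstoLocallyUniformlyOn
    (s := ((Λ.lattice : Set ℂ) \ {0})ᶜ)
  have hd : ∀ᶠ s : Finset Λ.lattice in atTop, DifferentiableOn ℂ
      (fun z => ∑ l ∈ s, zetaSummand l z) ((Λ.lattice : Set ℂ) \ {0})ᶜ :=
    .of_forall fun s => .fun_sum fun l _ w hw =>
      (hasDerivAt_zetaSummand (hne w hw l)).differentiableAt.differentiableWithinAt
  have h1 := hS.deriv hd hopen
  have h2 : TendstoLocallyUniformlyOn (deriv ∘ fun (s : Finset Λ.lattice) z =>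
      ∑ l ∈ s, zetaSummand l z) (fun z => -Λ.weierstrassPExcept 0 z) atTop
      ((Λ.lattice : Set ℂ) \ {0})ᶜ := by
    have h3 := (Λ.hasSumLocallyUniformly_weierstrassPExcept 0).tendstoLocallyUniformlyOn
      (s := ((Λ.lattice : Set ℂ) \ {0})ᶜ)
    refine TendstoLocallyUniformlyOn.congr h3.neg fun s w hw => ?_
    have h4 := (HasDerivAt.fun_sum fun (l : Λ.lattice) (_ : l ∈ s) =>
      hasDerivAt_zetaSummand (hne w hw l)).deriv
    simp only [Function.comp_apply, h4, Finset.sum_neg_distrib, Pi.neg_apply]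
  have h5 := h1.unique h2 hz
  have h6 : DifferentiableAt ℂ (zetaRegular Λ) z :=
    (hS.differentiableOn hd hopen).differentiableAt (hopen.mem_nhds hz)
  rw [← h5]
  exact h6.hasDerivAt

theorem logDeriv_sigmaFactor {l z : ℂ} (h : l ≠ 0 → z ≠ l) :
    logDeriv (sigmaFactor l) z = zetaSummand l z := by
  by_cases h0 : l = 0
  · have e : sigmaFactor l = fun _ => 1 := by funext z; rw [sigmaFactor, if_pos h0]
    rw [e, zetaSummand, if_pos h0, logDeriv_const]
    rfl
  · have e : sigmaFactor l = fun z =>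
        (1 - z / l) * Complex.exp (z / l + z ^ 2 / (2 * l ^ 2)) := by
      funext z; rw [sigmaFactor, if_neg h0]
    have hne : z - l ≠ 0 := sub_ne_zero.mpr (h h0)
    have h1 : HasDerivAt (fun z : ℂ => 1 - z / l) (-(1 / l)) z := by
      simpa using ((hasDerivAt_id z).div_const l).const_sub 1
    have h2 : HasDerivAt (fun z : ℂ => z / l + z ^ 2 / (2 * l ^ 2)) (1 / l + z / l ^ 2) z := by
      have := ((hasDerivAt_id z).div_const l).add (((hasDerivAt_id z).pow 2).div_const (2 * l ^ 2))
      refine this.congr_deriv ?_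
      simp only [id_eq, Nat.cast_ofNat, Nat.add_one_sub_one, pow_one]
      field_simp
    have h3 := (h1.mul h2.cexp).deriv
    have e3 : deriv (sigmaFactor l) z =
        -(1 / l) * Complex.exp (z / l + z ^ 2 / (2 * l ^ 2)) + (1 - z / l) *
          (Complex.exp (z / l + z ^ 2 / (2 * l ^ 2)) * (1 / l + z / l ^ 2)) := by
      rw [e]; exact h3
    rw [logDeriv_apply, e3, sigmaFactor, if_neg h0, zetaSummand, if_neg h0]
    have hE := Complex.exp_ne_zero (z / l + z ^ 2 / (2 * l ^ 2))
    have h5 : 1 - z / l ≠ 0 := by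
      rw [one_sub_div h0]
      exact div_ne_zero (by rw [← neg_sub]; exact neg_ne_zero.mpr hne) h0
    have h6 : l - z ≠ 0 := by rw [← neg_sub]; exact neg_ne_zero.mpr hne
    rw [div_eq_iff (mul_ne_zero h5 hE)]
    have h7 : (1 / (z - l) + 1 / l + z / l ^ 2) * (1 - z / l) =
        -(1 / l) + (1 - z / l) * (1 / l + z / l ^ 2) := by
      field_simp
      ring
    linear_combination (-Complex.exp (z / l + z ^ 2 / (2 * l ^ 2))) * h7

/-- Termwise logarithmic differentiation of the product connects ζ, defined as σ'/σ, with its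
partial fraction series. -/
theorem logDeriv_sigmaQuotient {z : ℂ} (hz : z ∈ ((Λ.lattice : Set ℂ) \ {0})ᶜ) :
    logDeriv (sigmaQuotient Λ) z = zetaRegular Λ z := by
  have hne : ∀ l : Λ.lattice, (l : ℂ) ≠ 0 → z ≠ l := by
    rintro l h0 rfl
    exact hz ⟨l.2, h0⟩
  have h := logDeriv_tprod_eq_tsum (f := fun (l : Λ.lattice) z => sigmaFactor l z)
    (Metric.isOpen_ball (x := (0 : ℂ)) (ε := ‖z‖ + 1)) (x := z) (by simp)
    (fun l => sigmaFactor_ne_zero (hne l))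
    (fun l => (differentiable_sigmaFactor l).differentiableOn) ?_
    (hasProdLocallyUniformlyOn_sigmaFactor Λ _).multipliableLocallyUniformlyOn
    (sigmaQuotient_ne_zero Λ hz)
  · refine Eq.trans h (tsum_congr fun l => ?_)
    exact logDeriv_sigmaFactor (hne l)
  · have := (hasSumLocallyUniformly_zetaRegular Λ).hasSum (x := z)
    refine this.summable.congr fun l => ?_
    exact (logDeriv_sigmaFactor (hne l)).symm

theorem weierstrassZeta_eq {z : ℂ} (hz : z ∉ Λ.lattice) :
    weierstrassZeta Λ z = 1 / z + zetaRegular Λ z := by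
  have hz0 : z ≠ 0 := fun h => hz (h ▸ zero_mem _)
  have hz' : z ∈ ((Λ.lattice : Set ℂ) \ {0})ᶜ := fun h => hz h.1
  have e : weierstrassSigma Λ = fun z => z * sigmaQuotient Λ z := funext (weierstrassSigma_eq Λ)
  have h1 := logDeriv_mul (f := fun z : ℂ => z) (g := sigmaQuotient Λ) z hz0
    (sigmaQuotient_ne_zero Λ hz') differentiableAt_id (differentiable_sigmaQuotient Λ z)
  rw [logDeriv_sigmaQuotient Λ hz'] at h1
  rw [weierstrassZeta, ← logDeriv_apply, e, h1, logDeriv_apply]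
  simp

theorem hasDerivAt_weierstrassZeta {z : ℂ} (hz : z ∉ Λ.lattice) :
    HasDerivAt (weierstrassZeta Λ) (-Λ.weierstrassP z) z := by
  have hz0 : z ≠ 0 := fun h => hz (h ▸ zero_mem _)
  have hz' : z ∈ ((Λ.lattice : Set ℂ) \ {0})ᶜ := fun h => hz h.1
  have h1 := (hasDerivAt_inv hz0).add (hasDerivAt_zetaRegular Λ hz')
  have h2 := Λ.weierstrassPExcept_def 0 z
  simp only [ZeroMemClass.coe_zero] at h2
  rw [h2] at h1
  refine (h1.congr_deriv ?_).congr_of_eventuallyEq ?_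
  · simp
  · filter_upwards [Λ.isClosed_lattice.isOpen_compl.mem_nhds hz] with w hw
    rw [weierstrassZeta_eq Λ hw, Pi.add_apply, one_div]

theorem hasDerivAt_weierstrassSigma {z : ℂ} (hz : z ∉ Λ.lattice) :
    HasDerivAt (weierstrassSigma Λ) (weierstrassZeta Λ z * weierstrassSigma Λ z) z := by
  rw [weierstrassZeta, div_mul_cancel₀ _ (weierstrassSigma_ne_zero Λ hz)]
  exact (differentiable_weierstrassSigma Λ z).hasDerivAt

theorem zetaRegular_zero : zetaRegular Λ 0 = 0 := by
  have : ∀ l : Λ.lattice, zetaSummand l 0 = 0 := fun l => by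
    rw [zetaSummand]
    split_ifs
    · rfl
    · simp
  simp [zetaRegular, this]

theorem zetaRegular_neg (z : ℂ) : zetaRegular Λ (-z) = -zetaRegular Λ z := by
  rw [zetaRegular, zetaRegular, ← tsum_neg, ← (Equiv.neg Λ.lattice).tsum_eq]
  refine tsum_congr fun l => ?_
  simp only [Equiv.neg_apply, NegMemClass.coe_neg, zetaSummand, neg_eq_zero]
  split_ifs
  · simp
  · have : -z - -(l : ℂ) = -(z - l) := by ring
    rw [this, one_div_neg_eq_neg_one_div, one_div_neg_eq_neg_one_div]
    ring

theorem weierstrassZeta_neg {z : ℂ} (hz : z ∉ Λ.lattice) :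
    weierstrassZeta Λ (-z) = -weierstrassZeta Λ z := by
  rw [weierstrassZeta_eq Λ hz, weierstrassZeta_eq Λ (by simpa using hz), zetaRegular_neg]
  rw [one_div_neg_eq_neg_one_div]
  ring

/-- A countable set does not disconnect the plane. Connectedness is needed to integrate equalities
of derivatives and to use the identity theorem. -/
theorem isPreconnected_compl_lattice : IsPreconnected ((Λ.lattice : Set ℂ)ᶜ) := by
  have hc : (Λ.lattice : Set ℂ).Countable := by
    have : Countable Λ.lattice := Λ.latticeEquivProd.toEquiv.countable_iff.mpr inferInstance
    exact Set.to_countable _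
  exact (hc.isPathConnected_compl_of_one_lt_rank (by simp)).isConnected.isPreconnected

theorem eq_of_hasDerivAt_eq {f g f' : ℂ → ℂ} (hf : ∀ z ∉ Λ.lattice, HasDerivAt f (f' z) z)
    (hg : ∀ z ∉ Λ.lattice, HasDerivAt g (f' z) z) :
    ∃ c, ∀ z ∉ Λ.lattice, f z = g z + c := by
  obtain ⟨c, hc⟩ := IsOpen.exists_eq_add_of_deriv_eq (s := (Λ.lattice : Set ℂ)ᶜ)
    Λ.isClosed_lattice.isOpen_compl (isPreconnected_compl_lattice Λ)
    (f := f) (g := g) (fun z hz => (hf z hz).differentiableAt.differentiableWithinAt)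
    (fun z hz => (hg z hz).differentiableAt.differentiableWithinAt)
    (fun z hz => by rw [(hf z hz).deriv, (hg z hz).deriv])
  exact ⟨c, fun z hz => hc hz⟩

/-- The translate of ζ and ζ itself have the same derivative, because ℘ is periodic. -/
theorem exists_weierstrassZeta_add (l : Λ.lattice) :
    ∃ η, ∀ z ∉ Λ.lattice, weierstrassZeta Λ (z + l) = weierstrassZeta Λ z + η := by
  refine eq_of_hasDerivAt_eq Λ (f := fun z => weierstrassZeta Λ (z + l))
    (f' := fun z => -Λ.weierstrassP z) (fun z hz => ?_) fun z hz => hasDerivAt_weierstrassZeta Λ hz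
  have hzl : z + l ∉ Λ.lattice := fun h => hz (by simpa using sub_mem h l.2)
  have := (hasDerivAt_weierstrassZeta Λ hzl).comp_add_const z (l : ℂ)
  rwa [Λ.weierstrassP_add_coe] at this

end Sigma

/-! ### Addition theorems for ζ and the second-order equation for ℘ -/

section AdditionTheorem

open Filter Topology PeriodPair

variable (Λ : PeriodPair)

theorem ne_zero_of_notMem_lattice {z : ℂ} (hz : z ∉ Λ.lattice) : z ≠ 0 :=
  fun h => hz (h ▸ zero_mem _)

theorem weierstrassPExcept_zero_zero : Λ.weierstrassPExcept 0 0 = 0 := by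
  simp [weierstrassPExcept]

theorem weierstrassP_eq (z : ℂ) :
    Λ.weierstrassP z = Λ.weierstrassPExcept 0 z + 1 / z ^ 2 := by
  have := Λ.weierstrassPExcept_add 0 z
  simpa using this.symm

theorem zero_mem_compl_lattice_sdiff : (0 : ℂ) ∈ ((Λ.lattice : Set ℂ) \ {0})ᶜ :=
  fun h => h.2 rfl

theorem eventually_notMem_lattice_of_notMem {z : ℂ} (hz : z ∉ Λ.lattice) :
    ∀ᶠ w in 𝓝 z, w ∉ Λ.lattice := Λ.isClosed_lattice.isOpen_compl.mem_nhds hz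

theorem eventually_notMem_lattice : ∀ᶠ z in 𝓝[≠] (0 : ℂ), z ∉ Λ.lattice := by
  have h : ((Λ.lattice : Set ℂ) \ {0})ᶜ ∈ 𝓝 (0 : ℂ) :=
    Λ.isOpen_compl_lattice_sdiff.mem_nhds (zero_mem_compl_lattice_sdiff Λ)
  filter_upwards [self_mem_nhdsWithin, mem_nhdsWithin_of_mem_nhds h] with z hz h1 h2
  exact h1 ⟨h2, hz⟩

theorem hasDerivAt_weierstrassP {z : ℂ} (hz : z ∉ Λ.lattice) :
    HasDerivAt Λ.weierstrassP (Λ.derivWeierstrassP z) z := by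
  have h := (Λ.analyticOnNhd_weierstrassP z hz).differentiableAt.hasDerivAt
  rwa [deriv_weierstrassP] at h

theorem hasDerivAt_weierstrassPExcept {z : ℂ} (hz : z ∈ ((Λ.lattice : Set ℂ) \ {0})ᶜ) :
    HasDerivAt (Λ.weierstrassPExcept 0) (Λ.derivWeierstrassPExcept 0 z) z := by
  have h := (Λ.analyticOnNhd_weierstrassPExcept 0 z hz).differentiableAt.hasDerivAt
  rwa [Λ.eqOn_deriv_weierstrassPExcept_derivWeierstrassPExcept 0 hz] at h

/-- The difference of the two sides of the addition theorem for `ζ`. -/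
noncomputable def zetaDefect (u v : ℂ) : ℂ := by
  classical exact if v ∈ Λ.lattice ∨ u + v ∈ Λ.lattice then 0 else
    (weierstrassZeta Λ (u + v) - weierstrassZeta Λ u - weierstrassZeta Λ v) ^ 2 -
      Λ.weierstrassP (u + v) - Λ.weierstrassP u - Λ.weierstrassP v

/-- The quasi-period occurs in both ζ(u + v) and ζ(v) and cancels in the difference. -/
theorem zetaDefect_add (u v : ℂ) (l : Λ.lattice) :
    zetaDefect Λ u (v + l) = zetaDefect Λ u v := by
  have h1 : v + l ∈ Λ.lattice ↔ v ∈ Λ.lattice := Submodule.add_mem_iff_left _ l.2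
  have h2 : u + (v + l) ∈ Λ.lattice ↔ u + v ∈ Λ.lattice := by
    rw [← add_assoc]; exact Submodule.add_mem_iff_left _ l.2
  have h12 := or_congr h1 h2
  by_cases h : v ∈ Λ.lattice ∨ u + v ∈ Λ.lattice
  · rw [zetaDefect, zetaDefect, if_pos h, if_pos (h12.mpr h)]
  · rw [zetaDefect, zetaDefect, if_neg h, if_neg (mt h12.mp h)]
    push Not at h
    obtain ⟨η, hη⟩ := exists_weierstrassZeta_add Λ l
    rw [← add_assoc, hη _ h.1, hη _ h.2, Λ.weierstrassP_add_coe, Λ.weierstrassP_add_coe]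
    ring

/-- This involution exchanges the two lattice cosets of possible poles, v ∈ Λ and u + v ∈ Λ, so
regularity has to be checked at only one of them. -/
theorem zetaDefect_symm (u v : ℂ) :
    zetaDefect Λ u (-u - v) = zetaDefect Λ u v := by
  have h1 : -u - v ∈ Λ.lattice ↔ u + v ∈ Λ.lattice := by
    rw [← neg_add', neg_mem_iff]
  have h2 : u + (-u - v) ∈ Λ.lattice ↔ v ∈ Λ.lattice := by
    rw [show u + (-u - v) = -v by ring, neg_mem_iff]
  have h12 := (or_congr h1 h2).trans or_comm
  by_cases h : v ∈ Λ.lattice ∨ u + v ∈ Λ.lattice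
  · rw [zetaDefect, zetaDefect, if_pos h, if_pos (h12.mpr h)]
  · rw [zetaDefect, zetaDefect, if_neg h, if_neg (mt h12.mp h)]
    push Not at h
    rw [show u + (-u - v) = -v by ring, show -u - v = -(u + v) by ring,
      weierstrassZeta_neg Λ h.1, weierstrassZeta_neg Λ h.2, Λ.weierstrassP_neg,
      Λ.weierstrassP_neg]
    ring

theorem differentiableAt_zetaDefect {u v : ℂ} (hv : v ∉ Λ.lattice)
    (huv : u + v ∉ Λ.lattice) : DifferentiableAt ℂ (zetaDefect Λ u) v := by
  have hc : Tendsto (fun w => u + w) (𝓝 v) (𝓝 (u + v)) :=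
    (continuous_const.add continuous_id).tendsto v
  have h1 := (hasDerivAt_weierstrassZeta Λ huv).comp_const_add u v
  have h2 := (hasDerivAt_weierstrassP Λ huv).comp_const_add u v
  have h3 := hasDerivAt_weierstrassZeta Λ hv
  have h4 := hasDerivAt_weierstrassP Λ hv
  have h5 : DifferentiableAt ℂ (fun w =>
      (weierstrassZeta Λ (u + w) - weierstrassZeta Λ u - weierstrassZeta Λ w) ^ 2 -
      Λ.weierstrassP (u + w) - Λ.weierstrassP u - Λ.weierstrassP w) v :=
    (((((h1.differentiableAt.sub_const _).sub h3.differentiableAt).pow 2).sub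
      h2.differentiableAt).sub_const _).sub h4.differentiableAt
  refine h5.congr_of_eventuallyEq ?_
  filter_upwards [eventually_notMem_lattice_of_notMem Λ hv,
    hc.eventually (eventually_notMem_lattice_of_notMem Λ huv)] with w hw hw'
  simp [zetaDefect, hw, hw']

/-- The default value 0 at lattice points is the limit: after ζ(v) = 1/v + regular is inserted, the
double poles cancel, and what remains tends to 2℘(u) - ℘(u) - ℘(u) = 0. -/
theorem analyticAt_zetaDefect_zero {u : ℂ} (hu : u ∉ Λ.lattice) :
    AnalyticAt ℂ (zetaDefect Λ u) 0 := by
  have hc : Tendsto (fun w => u + w) (𝓝 0) (𝓝 u) := by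
    simpa using (continuous_const.add continuous_id).tendsto (0 : ℂ) (f := fun w => u + w)
  have hu' := (hc.eventually (eventually_notMem_lattice_of_notMem Λ hu)).filter_mono
    (nhdsWithin_le_nhds (s := {0}ᶜ))
  have hl := eventually_notMem_lattice Λ
  refine Complex.analyticAt_of_differentiable_on_punctured_nhds_of_continuousAt ?_ ?_
  · filter_upwards [hl, hu'] with w h1 h2 using differentiableAt_zetaDefect Λ h1 h2
  have h0 : zetaDefect Λ u 0 = 0 := by simp [zetaDefect]
  rw [continuousAt_iff_punctured_nhds, h0]
  have hd0 := zero_mem_compl_lattice_sdiff Λ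
  set f : ℂ → ℂ := fun v => weierstrassZeta Λ (u + v) - weierstrassZeta Λ u - zetaRegular Λ v
    with hf
  have hf0 : f 0 = 0 := by simp [hf, zetaRegular_zero]
  have hfd : HasDerivAt f (-Λ.weierstrassP u) 0 := by
    have h1 := (hasDerivAt_weierstrassZeta Λ (by simpa using hu : u + 0 ∉ Λ.lattice)).comp_const_add
      u 0
    have h2 := (h1.sub_const (weierstrassZeta Λ u)).sub (hasDerivAt_zetaRegular Λ hd0)
    refine h2.congr_deriv ?_
    rw [weierstrassPExcept_zero_zero, add_zero]
    ring
  have t1 : Tendsto f (𝓝[≠] 0) (𝓝 0) := by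
    have := hfd.continuousAt.tendsto
    rw [hf0] at this
    exact this.mono_left nhdsWithin_le_nhds
  -- The cross term f(v)/v is a difference quotient, because f vanishes at 0.
  have t2 : Tendsto (fun v => v⁻¹ * f v) (𝓝[≠] 0) (𝓝 (-Λ.weierstrassP u)) := by
    have := hfd.tendsto_slope
    refine this.congr fun v => ?_
    rw [slope_def_field, hf0, sub_zero, sub_zero, div_eq_inv_mul]
  have t3 : Tendsto (fun v => Λ.weierstrassP (u + v)) (𝓝[≠] 0) (𝓝 (Λ.weierstrassP u)) :=
    ((hasDerivAt_weierstrassP Λ hu).continuousAt.tendsto.comp hc).mono_left nhdsWithin_le_nhds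
  have t4 : Tendsto (Λ.weierstrassPExcept 0) (𝓝[≠] 0) (𝓝 0) := by
    have := (hasDerivAt_weierstrassPExcept Λ hd0).continuousAt.tendsto
    rw [weierstrassPExcept_zero_zero] at this
    exact this.mono_left nhdsWithin_le_nhds
  have t5 := ((((t1.pow 2).sub (t2.const_mul 2)).sub t3).sub
    (tendsto_const_nhds (x := Λ.weierstrassP u))).sub t4
  have e : (0 : ℂ) ^ 2 - 2 * -Λ.weierstrassP u - Λ.weierstrassP u - Λ.weierstrassP u - 0 = 0 := by
    ring
  rw [e] at t5
  refine t5.congr' ?_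
  filter_upwards [hl, hu'] with v h1 h2
  have hv0 := ne_zero_of_notMem_lattice Λ h1
  simp only [zetaDefect, h1, h2, or_self, if_false, hf]
  rw [weierstrassP_eq Λ v, weierstrassZeta_eq Λ h1]
  field_simp
  ring

theorem differentiable_zetaDefect {u : ℂ} (hu : u ∉ Λ.lattice) :
    Differentiable ℂ (zetaDefect Λ u) := by
  have hlat : ∀ l : Λ.lattice, DifferentiableAt ℂ (zetaDefect Λ u) l := fun l => by
    have e : zetaDefect Λ u = fun v => zetaDefect Λ u (v - l) := by
      funext v
      rw [← zetaDefect_add Λ u (v - l) l, sub_add_cancel]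
    rw [e]
    have h0 : DifferentiableAt ℂ (zetaDefect Λ u) ((l : ℂ) - l) := by
      rw [sub_self]; exact (analyticAt_zetaDefect_zero Λ hu).differentiableAt
    exact DifferentiableAt.comp (l : ℂ) (g := zetaDefect Λ u) (f := fun v : ℂ => v - (l : ℂ)) h0
      (by fun_prop)
  intro v
  by_cases hv : v ∈ Λ.lattice
  · exact hlat ⟨v, hv⟩
  by_cases huv : u + v ∈ Λ.lattice
  · have e : zetaDefect Λ u = fun v => zetaDefect Λ u (-u - v) := by
      funext v
      rw [zetaDefect_symm Λ u]
    rw [e]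
    have h0 : DifferentiableAt ℂ (zetaDefect Λ u) (-u - v) := by
      have := hlat ⟨-u - v, by rw [← neg_add']; exact neg_mem huv⟩
      exact this
    exact DifferentiableAt.comp v (g := zetaDefect Λ u) (f := fun v => -u - v) h0 (by fun_prop)
  · exact differentiableAt_zetaDefect Λ hv huv

/-- The addition theorem `(ζ(u + v) - ζ(u) - ζ(v))² = ℘(u + v) + ℘(u) + ℘(v)`. -/
theorem weierstrassZeta_addition_sq {u v : ℂ} (hu : u ∉ Λ.lattice) (hv : v ∉ Λ.lattice)
    (huv : u + v ∉ Λ.lattice) :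
    (weierstrassZeta Λ (u + v) - weierstrassZeta Λ u - weierstrassZeta Λ v) ^ 2 =
      Λ.weierstrassP (u + v) + Λ.weierstrassP u + Λ.weierstrassP v := by
  have hd := differentiable_zetaDefect Λ hu
  -- An entire function periodic under the lattice is bounded, hence constant; its value at 0 is 0.
  have h := hd.apply_eq_apply_of_bounded (IsZLattice.isCompact_range_of_periodic Λ.lattice _
    hd.continuous fun z w hw => by
      lift w to Λ.lattice using hw
      exact zetaDefect_add Λ u z w).isBounded v 0
  have h0 : zetaDefect Λ u 0 = 0 := by simp [zetaDefect]
  rw [h0] at h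
  simp only [zetaDefect, hv, huv, or_self, if_false] at h
  linear_combination h

/-- `2 (ζ(u + v) - ζ(u) - ζ(v)) (℘(u) - ℘(v)) = ℘'(u) - ℘'(v)`. -/
theorem weierstrassZeta_addition {u v : ℂ} (hu : u ∉ Λ.lattice) (hv : v ∉ Λ.lattice)
    (huv : u + v ∉ Λ.lattice) :
    2 * (weierstrassZeta Λ (u + v) - weierstrassZeta Λ u - weierstrassZeta Λ v) *
      (Λ.weierstrassP u - Λ.weierstrassP v) = Λ.derivWeierstrassP u - Λ.derivWeierstrassP v := by
  have hu0 : u + 0 ∉ Λ.lattice := by simpa using hu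
  have hv0 : v - 0 ∉ Λ.lattice := by simpa using hv
  have h1 := (hasDerivAt_weierstrassZeta Λ hu0).comp_const_add u 0
  have h2 := (hasDerivAt_weierstrassZeta Λ hv0).comp_const_sub v 0
  have h3 := (hasDerivAt_weierstrassP Λ hu0).comp_const_add u 0
  have h4 := (hasDerivAt_weierstrassP Λ hv0).comp_const_sub v 0
  -- The squared identity is differentiated along (u + s, v - s) at s = 0, where u + v, and hence
  -- ζ(u + v) and ℘(u + v), stay fixed.
  have hL := ((h1.const_sub (weierstrassZeta Λ (u + v))).sub h2).pow 2
  have hR := (h3.const_add (Λ.weierstrassP (u + v))).add h4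
  have ev : (fun s : ℂ => Λ.weierstrassP (u + v) + Λ.weierstrassP (u + s)) +
      (fun s => Λ.weierstrassP (v - s)) =ᶠ[𝓝 0]
      (((fun s => weierstrassZeta Λ (u + v) - weierstrassZeta Λ (u + s)) -
        fun s => weierstrassZeta Λ (v - s)) ^ 2 : ℂ → ℂ) := by
    have c1 : Tendsto (fun s : ℂ => u + s) (𝓝 0) (𝓝 (u + 0)) :=
      (continuous_const.add continuous_id).tendsto 0
    have c2 : Tendsto (fun s : ℂ => v - s) (𝓝 0) (𝓝 (v - 0)) :=
      (continuous_const.sub continuous_id).tendsto 0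
    filter_upwards [c1.eventually (eventually_notMem_lattice_of_notMem Λ hu0),
      c2.eventually (eventually_notMem_lattice_of_notMem Λ hv0)] with s hs1 hs2
    have e : u + s + (v - s) = u + v := by ring
    have := weierstrassZeta_addition_sq Λ hs1 hs2 (by rwa [e])
    rw [e] at this
    exact this.symm
  have h5 := (hL.congr_of_eventuallyEq ev).unique hR
  simp only [Pi.sub_apply, add_zero, sub_zero] at h5
  push_cast at h5
  linear_combination h5

/-- The differential equation `℘'' = 6 ℘² - g₂ / 2`. -/
theorem hasDerivAt_derivWeierstrassP {z : ℂ} (hz : z ∉ Λ.lattice) :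
    HasDerivAt Λ.derivWeierstrassP (6 * Λ.weierstrassP z ^ 2 - Λ.g₂ / 2) z := by
  have hP : AnalyticOnNhd ℂ Λ.weierstrassP (Λ.lattice : Set ℂ)ᶜ := Λ.analyticOnNhd_weierstrassP
  have hP' : AnalyticOnNhd ℂ Λ.derivWeierstrassP (Λ.lattice : Set ℂ)ᶜ :=
    Λ.analyticOnNhd_derivWeierstrassP
  set f : ℂ → ℂ := fun z => deriv Λ.derivWeierstrassP z - (6 * Λ.weierstrassP z ^ 2 - Λ.g₂ / 2)
    with hf
  have hfa : AnalyticOnNhd ℂ f (Λ.lattice : Set ℂ)ᶜ := fun w hw =>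
    (hP'.deriv w hw).sub ((analyticAt_const.mul ((hP w hw).pow 2)).sub analyticAt_const)
  -- Differentiating ℘'² = 4℘³ - g₂℘ - g₃ gives the equation multiplied by ℘'. That factor is then
  -- removed by the identity theorem on the connected complement of the lattice.
  have hmul : ∀ w ∈ (Λ.lattice : Set ℂ)ᶜ, Λ.derivWeierstrassP w * f w = 0 := by
    intro w hw
    have h1 := (hP' w hw).differentiableAt.hasDerivAt
    have h2 := hasDerivAt_weierstrassP Λ hw
    have hR := (((h2.pow 3).const_mul 4).sub (h2.const_mul Λ.g₂)).sub_const Λ.g₃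
    have h3 := (h1.pow 2).congr_of_eventuallyEq (f₁ := fun w =>
      4 * Λ.weierstrassP w ^ 3 - Λ.g₂ * Λ.weierstrassP w - Λ.g₃) (by
        filter_upwards [eventually_notMem_lattice_of_notMem Λ hw] with s hs
        exact (Λ.derivWeierstrassP_sq s hs).symm)
    have h4 := h3.unique hR
    push_cast at h4
    simp only [hf]
    linear_combination h4 / 2
  rcases AnalyticOnNhd.eq_zero_or_eq_zero_of_mul_eq_zero hP' hfa hmul
    (isPreconnected_compl_lattice Λ) with h | h
  -- If ℘' vanished identically, ℘ would be constant, contradicting its double pole: z²℘(z) would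
  -- tend to both 0 and 1.
  · exfalso
    obtain ⟨c, hc⟩ := eq_of_hasDerivAt_eq Λ (f := Λ.weierstrassP) (g := fun _ => 0)
      (f' := fun _ => 0) (fun w hw => h w hw ▸ hasDerivAt_weierstrassP Λ hw)
      (fun w _ => hasDerivAt_const w 0)
    have hid : Tendsto (fun w : ℂ => w ^ 2) (𝓝[≠] 0) (𝓝 (0 ^ 2)) :=
      ((continuous_pow 2).tendsto 0).mono_left nhdsWithin_le_nhds
    have t1 := hid.mul_const c
    have t4 : Tendsto (Λ.weierstrassPExcept 0) (𝓝[≠] 0) (𝓝 (Λ.weierstrassPExcept 0 0)) :=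
      (hasDerivAt_weierstrassPExcept Λ
        (zero_mem_compl_lattice_sdiff Λ)).continuousAt.tendsto.mono_left nhdsWithin_le_nhds
    have t2 := (hid.mul t4).add_const 1
    have := tendsto_nhds_unique (t1.congr' ?_) t2
    · simp at this
    · filter_upwards [eventually_notMem_lattice Λ] with w hw
      have h0 := ne_zero_of_notMem_lattice Λ hw
      have := hc w hw
      rw [zero_add, weierstrassP_eq] at this
      rw [← this]
      field_simp
  · have := (hP' z hz).differentiableAt.hasDerivAt
    rwa [sub_eq_zero.mp (h z hz)] at this

end AdditionTheorem

/-! ### Exponentials of formal power series -/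

section FormalExponential

open PowerSeries

variable {A : Type*} [CommRing A] [Algebra ℚ A]

/-- The formal exponential of a power series without constant term. -/
noncomputable def expSeries (G : PowerSeries A) : PowerSeries A :=
  PowerSeries.mk fun j => ∑ k ∈ Finset.range (j + 1), (1 / k.factorial : ℚ) • coeff j (G ^ k)

@[simp] theorem constantCoeff_expSeries (G : PowerSeries A) : constantCoeff (expSeries G) = 1 := by
  rw [← coeff_zero_eq_constantCoeff_apply, expSeries, coeff_mk]
  simp

theorem derivative_expSeries {G : PowerSeries A} (hG : constantCoeff G = 0) :
    derivative A (expSeries G) = derivative A G * expSeries G := by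
  ext j
  have h := exp_coeff_recursion G hG j
  rw [coeff_derivative, coeff_mul]
  simp only [ratCast_smul_eq_mul] at h
  simp only [expSeries, coeff_mk, coeff_derivative]
  exact h

/-- Uniqueness for the differential equation `Y' = f Y`. -/
theorem eq_of_derivative_eq_mul {f Y Z : PowerSeries A} (hY : derivative A Y = f * Y)
    (hZ : derivative A Z = f * Z) (h : constantCoeff Y = constantCoeff Z) : Y = Z := by
  ext j
  induction j using Nat.strong_induction_on with
  | _ j ih =>
    cases j with
    | zero => simpa using h
    | succ j =>
      have h1 := congrArg (coeff j) hY
      have h2 := congrArg (coeff j) hZ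
      rw [coeff_derivative, coeff_mul] at h1 h2
      refine mul_succ_cancel (h1.trans (Eq.trans ?_ h2.symm))
      refine Finset.sum_congr rfl fun p hp => ?_
      have := Finset.HasAntidiagonal.mem_antidiagonal.mp hp
      rw [ih p.2 (by omega)]

theorem eq_expSeries {G Y : PowerSeries A} (hG : constantCoeff G = 0)
    (hY : derivative A Y = derivative A G * Y) (h : constantCoeff Y = 1) : Y = expSeries G :=
  eq_of_derivative_eq_mul hY (derivative_expSeries hG) (by simpa using h)

theorem expSeries_add {F G : PowerSeries A} (hF : constantCoeff F = 0)
    (hG : constantCoeff G = 0) : expSeries (F + G) = expSeries F * expSeries G := by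
  refine (eq_expSeries (by simp [hF, hG]) ?_ (by simp)).symm
  rw [Derivation.leibniz, derivative_expSeries hF, derivative_expSeries hG, map_add]
  simp only [smul_eq_mul]
  ring

theorem map_expSeries {B : Type*} [CommRing B] [Algebra ℚ B] (f : A →+* B) {G : PowerSeries A}
    (hG : constantCoeff G = 0) :
    PowerSeries.map f (expSeries G) = expSeries (PowerSeries.map f G) := by
  have hd : ∀ H : PowerSeries A,
      derivative B (PowerSeries.map f H) = PowerSeries.map f (derivative A H) := fun H => by
    ext j
    simp [coeff_derivative]
  refine eq_expSeries ?_ ?_ ?_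
  · rw [← coeff_zero_eq_constantCoeff_apply, coeff_map, coeff_zero_eq_constantCoeff_apply, hG,
      map_zero]
  · rw [hd, derivative_expSeries hG, map_mul, hd]
  · rw [← coeff_zero_eq_constantCoeff_apply, coeff_map, coeff_zero_eq_constantCoeff_apply,
      constantCoeff_expSeries, map_one]

variable [FlowAlgebra A]

theorem derivative_coeffDerivation (d : Derivation ℚ A A) (f : PowerSeries A) :
    derivative A (coeffDerivation d f) = coeffDerivation d (derivative A f) := by
  ext j
  simp only [coeff_derivative, coeff_coeffDerivation, Derivation.leibniz, smul_eq_mul]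
  have : d ((j : A) + 1) = 0 := by simp
  simp [mul_comm]

/-- The defect between the two sides solves Y' = G' Y with zero constant term, hence vanishes. -/
theorem coeffDerivation_expSeries (d : Derivation ℚ A A) {G : PowerSeries A}
    (hG : constantCoeff G = 0) :
    coeffDerivation d (expSeries G) = coeffDerivation d G * expSeries G := by
  have h0 : ∀ H : PowerSeries A, constantCoeff (coeffDerivation d H) = d (constantCoeff H) :=
    fun H => by
      rw [← coeff_zero_eq_constantCoeff_apply, coeff_coeffDerivation,
        coeff_zero_eq_constantCoeff_apply]
  rw [← sub_eq_zero]
  refine eq_of_derivative_eq_mul (f := derivative A G) ?_ (by simp) (by simp [h0, hG])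
  rw [map_sub, derivative_coeffDerivation, derivative_expSeries hG, Derivation.leibniz,
    Derivation.leibniz, derivative_coeffDerivation, derivative_expSeries hG]
  simp only [smul_eq_mul]
  ring

/-- The chain rule for exp, known for d/dz and for each coefficientwise flow, passes to F because
each coefficient involves finitely many flows. -/
theorem flowDerivation_expSeries {G : PowerSeries A} (hG : constantCoeff G = 0) :
    flowDerivation A (expSeries G) = flowDerivation A G * expSeries G := by
  rw [flowDerivation_apply, flowDerivation_apply, add_mul, derivative_expSeries hG]
  congr 1
  ext j
  rw [coeff_flowSum _ (Nat.lt_succ_self j), coeff_mul]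
  have h : ∀ p ∈ Finset.HasAntidiagonal.antidiagonal j,
      coeff p.1 (flowSum G) * coeff p.2 (expSeries G) = coeff p.1 (∑ n ∈ Finset.range (j + 1),
        X ^ n * coeffDerivation (FlowAlgebra.d (Nat.succPNat n)) G) * coeff p.2 (expSeries G) :=
    fun p hp => by
      have := Finset.HasAntidiagonal.mem_antidiagonal.mp hp
      rw [coeff_flowSum G (by omega : p.1 < j + 1)]
  rw [Finset.sum_congr rfl h, ← coeff_mul, Finset.sum_mul]
  congr 1
  refine Finset.sum_congr rfl fun n _ => ?_
  rw [coeffDerivation_expSeries _ hG]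
  ring

/-- If `f` depends on `x` only, then `f(x - z) = ∑ (-z)ʲ f⁽ʲ⁾(x) / j!`. -/
theorem shiftSeries_eq_taylor {f : A} (hf : ∀ n : ℕ+, n ≠ 1 → FlowAlgebra.d n f = 0) :
    shiftSeries f = PowerSeries.mk fun j => ((-1) ^ j / j.factorial : ℚ) • dx^[j] f := by
  refine (eq_of_flowDerivation_eq_zero ?_ (flowDerivation_shiftSeries f) ?_).symm
  · ext j
    rw [coeff_flowDerivation, Finset.sum_eq_single_of_mem ((0, j) : ℕ × ℕ) (by simp)]
    · have e : Nat.succPNat 0 = 1 := rfl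
      simp only [coeff_mk, e, map_rat_smul, map_zero]
      rw [← ratCast_smul_eq_mul, smul_smul, Function.iterate_succ_apply']
      have : ((j : ℚ) + 1) * ((-1) ^ (j + 1) / (j + 1).factorial) =
          -((-1) ^ j / j.factorial) := by
        rw [Nat.factorial_succ]
        push_cast
        field_simp
        ring
      rw [this, neg_smul]
      exact neg_add_cancel _
    · rintro ⟨m, n⟩ hp hne
      have hm : m ≠ 0 := by
        rintro rfl
        have := Finset.HasAntidiagonal.mem_antidiagonal.mp hp
        simp only [zero_add] at this
        exact hne (by rw [this])
      have hm' : Nat.succPNat m ≠ 1 := fun h => hm (Nat.succPNat_injective h)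
      rw [coeff_mk, map_rat_smul, PDO.d_comm_iterate, hf _ hm', PDO.iterate_dx_zero, smul_zero]
  · rw [← coeff_zero_eq_constantCoeff_apply, coeff_mk]
    simp

end FormalExponential

/-! ### Operators of nonpositive order encoded by power series -/

section Symbols

variable {A : Type*} [CommRing A] [Algebra ℚ A] [FlowAlgebra A]

namespace PDO

/-- The operator `∑ fⱼ ∂ₓ⁻ʲ` of the power series `∑ fⱼ zʲ`. -/
noncomputable def ofSeries (f : PowerSeries A) : PDO A :=
  ⟨fun n => if n ≤ 0 then PowerSeries.coeff (-n).toNat f else 0, 0,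
    fun _ hn => if_neg (not_le.mpr hn)⟩

theorem coeff_ofSeries (f : PowerSeries A) (n : ℤ) : (ofSeries f).coeff n =
    if n ≤ 0 then PowerSeries.coeff (-n).toNat f else 0 := rfl

theorem coeff_ofSeries_neg (f : PowerSeries A) (n : ℕ) :
    (ofSeries f).coeff (-(n : ℤ)) = PowerSeries.coeff n f := by
  rw [coeff_ofSeries, if_pos (by omega)]
  simp

theorem waveSeries_ofSeries (f : PowerSeries A) : waveSeries (ofSeries f) = f := by
  ext n
  rw [coeff_waveSeries, coeff_ofSeries_neg]

theorem ordLE_ofSeries (f : PowerSeries A) : OrdLE (ofSeries f) 0 :=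
  fun _ hn => if_neg (not_le.mpr hn)

theorem ext_of_ordLE {P Q : PDO A} (hP : OrdLE P 0) (hQ : OrdLE Q 0)
    (h : ∀ n : ℕ, P.coeff (-(n : ℤ)) = Q.coeff (-(n : ℤ))) : P = Q := by
  ext n
  rcases lt_or_ge 0 n with hn | hn
  · rw [hP n hn, hQ n hn]
  · have := h (-n).toNat
    rwa [Int.toNat_of_nonneg (by omega), neg_neg] at this

theorem isMonic_ofSeries {f : PowerSeries A} (h : PowerSeries.constantCoeff f = 1) :
    IsMonic (ofSeries f) :=
  ⟨ordLE_ofSeries f, by rw [coeff_ofSeries]; simpa using h⟩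

theorem ofSeries_add (f g : PowerSeries A) : ofSeries (f + g) = ofSeries f + ofSeries g := by
  ext n
  simp only [coeff_add, coeff_ofSeries]
  split_ifs <;> simp

theorem ofSeries_sub (f g : PowerSeries A) : ofSeries (f - g) = ofSeries f - ofSeries g := by
  ext n
  simp only [coeff_sub, coeff_ofSeries]
  split_ifs <;> simp

theorem ofSeries_C_mul (a : A) (f : PowerSeries A) :
    ofSeries (PowerSeries.C a * f) = C a * ofSeries f := by
  ext n
  rw [coeff_C_mul, coeff_ofSeries, coeff_ofSeries]
  split_ifs <;> simp

theorem ofSeries_one : ofSeries (1 : PowerSeries A) = 1 := by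
  ext n
  rw [coeff_ofSeries, one_def, coeff_monomial, PowerSeries.coeff_one]
  split_ifs <;> first | rfl | omega

theorem ofSeries_X_pow_mul (k : ℕ) (f : PowerSeries A) :
    ofSeries (PowerSeries.X ^ k * f) = ofSeries f * monomial 1 (-(k : ℤ)) := by
  ext n
  rw [coeff_mul_monomial dx_one, mul_one, coeff_ofSeries, coeff_ofSeries]
  rw [PowerSeries.coeff_X_pow_mul']
  split_ifs <;> first | omega | rfl | (congr 2; omega)

theorem ofSeries_zero : ofSeries (0 : PowerSeries A) = 0 := by
  ext n
  simp [coeff_ofSeries]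

theorem ofSeries_sum {ι : Type*} (s : Finset ι) (f : ι → PowerSeries A) :
    ofSeries (∑ i ∈ s, f i) = ∑ i ∈ s, ofSeries (f i) := by
  ext n
  simp only [coeff_sum, coeff_ofSeries]
  split_ifs <;> simp

theorem dt_ofSeries (n : ℕ+) (f : PowerSeries A) :
    dt n (ofSeries f) = ofSeries (coeffDerivation (FlowAlgebra.d n) f) := by
  ext k
  simp only [coeff_dt, coeff_ofSeries]
  split_ifs <;> simp

/-- The action `f ↦ f + z ∂ₓ f` of `∂ₓ` on symbols. -/
noncomputable def dSymbol (f : PowerSeries A) : PowerSeries A := f + PowerSeries.X * dxSeries f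

/-- With z in the place of ∂⁻¹, the rule ∂ f = (f + f' ∂⁻¹) ∂ moves ∂ to the right. Operator
identities thereby become identities of series. -/
theorem D_mul_ofSeries (f : PowerSeries A) : D * ofSeries f = ofSeries (dSymbol f) * D := by
  ext n
  rw [D, coeff_mul_monomial dx_one, mul_one, ← D, coeff_D_mul]
  simp only [coeff_ofSeries, dSymbol, map_add]
  rcases lt_trichotomy n 1 with h | h | h
  · rw [if_pos (by omega), if_pos (by omega), if_pos (by omega)]
    obtain ⟨k, hk⟩ : ∃ k : ℕ, (-(n - 1)).toNat = k + 1 := ⟨(-n).toNat, by omega⟩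
    have hk' : (-n).toNat = k := by omega
    rw [hk, hk', PowerSeries.coeff_succ_X_mul, coeff_coeffDerivation]
    rfl
  · subst h
    simp [dx_zero]
  · rw [if_neg (by omega), if_neg (by omega), if_neg (by omega), dx_zero, add_zero]

/-- When the right factor has coefficients constant in x, the Leibniz rule has no correction terms
and the operator product is the product of series. -/
theorem ofSeries_mul {f g : PowerSeries A} (hg : dxSeries g = 0) :
    ofSeries f * ofSeries g = ofSeries (f * g) := by
  refine ext_of_ordLE (by simpa using (ordLE_ofSeries f).mul (ordLE_ofSeries g))
    (ordLE_ofSeries _) fun n => ?_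
  have hc : ∀ j, dx (PowerSeries.coeff j g) = 0 := fun j => by
    have := congrArg (PowerSeries.coeff j) hg
    rwa [coeff_coeffDerivation] at this
  have hg0 : ∀ j : ℤ, dx ((ofSeries g).coeff j) = 0 := fun j => by
    rw [coeff_ofSeries]
    split_ifs
    · exact hc _
    · exact dx_zero
  rw [coeff_ofSeries_neg, PowerSeries.coeff_mul, coeff_mul, mulCoeff]
  have hinj : Set.InjOn (fun p : ℕ × ℕ => ((-(p.1 : ℤ), 0) : ℤ × ℕ))
      (Finset.HasAntidiagonal.antidiagonal n : Set (ℕ × ℕ)) := by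
    rintro ⟨a, b⟩ h1 ⟨c, d⟩ h2 h
    simp only [Finset.mem_coe, Finset.HasAntidiagonal.mem_antidiagonal, Prod.mk.injEq] at *
    omega
  classical
  rw [finsum_eq_sum_of_support_subset
    (s := (Finset.HasAntidiagonal.antidiagonal n).image fun p => ((-(p.1 : ℤ), 0) : ℤ × ℕ)),
    Finset.sum_image hinj]
  · refine Finset.sum_congr rfl fun p hp => ?_
    have hp' := Finset.HasAntidiagonal.mem_antidiagonal.mp hp
    have e : -(n : ℤ) - -(p.1 : ℤ) + ((0 : ℕ) : ℤ) = -(p.2 : ℤ) := by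
      push_cast; omega
    simp only [e, coeff_ofSeries_neg, Ring.choose_zero_right, one_smul, Function.iterate_zero, id]
  · rintro ⟨m, r⟩ h
    rw [Function.mem_support] at h
    have hr : r = 0 := by
      by_contra hr
      exact h (by simp only [iterate_dx_of_dx_eq_zero (hg0 _) hr, mul_zero, smul_zero])
    subst hr
    have hm : m ≤ 0 := by
      by_contra hm
      exact h (by rw [ordLE_ofSeries f m (by omega), zero_mul, smul_zero])
    have hm' : -(n : ℤ) ≤ m := by
      by_contra hm'
      refine h ?_
      rw [ordLE_ofSeries g _ (by push_cast; omega), iterate_dx_zero, mul_zero, smul_zero]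
    simp only [Finset.coe_image, Set.mem_image, Finset.mem_coe,
      Finset.HasAntidiagonal.mem_antidiagonal, Prod.mk.injEq, Prod.exists]
    exact ⟨(-m).toNat, n - (-m).toNat, by omega, by omega, trivial⟩

theorem dSymbol_of_dxSeries {f : PowerSeries A} (h : dxSeries f = 0) : dSymbol f = f := by
  rw [dSymbol, h, mul_zero, add_zero]

theorem D_pow_mul_ofSeries {f : PowerSeries A} (h : dxSeries f = 0) (n : ℕ) :
    D ^ n * ofSeries f = ofSeries f * D ^ n := by
  have : Commute (D : PDO A) (ofSeries f) := by
    rw [Commute, SemiconjBy, D_mul_ofSeries, dSymbol_of_dxSeries h]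
  exact this.pow_left n

theorem act_mul_right_of_dx (P : PDO A) {e : A} (he : dx e = 0) (f : A) :
    act P (f * e) = act P f * e := by
  rw [act_eq, act_eq, ← C_mul_C, ← mul_assoc]
  change (P * C f * monomial e 0).coeff 0 = _
  rw [coeff_mul_monomial he, sub_zero]

theorem act_sum_right {ι : Type*} (P : PDO A) (s : Finset ι) (f : ι → A) :
    act P (∑ i ∈ s, f i) = ∑ i ∈ s, act P (f i) := by
  classical
  induction s using Finset.induction_on with
  | empty => rw [Finset.sum_empty, Finset.sum_empty, act_eq, C_zero, mul_zero, coeff_zero]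
  | insert i s hi ih => rw [Finset.sum_insert hi, Finset.sum_insert hi, act_add_right, ih]

end PDO

end Symbols

/-! ### Evaluation, derivatives and standard elements of 𝒪(U) -/

section AnalyticFunctions

variable {U : TimeDomain}

/-- Evaluation of analytic functions at a point of `U`. -/
noncomputable def evalAt (t : U.carrier) : analyticFunctions U →+* ℂ :=
  (Pi.evalRingHom (fun _ : U.carrier => ℂ) t).comp (analyticFunctions U).subtype

theorem evalAt_apply (t : U.carrier) (f : analyticFunctions U) : evalAt t f = f.1 t := rfl

@[simp] theorem evalAt_mk (t : U.carrier) (f : U.carrier → ℂ) (hf : f ∈ analyticFunctions U) :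
    evalAt t ⟨f, hf⟩ = f t := rfl

@[simp] theorem evalAt_algebraMap (t : U.carrier) (c : ℂ) :
    evalAt t (algebraMap ℂ (analyticFunctions U) c) = c := rfl

theorem ext_evalAt {f g : analyticFunctions U} (h : ∀ t, evalAt t f = evalAt t g) : f = g :=
  Subtype.ext (funext h)

theorem mem_analyticFunctions {F : TimeSpace → ℂ} (hF : ∀ s ∈ U.carrier, ∀ (m : ℕ)
    (i : Fin m → ℕ+), AnalyticAt ℂ (fun v => F (slice s i v)) 0) :
    (fun t : U.carrier => F t.1) ∈ analyticFunctions U := by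
  intro s m i
  refine (hF s.1 s.2 m i).congr ?_
  filter_upwards [U.eventually_mem s i] with v hv
  rw [extendZero_of_mem _ hv]

theorem eventually_mem_line (s : U.carrier) (n : ℕ+) :
    ∀ᶠ z in nhds (0 : ℂ), s.1 + Finsupp.single n z ∈ U.carrier := by
  have h2 : Filter.Tendsto (fun z : ℂ => (fun _ : Fin 1 => z)) (nhds 0) (nhds 0) :=
    (by fun_prop : Continuous fun z : ℂ => (fun _ : Fin 1 => z)).tendsto' _ _ rfl
  have h := h2.eventually (U.eventually_mem s fun _ : Fin 1 => n)
  simpa [slice] using h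

theorem hasDerivAt_line (n : ℕ+) (f : analyticFunctions U) (t : U.carrier) :
    HasDerivAt (fun z : ℂ => extendZero f.1 (t.1 + Finsupp.single n z))
      (evalAt t (FlowAlgebra.d n f)) 0 :=
  (differentiableAt_line U f.2 n t).hasDerivAt

/-- Partial derivatives depend only on values near the point, so the extension by zero may be
replaced by any formula valid on U. -/
theorem evalAt_d_eq {n : ℕ+} {f : analyticFunctions U} {F : TimeSpace → ℂ} {f' : ℂ}
    {t : U.carrier} (hF : ∀ s, evalAt s f = F s.1)
    (h : HasDerivAt (fun z : ℂ => F (t.1 + Finsupp.single n z)) f' 0) :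
    evalAt t (FlowAlgebra.d n f) = f' := by
  refine (h.congr_of_eventuallyEq ?_).deriv
  filter_upwards [eventually_mem_line t n] with z hz
  rw [extendZero_of_mem _ hz]
  exact hF ⟨_, hz⟩

@[simp] theorem d_algebraMap (n : ℕ+) (c : ℂ) :
    FlowAlgebra.d n (algebraMap ℂ (analyticFunctions U) c) = 0 :=
  (partialDerivation U n).map_algebraMap c

theorem isUnit_of_evalAt_ne_zero {f : analyticFunctions U} (h : ∀ t, evalAt t f ≠ 0) :
    IsUnit f := by
  have hg : (fun t => (f.1 t)⁻¹) ∈ analyticFunctions U := by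
    intro s m i
    have h1 : extendZero f.1 (slice s.1 i 0) ≠ 0 := by
      rw [slice_zero, extendZero_val]; exact h s
    refine ((f.2 s m i).inv h1).congr ?_
    filter_upwards [U.eventually_mem s i] with v hv
    rw [Pi.inv_apply, extendZero_of_mem _ hv, extendZero_of_mem _ hv]
  refine IsUnit.of_mul_eq_one ⟨_, hg⟩ (ext_evalAt fun t => ?_)
  rw [map_mul, map_one, evalAt_mk]
  exact mul_inv_cancel₀ (h t)

theorem analyticAt_coordinate {m : ℕ} (j : Fin m) (v : Fin m → ℂ) :
    AnalyticAt ℂ (fun v : Fin m → ℂ => v j) v :=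
  (ContinuousLinearMap.proj (R := ℂ) (φ := fun _ : Fin m => ℂ) j).analyticAt v

theorem apply_slice (ℓ : TimeSpace →ₗ[ℂ] ℂ) (s : TimeSpace) {m : ℕ} (i : Fin m → ℕ+)
    (v : Fin m → ℂ) :
    ℓ (slice s i v) = ℓ s + ∑ j, v j * ℓ (Finsupp.single (i j) 1) := by
  rw [slice, map_add, map_sum]
  congr 1
  refine Finset.sum_congr rfl fun j _ => ?_
  rw [← smul_eq_mul, ← map_smul, Finsupp.smul_single, smul_eq_mul, mul_one]

theorem analyticAt_apply_slice (ℓ : TimeSpace →ₗ[ℂ] ℂ) (s : TimeSpace) {m : ℕ}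
    (i : Fin m → ℕ+) (v : Fin m → ℂ) : AnalyticAt ℂ (fun v => ℓ (slice s i v)) v := by
  simp only [apply_slice]
  exact analyticAt_const.add (Finset.analyticAt_fun_sum _ fun j _ =>
    (analyticAt_coordinate j v).mul analyticAt_const)

theorem apply_add_single (ℓ : TimeSpace →ₗ[ℂ] ℂ) (s : TimeSpace) (n : ℕ+) (z : ℂ) :
    ℓ (s + Finsupp.single n z) = ℓ s + z * ℓ (Finsupp.single n 1) := by
  rw [map_add, ← smul_eq_mul, ← map_smul, Finsupp.smul_single, smul_eq_mul, mul_one]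

variable (U)

/-- A linear function of the times. -/
noncomputable def linearFunction (ℓ : TimeSpace →ₗ[ℂ] ℂ) : analyticFunctions U :=
  ⟨fun t => ℓ t.1, mem_analyticFunctions fun s _ _ i => analyticAt_apply_slice ℓ s i 0⟩

@[simp] theorem evalAt_linearFunction (ℓ : TimeSpace →ₗ[ℂ] ℂ) (t : U.carrier) :
    evalAt t (linearFunction U ℓ) = ℓ t.1 := rfl

theorem d_linearFunction (ℓ : TimeSpace →ₗ[ℂ] ℂ) (n : ℕ+) :
    FlowAlgebra.d n (linearFunction U ℓ) = algebraMap ℂ _ (ℓ (Finsupp.single n 1)) := by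
  refine ext_evalAt fun t => evalAt_d_eq (F := ℓ) (fun s => rfl) ?_
  simp only [apply_add_single]
  rw [evalAt_algebraMap]
  simpa using ((hasDerivAt_id (0 : ℂ)).mul_const (ℓ (Finsupp.single n 1))).const_add (ℓ t.1)

/-- A quadratic function of the times. -/
noncomputable def quadraticFunction (b : TimeSpace →ₗ[ℂ] TimeSpace →ₗ[ℂ] ℂ) : analyticFunctions U :=
  ⟨fun t => b t.1 t.1, mem_analyticFunctions (F := fun t => b t t) fun s _ _ i => by
    have h : ∀ v, b (slice s i v) (slice s i v) =
        b.flip (slice s i v) s + ∑ j, v j * b (Finsupp.single (i j) 1) (slice s i v) := by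
      intro v
      have := apply_slice (b.flip (slice s i v)) s i v
      simpa only [LinearMap.flip_apply] using this
    simp only [h, LinearMap.flip_apply]
    refine (analyticAt_apply_slice (b s) s i 0).add
      (Finset.analyticAt_fun_sum _ fun j _ => (analyticAt_coordinate j 0).mul
        (analyticAt_apply_slice (b (Finsupp.single (i j) 1)) s i 0))⟩

@[simp] theorem evalAt_quadraticFunction (b : TimeSpace →ₗ[ℂ] TimeSpace →ₗ[ℂ] ℂ)
    (t : U.carrier) : evalAt t (quadraticFunction U b) = b t.1 t.1 := rfl

theorem d_quadraticFunction (b : TimeSpace →ₗ[ℂ] TimeSpace →ₗ[ℂ] ℂ) (n : ℕ+) :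
    FlowAlgebra.d n (quadraticFunction U b) =
      linearFunction U (b (Finsupp.single n 1) + b.flip (Finsupp.single n 1)) := by
  refine ext_evalAt fun t => evalAt_d_eq (F := fun t => b t t) (fun s => rfl) ?_
  have h : ∀ z : ℂ, b (t.1 + Finsupp.single n z) (t.1 + Finsupp.single n z) =
      b t.1 t.1 + z * (b t.1 (Finsupp.single n 1) + b (Finsupp.single n 1) t.1) +
        z ^ 2 * b (Finsupp.single n 1) (Finsupp.single n 1) := by
    intro z
    have h1 := apply_add_single (b.flip (t.1 + Finsupp.single n z)) t.1 n z
    simp only [LinearMap.flip_apply] at h1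
    rw [h1, apply_add_single, apply_add_single]
    ring
  have h2 := (((hasDerivAt_id (0 : ℂ)).mul_const
    (b t.1 (Finsupp.single n 1) + b (Finsupp.single n 1) t.1)).const_add (b t.1 t.1)).add
    (((hasDerivAt_id (0 : ℂ)).pow 2).mul_const (b (Finsupp.single n 1) (Finsupp.single n 1)))
  refine (h2.congr_of_eventuallyEq (.of_forall fun z => ?_)).congr_deriv ?_
  · simpa using h z
  · simp [add_comm]

variable {U}

/-- A function of `x`. -/
noncomputable def functionOfX (f : ℂ → ℂ) (hf : ∀ t ∈ U.carrier, AnalyticAt ℂ f (t 1)) :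
    analyticFunctions U :=
  ⟨fun t => f (t.1 1), mem_analyticFunctions (F := fun t => f (t 1)) fun s hs _ i => by
    have h := analyticAt_apply_slice (Finsupp.lapply 1) s i 0
    change AnalyticAt ℂ (fun v => slice s i v 1) 0 at h
    refine AnalyticAt.comp (g := f) (f := fun v => slice s i v 1) ?_ h
    rw [slice_zero]
    exact hf s hs⟩

section FunctionOfX

variable {f : ℂ → ℂ} (hf : ∀ t ∈ U.carrier, AnalyticAt ℂ f (t 1))

@[simp] theorem evalAt_functionOfX (t : U.carrier) : evalAt t (functionOfX f hf) = f (t.1 1) := rfl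

theorem d_one_functionOfX :
    dx (functionOfX f hf) = functionOfX (deriv f) fun t ht => (hf t ht).deriv := by
  refine ext_evalAt fun t => evalAt_d_eq (F := fun t => f (t 1)) (fun s => rfl) ?_
  have h1 : HasDerivAt (fun z : ℂ => t.1 1 + z) 1 0 := by
    simpa using (hasDerivAt_id (0 : ℂ)).const_add (t.1 1)
  have h2 : HasDerivAt f (deriv f (t.1 1)) (t.1 1 + 0) := by
    rw [add_zero]; exact (hf t.1 t.2).differentiableAt.hasDerivAt
  simpa [Function.comp_def] using h2.comp (0 : ℂ) h1

theorem d_functionOfX {n : ℕ+} (hn : n ≠ 1) : FlowAlgebra.d n (functionOfX f hf) = 0 := by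
  refine ext_evalAt fun t => evalAt_d_eq (F := fun t => f (t 1)) (fun s => rfl) ?_
  simp only [Finsupp.add_apply, Finsupp.single_eq_of_ne hn.symm, add_zero]
  exact hasDerivAt_const _ _

theorem dx_functionOfX_eq {g : ℂ → ℂ} (hg : ∀ t ∈ U.carrier, AnalyticAt ℂ g (t 1))
    (h : ∀ t ∈ U.carrier, HasDerivAt f (g (t 1)) (t 1)) :
    dx (functionOfX f hf) = functionOfX g hg := by
  rw [d_one_functionOfX]
  exact ext_evalAt fun t => (h t.1 t.2).deriv

theorem evalAt_iterate_dx_functionOfX (j : ℕ) (t : U.carrier) :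
    evalAt t (dx^[j] (functionOfX f hf)) = iteratedDeriv j f (t.1 1) := by
  induction j generalizing f with
  | zero => simp
  | succ j ih => rw [Function.iterate_succ_apply, d_one_functionOfX, ih, iteratedDeriv_succ']

end FunctionOfX

/-- The exponential of an analytic function. -/
noncomputable def expFunction (f : analyticFunctions U) : analyticFunctions U :=
  ⟨fun t => Complex.exp (f.1 t), fun s m i => by
    refine (f.2 s m i).cexp.congr ?_
    filter_upwards [U.eventually_mem s i] with v hv
    rw [Function.comp_apply, extendZero_of_mem _ hv, extendZero_of_mem _ hv]⟩

@[simp] theorem evalAt_expFunction (f : analyticFunctions U) (t : U.carrier) :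
    evalAt t (expFunction f) = Complex.exp (evalAt t f) := rfl

theorem isUnit_expFunction (f : analyticFunctions U) : IsUnit (expFunction f) :=
  isUnit_of_evalAt_ne_zero fun _ => Complex.exp_ne_zero _

theorem d_expFunction (n : ℕ+) (f : analyticFunctions U) :
    FlowAlgebra.d n (expFunction f) = FlowAlgebra.d n f * expFunction f := by
  refine ext_evalAt fun t => ?_
  have h := (hasDerivAt_line n f t).cexp
  rw [Finsupp.single_zero, add_zero, extendZero_val] at h
  rw [map_mul, mul_comm]
  refine (h.congr_of_eventuallyEq ?_).deriv
  filter_upwards [eventually_mem_line t n] with z hz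
  rw [extendZero_of_mem _ hz, extendZero_of_mem _ hz]
  rfl

end AnalyticFunctions

/-! ### Symmetry and summation identities for q and s -/

section QuadraticCoefficients

variable (Λ : PeriodPair)

theorem laurentCoeff_eq_zero_of_odd {n : ℕ} (hn : Odd n) : laurentCoeff Λ n = 0 := by
  have h := iteratedDeriv_comp_neg n (Λ.weierstrassPExcept 0) 0
  have e : (fun z => Λ.weierstrassPExcept 0 (-z)) = Λ.weierstrassPExcept 0 := by
    funext z
    rw [Λ.weierstrassPExcept_neg, neg_zero]
  rw [e, neg_zero, hn.neg_one_pow, neg_one_smul, self_eq_neg] at h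
  rw [laurentCoeff, h, zero_div]

/-- For m + n even the signs agree; for m + n odd both sides vanish, because ℘ is even and its odd
Laurent coefficients are zero. -/
theorem quadraticCoeff_comm {m n : ℕ} (hm : 1 ≤ m) (hn : 1 ≤ n) :
    quadraticCoeff Λ m n = quadraticCoeff Λ n m := by
  rw [quadraticCoeff, quadraticCoeff, add_comm n m]
  rcases Nat.even_or_odd (m + n) with h | h
  · have : (-1 : ℂ) ^ m = (-1) ^ n := by
      rcases Nat.even_or_odd m with h1 | h1
      · rw [h1.neg_one_pow, ((Nat.even_add.mp h).mp h1).neg_one_pow]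
      · rw [h1.neg_one_pow, ((Nat.even_add'.mp h).mp h1).neg_one_pow]
    rw [this]
    ring
  · rw [laurentCoeff_eq_zero_of_odd Λ (n := m + n - 2) (by
      obtain ⟨k, hk⟩ := h
      exact ⟨k - 1, by omega⟩)]
    ring

/-- Averaging over j ↔ n + 1 - j uses 1/j + 1/(n + 1 - j) = (n + 1)/(j(n + 1 - j)). The term with
denominator 0 is 0 by convention, so the range effectively starts at 1. -/
theorem sum_quadraticCoeff_div (n : ℕ) :
    ∑ p ∈ Finset.HasAntidiagonal.antidiagonal n, quadraticCoeff Λ p.2 (p.1 + 1) / p.2 =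
      linearCoeff Λ (n + 1) := by
  have h1 : ∑ p ∈ Finset.HasAntidiagonal.antidiagonal n, quadraticCoeff Λ p.2 (p.1 + 1) / p.2 =
      ∑ j ∈ Finset.Ico 1 (n + 1), quadraticCoeff Λ j (n + 1 - j) / j := by
    rw [← Finset.Nat.sum_antidiagonal_swap, Finset.Nat.sum_antidiagonal_eq_sum_range_succ_mk,
      Finset.range_eq_Ico, Finset.sum_eq_sum_Ico_succ_bot (by omega)]
    simp only [Prod.fst_swap, Prod.snd_swap, Nat.cast_zero, div_zero, zero_add]
    refine Finset.sum_congr rfl fun j hj => ?_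
    rw [Finset.mem_Ico] at hj
    rw [show n - j + 1 = n + 1 - j by omega]
  have h2 : ∑ j ∈ Finset.Ico 1 (n + 1), quadraticCoeff Λ j (n + 1 - j) / j =
      ∑ j ∈ Finset.Ico 1 (n + 1), quadraticCoeff Λ (n + 1 - j) j / (n + 1 - j : ℕ) := by
    refine Finset.sum_bij' (fun j _ => n + 1 - j) (fun j _ => n + 1 - j) ?_ ?_ ?_ ?_ ?_ <;>
      intro j hj <;> rw [Finset.mem_Ico] at hj
    · rw [Finset.mem_Ico]; omega
    · rw [Finset.mem_Ico]; omega
    · omega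
    · omega
    · rw [show n + 1 - (n + 1 - j) = j by omega]
  have h3 : 2 * ∑ j ∈ Finset.Ico 1 (n + 1), quadraticCoeff Λ j (n + 1 - j) / j =
      (n + 1) * ∑ j ∈ Finset.Ico 1 (n + 1),
        quadraticCoeff Λ (n + 1 - j) j / (j * (n + 1 - j : ℕ)) := by
    rw [two_mul]
    nth_rw 2 [h2]
    rw [← Finset.sum_add_distrib, Finset.mul_sum]
    refine Finset.sum_congr rfl fun j hj => ?_
    rw [Finset.mem_Ico] at hj
    rw [quadraticCoeff_comm Λ hj.1 (by omega : 1 ≤ n + 1 - j)]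
    have e1 : (j : ℂ) ≠ 0 := by exact_mod_cast (by omega : j ≠ 0)
    have e2 : ((n + 1 - j : ℕ) : ℂ) ≠ 0 := by exact_mod_cast (by omega : n + 1 - j ≠ 0)
    have e3 : (n : ℂ) + 1 = j + (n + 1 - j : ℕ) := by
      rw [← Nat.cast_add, show j + (n + 1 - j) = n + 1 by omega]; push_cast; rfl
    rw [e3]
    field_simp
    ring
  rw [h1, linearCoeff]
  push_cast
  linear_combination h3 / 2

end QuadraticCoefficients

/-! ### The shift of the Gaussian factor -/

section TauFunction

variable (Λ : PeriodPair) (U : TimeDomain)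

/-- The power series `∑ⱼ (∑ᵢ cⱼᵢ tᵢ) zʲ`. -/
noncomputable def linearSeries (c : ℕ → ℕ+ → ℂ) : PowerSeries (analyticFunctions U) :=
  PowerSeries.mk fun j => linearFunction U (Finsupp.linearCombination ℂ (c j))

theorem coeffDerivation_linearSeries (c : ℕ → ℕ+ → ℂ) (n : ℕ+) :
    coeffDerivation (FlowAlgebra.d n) (linearSeries U c) =
      PowerSeries.map (algebraMap ℂ (analyticFunctions U)) (PowerSeries.mk fun j => c j n) := by
  ext j
  rw [coeff_coeffDerivation, linearSeries, PowerSeries.coeff_mk, d_linearFunction]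
  simp

theorem constantCoeff_linearSeries {c : ℕ → ℕ+ → ℂ} (hc : ∀ i, c 0 i = 0) :
    PowerSeries.constantCoeff (linearSeries U c) = 0 := by
  rw [← PowerSeries.coeff_zero_eq_constantCoeff_apply, linearSeries, PowerSeries.coeff_mk]
  refine ext_evalAt fun t => ?_
  rw [evalAt_linearFunction, Finsupp.linearCombination_apply, map_zero]
  exact Finset.sum_eq_zero fun i _ => by simp [hc]

theorem linearSeries_add (c c' : ℕ → ℕ+ → ℂ) :
    linearSeries U (c + c') = linearSeries U c + linearSeries U c' := by
  ext1 j
  refine ext_evalAt fun t => ?_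
  simp only [linearSeries, PowerSeries.coeff_mk, map_add, evalAt_linearFunction,
    Finsupp.linearCombination_apply, Finsupp.sum, Pi.add_apply, smul_add, Finset.sum_add_distrib]

/-- The coefficients `q_{ji} / j`, restricted to `i = 1`. -/
noncomputable def stationaryExponent (j : ℕ) (i : ℕ+) : ℂ :=
  if i = 1 then quadraticCoeff Λ j i / j else 0

/-- The coefficients `q_{ji} / j`, restricted to `i ≠ 1`. -/
noncomputable def timeExponent (j : ℕ) (i : ℕ+) : ℂ :=
  if i = 1 then 0 else quadraticCoeff Λ j i / j

theorem stationaryExponent_add_timeExponent :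
    stationaryExponent Λ + timeExponent Λ = fun (j : ℕ) (i : ℕ+) => quadraticCoeff Λ j i / j := by
  funext j i
  rw [Pi.add_apply, Pi.add_apply, stationaryExponent, timeExponent]
  split_ifs <;> simp

theorem stationaryExponent_zero (i : ℕ+) : stationaryExponent Λ 0 i = 0 := by
  simp [stationaryExponent]

theorem timeExponent_zero (i : ℕ+) : timeExponent Λ 0 i = 0 := by
  simp [timeExponent]

/-- The quadratic function `Q` as an element of `𝒪(U)`. -/
noncomputable def quadraticElement : analyticFunctions U :=
  algebraMap ℂ _ (1 / 2) * quadraticFunction U (Finsupp.linearCombination ℂ fun i : ℕ+ =>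
    Finsupp.linearCombination ℂ fun j : ℕ+ => quadraticCoeff Λ i j) +
  linearFunction U (Finsupp.linearCombination ℂ fun i : ℕ+ => linearCoeff Λ i)

theorem evalAt_quadraticElement (t : U.carrier) :
    evalAt t (quadraticElement Λ U) = quadraticQ Λ t.1 := by
  rw [quadraticElement, quadraticQ, map_add, map_mul, evalAt_algebraMap, evalAt_quadraticFunction,
    evalAt_linearFunction, Finsupp.linearCombination_apply, Finsupp.linearCombination_apply]
  congr 2
  · rw [Finsupp.sum, LinearMap.sum_apply]
    refine Finset.sum_congr rfl fun i _ => ?_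
    rw [LinearMap.smul_apply, Finsupp.linearCombination_apply, Finsupp.sum, Finset.smul_sum]
    refine Finset.sum_congr rfl fun j _ => ?_
    simp only [smul_eq_mul]
    ring
  · funext i u
    rw [smul_eq_mul, mul_comm]

theorem d_quadraticElement (n : ℕ+) : FlowAlgebra.d n (quadraticElement Λ U) =
    linearFunction U (Finsupp.linearCombination ℂ fun j : ℕ+ => quadraticCoeff Λ n j) +
      algebraMap ℂ _ (linearCoeff Λ n) := by
  rw [quadraticElement, map_add, Derivation.leibniz, d_algebraMap, smul_zero, add_zero,
    d_quadraticFunction, d_linearFunction]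
  refine ext_evalAt fun t => ?_
  simp only [map_add, smul_eq_mul, map_mul, evalAt_algebraMap, evalAt_linearFunction,
    LinearMap.add_apply, Finsupp.linearCombination_single, one_smul, LinearMap.flip_apply]
  have : (Finsupp.linearCombination ℂ fun i : ℕ+ =>
      Finsupp.linearCombination ℂ fun j : ℕ+ => quadraticCoeff Λ i j) t.1 (Finsupp.single n 1) =
      (Finsupp.linearCombination ℂ fun j : ℕ+ => quadraticCoeff Λ n j) t.1 := by
    rw [Finsupp.linearCombination_apply, Finsupp.linearCombination_apply, Finsupp.sum,
      LinearMap.sum_apply]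
    refine Finset.sum_congr rfl fun i _ => ?_
    simp only [LinearMap.smul_apply, Finsupp.linearCombination_single, one_smul]
    rw [quadraticCoeff_comm Λ i.pos n.pos]
  rw [this]
  ring

/-- The right side has constant term e^{-Q}, and F kills it: d/dz of the exponent reproduces the
linear part of the gradient of Q, while the flows on the exponent produce the sum equal to sₙ₊₁.
This is why Q carries the linear terms sᵢ tᵢ. -/
theorem shiftSeries_exp_quadraticElement :
    shiftSeries (expFunction (-quadraticElement Λ U)) =
      PowerSeries.C (expFunction (-quadraticElement Λ U)) *
        expSeries (linearSeries U (stationaryExponent Λ + timeExponent Λ)) := by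
  have hc : PowerSeries.constantCoeff
      (linearSeries U (stationaryExponent Λ + timeExponent Λ)) = 0 :=
    constantCoeff_linearSeries U fun i => by
      rw [Pi.add_apply, Pi.add_apply, stationaryExponent_zero, timeExponent_zero, add_zero]
  have key := eq_shiftSeries (F := PowerSeries.C (expFunction (-quadraticElement Λ U)) *
        expSeries (linearSeries U (stationaryExponent Λ + timeExponent Λ))) ?_
  · rw [key]
    simp
  · rw [Derivation.leibniz, flowDerivation_expSeries hc, flowDerivation_C, smul_eq_mul, smul_eq_mul]
    have h : (PowerSeries.mk fun n => FlowAlgebra.d (Nat.succPNat n)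
        (expFunction (-quadraticElement Λ U))) =
        -(PowerSeries.C (expFunction (-quadraticElement Λ U)) *
        flowDerivation _ (linearSeries U (stationaryExponent Λ + timeExponent Λ))) := by
      ext1 n
      rw [PowerSeries.coeff_mk, d_expFunction, map_neg, d_quadraticElement, map_neg,
        PowerSeries.coeff_C_mul, coeff_flowDerivation, mul_comm]
      refine (mul_neg _ _).trans ?_
      congr 2
      simp only [← coeff_coeffDerivation, coeffDerivation_linearSeries]
      simp only [stationaryExponent_add_timeExponent, PowerSeries.coeff_map, PowerSeries.coeff_mk,
        linearSeries, ← map_sum, Nat.succPNat_coe, Nat.succ_eq_add_one, sum_quadraticCoeff_div]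
      congr 1
      refine ext_evalAt fun t => ?_
      rw [map_mul, evalAt_linearFunction, evalAt_linearFunction, map_add, map_natCast, map_one,
        Finsupp.linearCombination_apply, Finsupp.linearCombination_apply, Finsupp.sum, Finsupp.sum,
        Finset.sum_mul]
      refine Finset.sum_congr rfl fun i _ => ?_
      have : (n : ℂ) + 1 ≠ 0 := Nat.cast_add_one_ne_zero n
      rw [smul_eq_mul, smul_eq_mul]
      push_cast
      field_simp
    rw [h]
    ring

variable {U}

/-- The function `σ(x)`. -/
noncomputable def sigmaElement (Λ : PeriodPair) (U : TimeDomain) : analyticFunctions U :=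
  functionOfX (weierstrassSigma Λ) fun t _ =>
    (differentiable_weierstrassSigma Λ).analyticAt (t 1)

theorem isUnit_sigmaElement (hU : ∀ t ∈ U.carrier, t 1 ∉ Λ.lattice) : IsUnit (sigmaElement Λ U) :=
  isUnit_of_evalAt_ne_zero fun t => weierstrassSigma_ne_zero Λ (hU t.1 t.2)

end TauFunction

/-! ### Transfer of analytic identities to formal power series -/

section Taylor

open PowerSeries Filter
open scoped Topology

/-- The Taylor series at `0`. -/
noncomputable def taylorSeries (f : ℂ → ℂ) : PowerSeries ℂ :=
  PowerSeries.mk fun n => iteratedDeriv n f 0 / n.factorial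

theorem coeff_taylorSeries (n : ℕ) (f : ℂ → ℂ) :
    coeff n (taylorSeries f) = iteratedDeriv n f 0 / n.factorial := coeff_mk _ _

variable {f g : ℂ → ℂ}

theorem taylorSeries_congr (h : f =ᶠ[𝓝 0] g) : taylorSeries f = taylorSeries g := by
  ext n
  rw [coeff_taylorSeries, coeff_taylorSeries, h.iteratedDeriv_eq]

theorem taylorSeries_congr_punctured (hf : AnalyticAt ℂ f 0) (hg : AnalyticAt ℂ g 0)
    (h : ∀ᶠ z in 𝓝[≠] 0, f z = g z) : taylorSeries f = taylorSeries g :=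
  taylorSeries_congr ((hf.frequently_eq_iff_eventually_eq hg).mp h.frequently)

theorem taylorSeries_add (hf : AnalyticAt ℂ f 0) (hg : AnalyticAt ℂ g 0) :
    taylorSeries (fun z => f z + g z) = taylorSeries f + taylorSeries g := by
  ext n
  rw [map_add, coeff_taylorSeries, coeff_taylorSeries, coeff_taylorSeries,
    iteratedDeriv_fun_add hf.contDiffAt hg.contDiffAt, add_div]

theorem taylorSeries_mul (hf : AnalyticAt ℂ f 0) (hg : AnalyticAt ℂ g 0) :
    taylorSeries (fun z => f z * g z) = taylorSeries f * taylorSeries g := by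
  ext n
  rw [coeff_taylorSeries, iteratedDeriv_fun_mul hf.contDiffAt hg.contDiffAt, coeff_mul,
    Finset.Nat.sum_antidiagonal_eq_sum_range_succ_mk, Finset.sum_div]
  refine Finset.sum_congr rfl fun i hi => ?_
  have hi' : i ≤ n := by rw [Finset.mem_range] at hi; omega
  rw [coeff_taylorSeries, coeff_taylorSeries, Nat.cast_choose ℂ hi']
  have h1 := Nat.cast_ne_zero (R := ℂ).mpr (Nat.factorial_ne_zero n)
  have h2 := Nat.cast_ne_zero (R := ℂ).mpr (Nat.factorial_ne_zero i)
  have h3 := Nat.cast_ne_zero (R := ℂ).mpr (Nat.factorial_ne_zero (n - i))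
  field_simp

theorem taylorSeries_const (c : ℂ) : taylorSeries (fun _ => c) = C c := by
  ext n
  rw [coeff_taylorSeries, iteratedDeriv_const, coeff_C]
  split_ifs with h
  · simp [h]
  · simp

theorem taylorSeries_id : taylorSeries (fun z => z) = X := by
  ext n
  rw [coeff_taylorSeries, iteratedDeriv_fun_id_zero, coeff_X]
  split_ifs with h
  · simp [h]
  · simp

theorem constantCoeff_taylorSeries (f : ℂ → ℂ) : constantCoeff (taylorSeries f) = f 0 := by
  rw [← coeff_zero_eq_constantCoeff_apply, coeff_taylorSeries]
  simp

theorem derivative_taylorSeries (f : ℂ → ℂ) :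
    derivative ℂ (taylorSeries f) = taylorSeries (deriv f) := by
  ext n
  rw [coeff_derivative, coeff_taylorSeries, coeff_taylorSeries, iteratedDeriv_succ',
    Nat.factorial_succ]
  have h1 := Nat.cast_ne_zero (R := ℂ).mpr (Nat.factorial_ne_zero n)
  have h2 := Nat.cast_add_one_ne_zero (R := ℂ) n
  push_cast
  field_simp

theorem taylorSeries_exp (hf : AnalyticAt ℂ f 0) (h0 : f 0 = 0) :
    taylorSeries (fun z => Complex.exp (f z)) = expSeries (taylorSeries f) := by
  refine eq_expSeries (by rw [constantCoeff_taylorSeries, h0]) ?_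
    (by rw [constantCoeff_taylorSeries, h0, Complex.exp_zero])
  rw [derivative_taylorSeries, derivative_taylorSeries]
  refine Eq.trans ?_ (taylorSeries_mul hf.deriv hf.cexp)
  refine taylorSeries_congr ?_
  filter_upwards [hf.eventually_analyticAt] with z hz
  rw [mul_comm]
  exact (hz.differentiableAt.hasDerivAt.cexp).deriv

variable {U : TimeDomain} {t : U.carrier}

/-- At the point `t`, the power series `F` is the Taylor series of `f`. -/
structure IsTaylorAt (t : U.carrier) (F : PowerSeries (analyticFunctions U)) (f : ℂ → ℂ) :
    Prop where
  analyticAt : AnalyticAt ℂ f 0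
  map_eq : PowerSeries.map (evalAt t) F = taylorSeries f

/-- Equality on a punctured neighbourhood suffices, so identities involving functions with poles at
z = 0 can be used after their poles are cleared. -/
theorem eq_of_isTaylorAt {F G : PowerSeries (analyticFunctions U)} {f g : U.carrier → ℂ → ℂ}
    (hF : ∀ t, IsTaylorAt t F (f t)) (hG : ∀ t, IsTaylorAt t G (g t))
    (h : ∀ t, ∀ᶠ z in 𝓝[≠] 0, f t z = g t z) : F = G := by
  ext1 n
  refine ext_evalAt fun t => ?_
  rw [← coeff_map, ← coeff_map, (hF t).map_eq, (hG t).map_eq,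
    taylorSeries_congr_punctured (hF t).analyticAt (hG t).analyticAt (h t)]

namespace IsTaylorAt

variable {F G : PowerSeries (analyticFunctions U)}

theorem add (hF : IsTaylorAt t F f) (hG : IsTaylorAt t G g) :
    IsTaylorAt t (F + G) fun z => f z + g z :=
  ⟨hF.1.add hG.1, by rw [map_add, hF.2, hG.2, taylorSeries_add hF.1 hG.1]⟩

theorem mul (hF : IsTaylorAt t F f) (hG : IsTaylorAt t G g) :
    IsTaylorAt t (F * G) fun z => f z * g z :=
  ⟨hF.1.mul hG.1, by rw [map_mul, hF.2, hG.2, taylorSeries_mul hF.1 hG.1]⟩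

theorem C (a : analyticFunctions U) :
    IsTaylorAt t (PowerSeries.C a) fun _ => evalAt t a :=
  ⟨analyticAt_const, by rw [map_C, taylorSeries_const]⟩

theorem X : IsTaylorAt t PowerSeries.X fun z => z :=
  ⟨analyticAt_id, by rw [map_X, taylorSeries_id]⟩

theorem one : IsTaylorAt t 1 fun _ => 1 :=
  ⟨analyticAt_const, by rw [map_one, taylorSeries_const, map_one]⟩

theorem neg (hF : IsTaylorAt t F f) : IsTaylorAt t (-F) fun z => -f z := by
  refine ⟨hF.1.neg, ?_⟩
  have h := ((C (t := t) (-1)).mul hF).map_eq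
  simpa using h

theorem sub (hF : IsTaylorAt t F f) (hG : IsTaylorAt t G g) :
    IsTaylorAt t (F - G) fun z => f z - g z := by
  simpa only [sub_eq_add_neg] using hF.add hG.neg

theorem pow (hF : IsTaylorAt t F f) (n : ℕ) : IsTaylorAt t (F ^ n) fun z => f z ^ n := by
  induction n with
  | zero => simpa using one
  | succ n ih => simpa only [pow_succ] using ih.mul hF

theorem map_taylorSeries (hf : AnalyticAt ℂ f 0) :
    IsTaylorAt t (PowerSeries.map (algebraMap ℂ (analyticFunctions U)) (taylorSeries f)) f := by
  refine ⟨hf, ?_⟩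
  ext n
  simp

/-- For a function of x alone the other flows act trivially, and the formal shift is the genuine
Taylor series of f(x - z) in z. -/
theorem shiftSeries {f : ℂ → ℂ} (hf : ∀ t ∈ U.carrier, AnalyticAt ℂ f (t 1)) :
    IsTaylorAt t (shiftSeries (functionOfX f hf)) fun z => f (t.1 1 - z) := by
  constructor
  · refine AnalyticAt.comp (g := f) (f := fun z => t.1 1 - z) ?_ (by fun_prop)
    rw [sub_zero]
    exact hf t.1 t.2
  · ext n
    rw [shiftSeries_eq_taylor fun n hn => d_functionOfX hf hn, coeff_map, coeff_mk, map_rat_smul,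
      evalAt_iterate_dx_functionOfX, coeff_taylorSeries, iteratedDeriv_comp_const_sub]
    simp only [sub_zero, Rat.smul_def, smul_eq_mul]
    push_cast
    ring

theorem exp (hF : IsTaylorAt t F f) (h0 : f 0 = 0) (hc : constantCoeff F = 0) :
    IsTaylorAt t (expSeries F) fun z => Complex.exp (f z) :=
  ⟨hF.1.cexp, by rw [map_expSeries _ hc, hF.2, taylorSeries_exp hF.1 h0]⟩

end IsTaylorAt

end Taylor

/-! ### The series of V₀ and its relation to the τ-function -/

section StationaryWave

open Filter
open scoped Topology

variable (Λ : PeriodPair) (U : TimeDomain)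

theorem analyticAt_weierstrassPExcept_zero : AnalyticAt ℂ (Λ.weierstrassPExcept 0) 0 :=
  Λ.analyticOnNhd_weierstrassPExcept 0 0 (zero_mem_compl_lattice_sdiff Λ)

theorem eventually_mem_compl_lattice_sdiff :
    ∀ᶠ z in 𝓝 (0 : ℂ), z ∈ ((Λ.lattice : Set ℂ) \ {0})ᶜ :=
  Λ.isOpen_compl_lattice_sdiff.mem_nhds (zero_mem_compl_lattice_sdiff Λ)

theorem analyticAt_zetaRegular : AnalyticAt ℂ (zetaRegular Λ) 0 := by
  rw [Complex.analyticAt_iff_eventually_differentiableAt]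
  filter_upwards [eventually_mem_compl_lattice_sdiff Λ] with z hz
  exact (hasDerivAt_zetaRegular Λ hz).differentiableAt

/-- Integrating -(℘(z) - z⁻²) termwise gives -a_{j-1}/j, which is q_{j1}/j by the symmetry of q and
q_{1j} = -a_{j-1}. -/
theorem coeff_taylorSeries_zetaRegular (j : ℕ) :
    PowerSeries.coeff j (taylorSeries (zetaRegular Λ)) = quadraticCoeff Λ j 1 / j := by
  cases j with
  | zero => simp [coeff_taylorSeries, zetaRegular_zero]
  | succ j =>
    have h : deriv (zetaRegular Λ) =ᶠ[𝓝 0] fun z => -Λ.weierstrassPExcept 0 z := by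
      filter_upwards [eventually_mem_compl_lattice_sdiff Λ] with z hz
      exact (hasDerivAt_zetaRegular Λ hz).deriv
    rw [coeff_taylorSeries, iteratedDeriv_succ', h.iteratedDeriv_eq, iteratedDeriv_fun_neg,
      quadraticCoeff_comm Λ (by omega) le_rfl, quadraticCoeff, laurentCoeff]
    have h1 := Nat.cast_ne_zero (R := ℂ).mpr (Nat.factorial_ne_zero j)
    have h2 := Nat.cast_add_one_ne_zero (R := ℂ) j
    have e : 1 + (j + 1) - 2 = j := by omega
    rw [e, Nat.factorial_succ]
    simp only [add_tsub_cancel_right, tsub_self, Nat.factorial_zero]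
    push_cast
    field_simp

/-- The series `v̂₀`. -/
noncomputable def stationaryWaveSeries : PowerSeries (analyticFunctions U) :=
  shiftSeries (sigmaElement Λ U) * PowerSeries.C (Ring.inverse (sigmaElement Λ U)) *
    expSeries (linearSeries U (stationaryExponent Λ))

theorem isTaylorAt_linearSeries_stationaryExponent (t : U.carrier) :
    IsTaylorAt t (linearSeries U (stationaryExponent Λ)) fun z => zetaRegular Λ z * t.1 1 := by
  refine ⟨(analyticAt_zetaRegular Λ).mul analyticAt_const, ?_⟩
  rw [taylorSeries_mul (analyticAt_zetaRegular Λ) analyticAt_const, taylorSeries_const]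
  ext j
  rw [PowerSeries.coeff_map, linearSeries, PowerSeries.coeff_mk, evalAt_linearFunction,
    PowerSeries.coeff_mul_C, coeff_taylorSeries_zetaRegular, Finsupp.linearCombination_apply,
    Finsupp.sum, Finset.sum_eq_single 1]
  · simp [stationaryExponent, mul_comm]
  · intro i _ hi
    rw [stationaryExponent, if_neg hi, smul_zero]
  · intro h
    rw [Finsupp.notMem_support_iff.mp h, zero_smul]

theorem constantCoeff_linearSeries_stationaryExponent :
    PowerSeries.constantCoeff (linearSeries U (stationaryExponent Λ)) = 0 :=
  constantCoeff_linearSeries U (stationaryExponent_zero Λ)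

theorem constantCoeff_linearSeries_timeExponent :
    PowerSeries.constantCoeff (linearSeries U (timeExponent Λ)) = 0 :=
  constantCoeff_linearSeries U (timeExponent_zero Λ)

variable {U}

theorem isTaylorAt_stationaryWaveSeries (hU : ∀ t ∈ U.carrier, t 1 ∉ Λ.lattice) (t : U.carrier) :
    IsTaylorAt t (stationaryWaveSeries Λ U) fun z =>
      weierstrassSigma Λ (t.1 1 - z) / weierstrassSigma Λ (t.1 1) *
        Complex.exp (zetaRegular Λ z * t.1 1) := by
  have h := ((IsTaylorAt.shiftSeries (t := t) (f := weierstrassSigma Λ) fun t _ =>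
    (differentiable_weierstrassSigma Λ).analyticAt (t 1)).mul
    (IsTaylorAt.C (Ring.inverse (sigmaElement Λ U)))).mul
    ((isTaylorAt_linearSeries_stationaryExponent Λ U t).exp (by simp [zetaRegular_zero])
      (constantCoeff_linearSeries_stationaryExponent Λ U))
  have e : evalAt t (Ring.inverse (sigmaElement Λ U)) = (weierstrassSigma Λ (t.1 1))⁻¹ := by
    refine eq_inv_of_mul_eq_one_left ?_
    have := congrArg (evalAt t) (Ring.inverse_mul_cancel _ (isUnit_sigmaElement Λ hU))
    rwa [map_mul, map_one] at this
  simp only [e, ← div_eq_mul_inv] at h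
  exact h

theorem evalAt_coeff_stationaryWaveSeries (hU : ∀ t ∈ U.carrier, t 1 ∉ Λ.lattice) (n : ℕ)
    (t : U.carrier) : evalAt t (PowerSeries.coeff n (stationaryWaveSeries Λ U)) =
      stationaryWaveCoeff Λ n (t.1 1) := by
  rw [← PowerSeries.coeff_map, (isTaylorAt_stationaryWaveSeries Λ hU t).map_eq, coeff_taylorSeries,
    stationaryWaveCoeff]
  congr 1
  refine Filter.EventuallyEq.iteratedDeriv_eq _ ?_
  filter_upwards [eventually_mem_compl_lattice_sdiff Λ] with z hz
  congr 3
  split_ifs with h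
  · rw [h, zetaRegular_zero]
  · rw [weierstrassZeta_eq Λ fun h' => hz ⟨h', h⟩]
    ring

/-- The exponent from e^{-Q} splits into its part in x, which with σ(x - z)/σ(x) forms the series of
V₀, and its part in the remaining times. -/
theorem shiftSeries_tau (hU : ∀ t ∈ U.carrier, t 1 ∉ Λ.lattice) :
    shiftSeries (expFunction (-quadraticElement Λ U) * sigmaElement Λ U) =
      stationaryWaveSeries Λ U * expSeries (linearSeries U (timeExponent Λ)) *
        PowerSeries.C (expFunction (-quadraticElement Λ U) * sigmaElement Λ U) := by
  have h : PowerSeries.C (Ring.inverse (sigmaElement Λ U)) * PowerSeries.C (sigmaElement Λ U) =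
      1 := by
    rw [← map_mul, Ring.inverse_mul_cancel _ (isUnit_sigmaElement Λ hU), map_one]
  rw [shiftSeries_mul, shiftSeries_exp_quadraticElement, linearSeries_add,
    expSeries_add (constantCoeff_linearSeries_stationaryExponent Λ U)
      (constantCoeff_linearSeries_timeExponent Λ U), stationaryWaveSeries, map_mul]
  linear_combination (-PowerSeries.C (expFunction (-quadraticElement Λ U)) *
    shiftSeries (sigmaElement Λ U) * expSeries (linearSeries U (stationaryExponent Λ)) *
    expSeries (linearSeries U (timeExponent Λ))) * h

end StationaryWave

theorem coeffDerivation_shiftSeries {A : Type*} [CommRing A] [Algebra ℚ A] [FlowAlgebra A]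
    (n : ℕ+) (f : A) :
    coeffDerivation (FlowAlgebra.d n) (shiftSeries f) = shiftSeries (FlowAlgebra.d n f) := by
  have h : flowDerivation A (coeffDerivation (FlowAlgebra.d n) (shiftSeries f)) = 0 := by
    rw [flowDerivation_coeffDerivation, flowDerivation_shiftSeries, map_zero]
  rw [eq_shiftSeries h, ← PowerSeries.coeff_zero_eq_constantCoeff_apply, coeff_coeffDerivation,
    PowerSeries.coeff_zero_eq_constantCoeff_apply, constantCoeff_shiftSeries]

/-! ### The logarithmic derivative of the series of V₀ and the addition theorems as formal
identities -/

section StationarySymbols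

open Filter PDO
open scoped Topology

variable {Λ : PeriodPair} {U : TimeDomain} (hU : ∀ t ∈ U.carrier, t 1 ∉ Λ.lattice)

theorem analyticAt_weierstrassZeta {z : ℂ} (hz : z ∉ Λ.lattice) :
    AnalyticAt ℂ (weierstrassZeta Λ) z := by
  rw [Complex.analyticAt_iff_eventually_differentiableAt]
  filter_upwards [eventually_notMem_lattice_of_notMem Λ hz] with w hw
  exact (hasDerivAt_weierstrassZeta Λ hw).differentiableAt

theorem analyticAt_derivWeierstrassP {z : ℂ} (hz : z ∉ Λ.lattice) :
    AnalyticAt ℂ Λ.derivWeierstrassP z := by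
  rw [← Λ.deriv_weierstrassP]
  exact (Λ.analyticOnNhd_weierstrassP z hz).deriv

/-- The function `ζ(x)`. -/
noncomputable def zetaElement : analyticFunctions U :=
  functionOfX (weierstrassZeta Λ) fun t ht => analyticAt_weierstrassZeta (hU t ht)

/-- The function `℘(x)`. -/
noncomputable def pElement : analyticFunctions U :=
  functionOfX Λ.weierstrassP fun t ht => Λ.analyticOnNhd_weierstrassP (t 1) (hU t ht)

/-- The function `℘'(x)`. -/
noncomputable def pDerivElement : analyticFunctions U :=
  functionOfX Λ.derivWeierstrassP fun t ht => analyticAt_derivWeierstrassP (hU t ht)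

theorem dx_zetaElement : dx (zetaElement hU) = -pElement hU := by
  refine ext_evalAt fun t => ?_
  rw [zetaElement, d_one_functionOfX, map_neg, evalAt_functionOfX]
  exact (hasDerivAt_weierstrassZeta Λ (hU t.1 t.2)).deriv

theorem dx_pElement : dx (pElement hU) = pDerivElement hU :=
  dx_functionOfX_eq _ _ fun t ht => hasDerivAt_weierstrassP Λ (hU t ht)

theorem dx_sigmaElement : dx (sigmaElement Λ U) = zetaElement hU * sigmaElement Λ U := by
  refine ext_evalAt fun t => ?_
  rw [sigmaElement, d_one_functionOfX, map_mul, evalAt_functionOfX]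
  exact (hasDerivAt_weierstrassSigma Λ (hU t.1 t.2)).deriv

/-- Series with constant coefficients. -/
noncomputable def constSeries (U : TimeDomain) : PowerSeries ℂ →+* PowerSeries (analyticFunctions U) :=
  PowerSeries.map (algebraMap ℂ (analyticFunctions U))

theorem coeffDerivation_constSeries (n : ℕ+) (f : PowerSeries ℂ) :
    coeffDerivation (FlowAlgebra.d n) (constSeries U f) = 0 := by
  ext1 j
  rw [coeff_coeffDerivation, constSeries, PowerSeries.coeff_map, d_algebraMap, map_zero]

/-- The logarithmic derivative `∂ₓ v̂₀ / v̂₀`. -/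
noncomputable def logDerivSeries : PowerSeries (analyticFunctions U) :=
  shiftSeries (zetaElement hU) - PowerSeries.C (zetaElement hU) +
    constSeries U (taylorSeries (zetaRegular Λ))

theorem dxSeries_stationaryWaveSeries :
    dxSeries (stationaryWaveSeries Λ U) = logDerivSeries hU * stationaryWaveSeries Λ U := by
  have h1 : dxSeries (shiftSeries (sigmaElement Λ U)) =
      shiftSeries (zetaElement hU) * shiftSeries (sigmaElement Λ U) := by
    rw [← shiftSeries_mul, ← dx_sigmaElement]
    exact coeffDerivation_shiftSeries 1 _
  have h2 : dxSeries (PowerSeries.C (Ring.inverse (sigmaElement Λ U))) =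
      -PowerSeries.C (zetaElement hU) * PowerSeries.C (Ring.inverse (sigmaElement Λ U)) := by
    have hs := isUnit_sigmaElement Λ hU
    have h := Ring.mul_inverse_cancel _ hs
    have h3 := congrArg dx h
    rw [dx_mul, dx_one, dx_sigmaElement hU] at h3
    rw [coeffDerivation_C, ← map_neg, ← map_mul]
    congr 1
    change dx _ = _
    have h4 : sigmaElement Λ U * (dx (Ring.inverse (sigmaElement Λ U)) +
        zetaElement hU * Ring.inverse (sigmaElement Λ U)) = 0 := by
      linear_combination h3
    have h5 := (hs.mul_right_eq_zero).mp h4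
    linear_combination h5
  have h3 : dxSeries (linearSeries U (stationaryExponent Λ)) =
      constSeries U (taylorSeries (zetaRegular Λ)) := by
    rw [dxSeries, coeffDerivation_linearSeries, constSeries]
    congr 1
    ext j
    rw [coeff_taylorSeries_zetaRegular, PowerSeries.coeff_mk, stationaryExponent, if_pos rfl]
    rfl
  rw [stationaryWaveSeries, Derivation.leibniz, Derivation.leibniz, h1, h2,
    coeffDerivation_expSeries _ (constantCoeff_linearSeries_stationaryExponent Λ U), h3,
    logDerivSeries]
  simp only [smul_eq_mul]
  ring

theorem isTaylorAt_dSymbolFactor (t : U.carrier) :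
    IsTaylorAt t (1 + PowerSeries.X * logDerivSeries hU) fun z => 1 + z *
      (weierstrassZeta Λ (t.1 1 - z) - weierstrassZeta Λ (t.1 1) + zetaRegular Λ z) :=
  IsTaylorAt.one.add (IsTaylorAt.X.mul (((IsTaylorAt.shiftSeries _).sub (IsTaylorAt.C _)).add
    (IsTaylorAt.map_taylorSeries (analyticAt_zetaRegular Λ))))

theorem analyticAt_iteratedDeriv {f : ℂ → ℂ} {z : ℂ} (n : ℕ) (hf : AnalyticAt ℂ f z) :
    AnalyticAt ℂ (iteratedDeriv n f) z := by
  induction n with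
  | zero => simpa using hf
  | succ n ih => rw [iteratedDeriv_succ]; exact ih.deriv

variable (Λ)

/-- The functions `zⁿ⁺² ℘⁽ⁿ⁾(z)`, extended analytically to `z = 0`. -/
noncomputable def regularizedP (n : ℕ) (z : ℂ) : ℂ :=
  (-1) ^ n * (n + 1).factorial + z ^ (n + 2) * iteratedDeriv n (Λ.weierstrassPExcept 0) z

theorem analyticAt_regularizedP (n : ℕ) : AnalyticAt ℂ (regularizedP Λ n) 0 :=
  analyticAt_const.add ((analyticAt_id.pow _).mul
    (analyticAt_iteratedDeriv n (analyticAt_weierstrassPExcept_zero Λ)))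

theorem regularizedP_eq (n : ℕ) {z : ℂ} (hz : z ∉ Λ.lattice) :
    regularizedP Λ n z = z ^ (n + 2) * iteratedDeriv n Λ.weierstrassP z := by
  -- Away from the lattice, ℘⁽ⁿ⁾ is its explicit polar part plus the n-th derivative of the regular
  -- part; induction differentiates both.
  have key : ∀ w ∉ Λ.lattice, iteratedDeriv n Λ.weierstrassP w =
      (-1) ^ n * (n + 1).factorial * (w ^ (n + 2))⁻¹ +
        iteratedDeriv n (Λ.weierstrassPExcept 0) w := by
    induction n with
    | zero =>
      intro w hw
      simp [weierstrassP_eq Λ w, add_comm]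
    | succ n ih =>
      intro w hw
      have hw0 : w ≠ 0 := fun h => hw (h ▸ zero_mem _)
      have hwc : w ∈ ((Λ.lattice : Set ℂ) \ {0})ᶜ := fun h => hw h.1
      have h1 : HasDerivAt (iteratedDeriv n (Λ.weierstrassPExcept 0))
          (iteratedDeriv (n + 1) (Λ.weierstrassPExcept 0) w) w := by
        rw [iteratedDeriv_succ]
        exact (analyticAt_iteratedDeriv n
          (Λ.analyticOnNhd_weierstrassPExcept 0 w hwc)).differentiableAt.hasDerivAt
      have h2 := (((hasDerivAt_pow (n + 2) w).inv (pow_ne_zero _ hw0)).const_mul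
        ((-1) ^ n * ((n + 1).factorial : ℂ))).add h1
      rw [iteratedDeriv_succ]
      refine (h2.congr_of_eventuallyEq ?_).deriv.trans ?_
      · filter_upwards [eventually_notMem_lattice_of_notMem Λ hw] with v hv
        exact ih v hv
      · congr 1
        rw [Nat.factorial_succ (n + 1)]
        push_cast
        field_simp
        ring
  have hz0 : z ≠ 0 := fun h => hz (h ▸ zero_mem _)
  rw [regularizedP, key z hz]
  field_simp

variable {Λ}

theorem eventually_sub_notMem_lattice {x : ℂ} (hx : x ∉ Λ.lattice) :
    ∀ᶠ z in 𝓝[≠] (0 : ℂ), x - z ∉ Λ.lattice := by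
  have h : Tendsto (fun z : ℂ => x - z) (𝓝[≠] 0) (𝓝 x) := by
    have : Tendsto (fun z : ℂ => x - z) (𝓝 0) (𝓝 (x - 0)) :=
      (by fun_prop : Continuous fun z : ℂ => x - z).tendsto 0
    rw [sub_zero] at this
    exact this.mono_left nhdsWithin_le_nhds
  exact h.eventually (eventually_notMem_lattice_of_notMem Λ hx)

/-- The addition theorem at u = x, v = -z, multiplied by z²: the factor 1 + z p equals z(ζ(x - z) -
ζ(x) + ζ(z)). -/
theorem sq_dSymbolFactor : (1 + PowerSeries.X * logDerivSeries hU) ^ 2 =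
    PowerSeries.X ^ 2 * shiftSeries (pElement hU) +
      PowerSeries.X ^ 2 * PowerSeries.C (pElement hU) +
      constSeries U (taylorSeries (regularizedP Λ 0)) := by
  refine eq_of_isTaylorAt (fun t => (isTaylorAt_dSymbolFactor hU t).pow 2)
    (fun t => (((IsTaylorAt.X.pow 2).mul (IsTaylorAt.shiftSeries _)).add
      ((IsTaylorAt.X.pow 2).mul (IsTaylorAt.C _))).add
      (IsTaylorAt.map_taylorSeries (analyticAt_regularizedP Λ 0))) fun t => ?_
  have hx := hU t.1 t.2
  filter_upwards [eventually_notMem_lattice Λ, eventually_sub_notMem_lattice hx] with z hz hxz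
  have hz0 : z ≠ 0 := fun h => hz (h ▸ zero_mem _)
  have h := weierstrassZeta_addition_sq Λ hx (fun h => hz (by simpa using neg_mem h) : -z ∉ Λ.lattice)
    (by rwa [← sub_eq_add_neg])
  rw [weierstrassZeta_neg Λ hz, ← sub_eq_add_neg, Λ.weierstrassP_neg, weierstrassZeta_eq Λ hz] at h
  rw [regularizedP_eq Λ 0 hz, iteratedDeriv_zero, pElement, evalAt_functionOfX]
  have e : 1 + z * (weierstrassZeta Λ (t.1 1 - z) - weierstrassZeta Λ (t.1 1) + zetaRegular Λ z) =
      z * (weierstrassZeta Λ (t.1 1 - z) - weierstrassZeta Λ (t.1 1) -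
        -(1 / z + zetaRegular Λ z)) := by
    field_simp
    ring
  rw [e, mul_pow, h]
  ring

/-- The differentiated addition theorem at u = x, v = -z, multiplied by z³; it lowers the degree in
the factor 1 + z p in the third-order computation. -/
theorem two_mul_dSymbolFactor_mul : 2 * (1 + PowerSeries.X * logDerivSeries hU) *
    (PowerSeries.X ^ 2 * PowerSeries.C (pElement hU) -
      constSeries U (taylorSeries (regularizedP Λ 0))) =
    PowerSeries.X ^ 3 * PowerSeries.C (pDerivElement hU) +
      constSeries U (taylorSeries (regularizedP Λ 1)) := by
  have two : ∀ t : U.carrier, IsTaylorAt t 2 fun _ => 2 := fun t => by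
    have := (IsTaylorAt.one (t := t)).add IsTaylorAt.one
    simpa only [one_add_one_eq_two] using this
  refine eq_of_isTaylorAt (fun t => ((two t).mul (isTaylorAt_dSymbolFactor hU t)).mul
    (((IsTaylorAt.X.pow 2).mul (IsTaylorAt.C _)).sub
      (IsTaylorAt.map_taylorSeries (analyticAt_regularizedP Λ 0))))
    (fun t => ((IsTaylorAt.X.pow 3).mul (IsTaylorAt.C _)).add
      (IsTaylorAt.map_taylorSeries (analyticAt_regularizedP Λ 1))) fun t => ?_
  have hx := hU t.1 t.2
  filter_upwards [eventually_notMem_lattice Λ, eventually_sub_notMem_lattice hx] with z hz hxz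
  have hz0 : z ≠ 0 := fun h => hz (h ▸ zero_mem _)
  have h := weierstrassZeta_addition Λ hx (fun h => hz (by simpa using neg_mem h) : -z ∉ Λ.lattice)
    (by rwa [← sub_eq_add_neg])
  rw [weierstrassZeta_neg Λ hz, ← sub_eq_add_neg, Λ.weierstrassP_neg, Λ.derivWeierstrassP_neg,
    weierstrassZeta_eq Λ hz] at h
  rw [regularizedP_eq Λ 0 hz, regularizedP_eq Λ 1 hz, iteratedDeriv_zero, iteratedDeriv_one,
    Λ.deriv_weierstrassP, pElement, evalAt_functionOfX, pDerivElement, evalAt_functionOfX]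
  have e : 1 + z * (weierstrassZeta Λ (t.1 1 - z) - weierstrassZeta Λ (t.1 1) + zetaRegular Λ z) =
      z * (weierstrassZeta Λ (t.1 1 - z) - weierstrassZeta Λ (t.1 1) -
        -(1 / z + zetaRegular Λ z)) := by
    field_simp
    ring
  rw [e]
  linear_combination z ^ 3 * h

end StationarySymbols

theorem shiftSeries_neg {A : Type*} [CommRing A] [Algebra ℚ A] [FlowAlgebra A] (f : A) :
    shiftSeries (-f) = -shiftSeries f := by
  refine eq_of_flowDerivation_eq_zero (flowDerivation_shiftSeries _) ?_ (by simp)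
  rw [map_neg, flowDerivation_shiftSeries, neg_zero]

/-! ### Operators with constant coefficients -/

section ConstantSymbols

open PDO

variable (U : TimeDomain)

/-- The operator `g(∂ₓ⁻¹) ∂ₓᵐ` with constant coefficients. -/
noncomputable def constSymbol (m : ℕ) (g : PowerSeries ℂ) : PDO (analyticFunctions U) :=
  ofSeries (constSeries U g) * D ^ m

theorem dxSeries_constSeries (g : PowerSeries ℂ) : dxSeries (constSeries U g) = 0 :=
  coeffDerivation_constSeries 1 g

theorem constSymbol_mul (m m' : ℕ) (g g' : PowerSeries ℂ) :
    constSymbol U m g * constSymbol U m' g' = constSymbol U (m + m') (g * g') := by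
  rw [constSymbol, constSymbol, constSymbol, mul_assoc, ← mul_assoc (D ^ m),
    D_pow_mul_ofSeries (dxSeries_constSeries U g'), mul_assoc, ← pow_add, ← mul_assoc,
    ofSeries_mul (dxSeries_constSeries U g'), map_mul]

theorem constSymbol_add (m : ℕ) (g g' : PowerSeries ℂ) :
    constSymbol U m (g + g') = constSymbol U m g + constSymbol U m g' := by
  rw [constSymbol, constSymbol, constSymbol, map_add, ofSeries_add, add_mul]

theorem constSymbol_sub (m : ℕ) (g g' : PowerSeries ℂ) :
    constSymbol U m (g - g') = constSymbol U m g - constSymbol U m g' := by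
  rw [constSymbol, constSymbol, constSymbol, map_sub, ofSeries_sub, sub_mul]

theorem constSymbol_sum {ι : Type*} (s : Finset ι) (m : ℕ) (g : ι → PowerSeries ℂ) :
    constSymbol U m (∑ i ∈ s, g i) = ∑ i ∈ s, constSymbol U m (g i) := by
  simp only [constSymbol]
  rw [map_sum, ofSeries_sum, Finset.sum_mul]

theorem constSeries_C (c : ℂ) : constSeries U (PowerSeries.C c) =
    PowerSeries.C (algebraMap ℂ (analyticFunctions U) c) := by
  rw [constSeries, PowerSeries.map_C]

theorem constSymbol_C_mul (m : ℕ) (c : ℂ) (g : PowerSeries ℂ) :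
    constSymbol U m (PowerSeries.C c * g) = C (algebraMap ℂ _ c) * constSymbol U m g := by
  rw [constSymbol, constSymbol, map_mul, constSeries_C, ofSeries_C_mul, mul_assoc]

theorem constSymbol_X_pow_mul (m k : ℕ) (g : PowerSeries ℂ) :
    constSymbol U (m + k) (PowerSeries.X ^ k * g) = constSymbol U m g := by
  rw [constSymbol, constSymbol, map_mul, map_pow, constSeries, PowerSeries.map_X,
    ofSeries_X_pow_mul, D_pow, D_pow, mul_assoc, monomial_mul_monomial _ _ dx_one]
  congr 2
  · rw [mul_one]
  · push_cast; ring

theorem constSymbol_one (m : ℕ) : constSymbol U m 1 = D ^ m := by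
  rw [constSymbol, map_one, ofSeries_one, one_mul]

theorem dx_algebraMap (c : ℂ) : dx (algebraMap ℂ (analyticFunctions U) c) = 0 :=
  d_algebraMap 1 c

end ConstantSymbols

/-! ### Second- and third-order intertwining relations for V₀ -/

section Intertwining

open PDO

variable {Λ : PeriodPair} {U : TimeDomain} (hU : ∀ t ∈ U.carrier, t 1 ∉ Λ.lattice)

theorem stationaryWave_mul_constSymbol (m : ℕ) (g : PowerSeries ℂ) :
    ofSeries (stationaryWaveSeries Λ U) * constSymbol U m g =
      ofSeries (constSeries U g * stationaryWaveSeries Λ U) * D ^ m := by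
  rw [constSymbol, ← mul_assoc, ofSeries_mul (dxSeries_constSeries U g), mul_comm (constSeries U g)]

theorem dSymbol_mul_stationaryWaveSeries (f : PowerSeries (analyticFunctions U)) :
    dSymbol (f * stationaryWaveSeries Λ U) =
      (f * (1 + PowerSeries.X * logDerivSeries hU) + PowerSeries.X * dxSeries f) *
        stationaryWaveSeries Λ U := by
  rw [dSymbol, Derivation.leibniz, dxSeries_stationaryWaveSeries hU]
  simp only [smul_eq_mul]
  ring

theorem dxSeries_logDerivSeries : dxSeries (logDerivSeries hU) =
    PowerSeries.C (pElement hU) - shiftSeries (pElement hU) := by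
  have h1 : dxSeries (shiftSeries (zetaElement hU)) = -shiftSeries (pElement hU) := by
    rw [← shiftSeries_neg, ← dx_zetaElement]
    exact coeffDerivation_shiftSeries 1 _
  have h2 : FlowAlgebra.d 1 (zetaElement hU) = -pElement hU := dx_zetaElement hU
  rw [logDerivSeries, map_add, map_sub, h1, dxSeries_constSeries, coeffDerivation_C, h2, map_neg]
  ring

theorem D_mul_stationaryWave : D * ofSeries (stationaryWaveSeries Λ U) =
    ofSeries ((1 + PowerSeries.X * logDerivSeries hU) * stationaryWaveSeries Λ U) * D := by
  rw [D_mul_ofSeries]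
  have := dSymbol_mul_stationaryWaveSeries hU 1
  rw [one_mul, one_mul] at this
  rw [this]
  congr 3
  simp

/-- The multiplier is (1 + zp)² + z²∂ₓp. The square contributes z²℘(x - z) and the derivative -z²℘(x
- z); their cancellation leaves x-dependence only through 2z²℘(x), which a potential can absorb. -/
theorem D_sq_mul_stationaryWave : D ^ 2 * ofSeries (stationaryWaveSeries Λ U) =
    ofSeries ((2 * PowerSeries.X ^ 2 * PowerSeries.C (pElement hU) +
      constSeries U (taylorSeries (regularizedP Λ 0))) * stationaryWaveSeries Λ U) * D ^ 2 := by
  rw [pow_two, mul_assoc, D_mul_stationaryWave hU, ← mul_assoc, D_mul_ofSeries,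
    dSymbol_mul_stationaryWaveSeries hU, ← pow_two, mul_assoc]
  congr 3
  rw [map_add, Derivation.leibniz, dxSeries_logDerivSeries, sq_dSymbolFactor, coeffDerivation_X]
  simp only [smul_eq_mul, Derivation.map_one_eq_zero]
  ring

theorem D_pow_three_mul_stationaryWave : D ^ 3 * ofSeries (stationaryWaveSeries Λ U) =
    ofSeries (((2 * PowerSeries.X ^ 2 * PowerSeries.C (pElement hU) +
      constSeries U (taylorSeries (regularizedP Λ 0))) *
      (1 + PowerSeries.X * logDerivSeries hU) +
      2 * PowerSeries.X ^ 3 * PowerSeries.C (pDerivElement hU)) *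
      stationaryWaveSeries Λ U) * D ^ 3 := by
  have h2 : FlowAlgebra.d 1 (pElement hU) = pDerivElement hU := dx_pElement hU
  have two : dxSeries (2 : PowerSeries (analyticFunctions U)) = 0 :=
    (dxSeries (A := analyticFunctions U)).map_natCast 2
  rw [pow_succ' _ 2, mul_assoc, D_sq_mul_stationaryWave hU, ← mul_assoc, D_mul_ofSeries,
    dSymbol_mul_stationaryWaveSeries hU, mul_assoc]
  congr 3
  rw [map_add, Derivation.leibniz, Derivation.leibniz, dxSeries_constSeries, pow_two,
    Derivation.leibniz, coeffDerivation_X, coeffDerivation_C, h2, two]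
  simp only [smul_eq_mul]
  ring

theorem C_mul_ofSeries_mul_D_pow (a : analyticFunctions U)
    (f : PowerSeries (analyticFunctions U)) (m k : ℕ) :
    C a * (ofSeries f * D ^ m) =
      ofSeries (PowerSeries.X ^ k * PowerSeries.C a * f) * D ^ (m + k) := by
  rw [mul_assoc (PowerSeries.X ^ k), ofSeries_X_pow_mul, ofSeries_C_mul, D_pow, D_pow, mul_assoc,
    mul_assoc, monomial_mul_monomial _ _ dx_one]
  congr 3
  · rw [mul_one]
  · push_cast; ring

theorem second_order_intertwining :
    (D ^ 2 - C (2 * pElement hU)) * ofSeries (stationaryWaveSeries Λ U) =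
      ofSeries (stationaryWaveSeries Λ U) *
        constSymbol U 2 (taylorSeries (regularizedP Λ 0)) := by
  have h := C_mul_ofSeries_mul_D_pow (2 * pElement hU) (stationaryWaveSeries Λ U) 0 2
  rw [pow_zero, mul_one, zero_add] at h
  rw [sub_mul, D_sq_mul_stationaryWave hU, h, stationaryWave_mul_constSymbol, ← sub_mul,
    ← ofSeries_sub]
  congr 2
  rw [map_mul, map_ofNat]
  ring

/-- The coefficients are chosen so that the terms linear in 1 + zp combine to -2(1 + zp)(z²℘(x) -
z²℘(z)). The differentiated addition theorem then cancels the remaining dependence on x. -/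
theorem third_order_intertwining :
    (C 2 * D ^ 3 - C (6 * pElement hU) * D - C (3 * pDerivElement hU)) *
      ofSeries (stationaryWaveSeries Λ U) = ofSeries (stationaryWaveSeries Λ U) *
        constSymbol U 3 (-taylorSeries (regularizedP Λ 1)) := by
  have h1 := C_mul_ofSeries_mul_D_pow (3 * pDerivElement hU) (stationaryWaveSeries Λ U) 0 3
  have h2 := C_mul_ofSeries_mul_D_pow (6 * pElement hU)
    ((1 + PowerSeries.X * logDerivSeries hU) * stationaryWaveSeries Λ U) 1 2
  rw [pow_zero, mul_one, zero_add] at h1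
  rw [pow_one] at h2
  rw [sub_mul, sub_mul, mul_assoc, mul_assoc, D_pow_three_mul_stationaryWave hU,
    D_mul_stationaryWave hU, h1, h2, stationaryWave_mul_constSymbol, ← mul_assoc, ← ofSeries_C_mul,
    ← sub_mul, ← ofSeries_sub, ← sub_mul, ← ofSeries_sub]
  congr 2
  simp only [map_mul, map_ofNat, map_neg]
  linear_combination (-stationaryWaveSeries Λ U) * two_mul_dSymbolFactor_mul hU

end Intertwining

/-! ### The Lamé function as a joint eigenvector -/

section Lame

open Filter PDO
open scoped Topology

variable {Λ : PeriodPair} {k : ℂ}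

theorem analyticAt_lameFunction {x : ℂ} (hx : x ∉ Λ.lattice) :
    AnalyticAt ℂ (lameFunction Λ k) x := by
  have hσ : ∀ z, AnalyticAt ℂ (weierstrassSigma Λ) z := fun z =>
    (differentiable_weierstrassSigma Λ).analyticAt z
  refine AnalyticAt.mul (AnalyticAt.div ?_ (hσ x) (weierstrassSigma_ne_zero Λ hx)) (by fun_prop)
  exact AnalyticAt.comp (g := weierstrassSigma Λ) (f := fun x => x + k) (hσ _) (by fun_prop)

theorem hasDerivAt_lameFunction {x : ℂ} (hx : x ∉ Λ.lattice) (hxk : x + k ∉ Λ.lattice) :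
    HasDerivAt (lameFunction Λ k) ((weierstrassZeta Λ (x + k) - weierstrassZeta Λ x -
      weierstrassZeta Λ k) * lameFunction Λ k x) x := by
  have h1 := (hasDerivAt_weierstrassSigma Λ hxk).comp_add_const x k
  have h2 := hasDerivAt_weierstrassSigma Λ hx
  have h3 : HasDerivAt (fun x => Complex.exp (-weierstrassZeta Λ k * x))
      (Complex.exp (-weierstrassZeta Λ k * x) * (-weierstrassZeta Λ k)) x := by
    simpa using ((hasDerivAt_id x).const_mul (-weierstrassZeta Λ k)).cexp
  have hσ := weierstrassSigma_ne_zero Λ hx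
  refine ((h1.div h2 hσ).mul h3).congr_deriv ?_
  rw [lameFunction, Pi.div_apply]
  field_simp
  ring

theorem eventually_add_notMem_lattice (x k : ℂ) :
    ∀ᶠ y in 𝓝[≠] x, y + k ∉ Λ.lattice := by
  by_cases h : x + k ∈ Λ.lattice
  · have h1 : Tendsto (fun y => y - x) (𝓝[≠] x) (𝓝[≠] 0) := by
      refine tendsto_nhdsWithin_of_tendsto_nhds_of_eventually_within _ ?_ ?_
      · have : Tendsto (fun y : ℂ => y - x) (𝓝 x) (𝓝 (x - x)) :=
          (by fun_prop : Continuous fun y : ℂ => y - x).tendsto x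
        rw [sub_self] at this
        exact this.mono_left nhdsWithin_le_nhds
      · filter_upwards [self_mem_nhdsWithin] with y hy
        exact sub_ne_zero.mpr hy
    filter_upwards [h1.eventually (eventually_notMem_lattice Λ)] with y hy hyk
    exact hy (by simpa using sub_mem hyk h)
  · have h1 : Tendsto (fun y => y + k) (𝓝[≠] x) (𝓝 (x + k)) :=
      ((by fun_prop : Continuous fun y : ℂ => y + k).tendsto x).mono_left nhdsWithin_le_nhds
    exact h1.eventually (eventually_notMem_lattice_of_notMem Λ h)

/-- Where x + k is outside the lattice, the logarithmic derivative of the Lamé function is ζ(x + k)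
- ζ(x) - ζ(k), so both equations are the two addition theorems in disguise. -/
theorem eventually_lame {x : ℂ} (hx : x ∉ Λ.lattice) (hk : k ∉ Λ.lattice) :
    ∀ᶠ y in 𝓝[≠] x,
      deriv (deriv (lameFunction Λ k)) y =
        (2 * Λ.weierstrassP y + Λ.weierstrassP k) * lameFunction Λ k y ∧
      2 * (Λ.weierstrassP y - Λ.weierstrassP k) * deriv (lameFunction Λ k) y =
        (Λ.derivWeierstrassP y - Λ.derivWeierstrassP k) * lameFunction Λ k y := by
  filter_upwards [eventually_add_notMem_lattice x k,
    nhdsWithin_le_nhds (eventually_notMem_lattice_of_notMem Λ hx)] with y hyk hy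
  have h1 := hasDerivAt_lameFunction hy hyk
  have h2 : deriv (lameFunction Λ k) =ᶠ[𝓝 y] fun y => (weierstrassZeta Λ (y + k) -
      weierstrassZeta Λ y - weierstrassZeta Λ k) * lameFunction Λ k y := by
    have h3 : Tendsto (fun y => y + k) (𝓝 y) (𝓝 (y + k)) :=
      (by fun_prop : Continuous fun y : ℂ => y + k).tendsto y
    filter_upwards [eventually_notMem_lattice_of_notMem Λ hy,
      h3.eventually (eventually_notMem_lattice_of_notMem Λ hyk)] with w hw hwk
    exact (hasDerivAt_lameFunction hw hwk).deriv
  have h4 := (((hasDerivAt_weierstrassZeta Λ hyk).comp_add_const y k).sub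
    (hasDerivAt_weierstrassZeta Λ hy)).sub_const (weierstrassZeta Λ k)
  have h5 := (h4.mul h1).deriv
  have e1 := weierstrassZeta_addition_sq Λ hy hk hyk
  have e2 := weierstrassZeta_addition Λ hy hk hyk
  constructor
  · rw [h2.deriv_eq]
    refine h5.trans ?_
    rw [Pi.sub_apply]
    linear_combination lameFunction Λ k y * e1
  · rw [h1.deriv]
    linear_combination lameFunction Λ k y * e2

/-- At points with x + k in the lattice the logarithmic derivative is unavailable, but both sides
are analytic there, so equality extends from a punctured neighbourhood. -/
theorem deriv_deriv_lameFunction {x : ℂ} (hx : x ∉ Λ.lattice) (hk : k ∉ Λ.lattice) :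
    deriv (deriv (lameFunction Λ k)) x =
      (2 * Λ.weierstrassP x + Λ.weierstrassP k) * lameFunction Λ k x := by
  have hΦ := analyticAt_lameFunction (k := k) hx
  have h1 := Λ.analyticOnNhd_weierstrassP x hx
  exact EventuallyEq.eq_of_nhds ((hΦ.deriv.deriv.frequently_eq_iff_eventually_eq
    (((analyticAt_const.mul h1).add analyticAt_const).mul hΦ)).mp
    ((eventually_lame hx hk).mono fun y h => h.1).frequently)

theorem weierstrassP_sub_mul_deriv_lameFunction {x : ℂ} (hx : x ∉ Λ.lattice)
    (hk : k ∉ Λ.lattice) :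
    2 * (Λ.weierstrassP x - Λ.weierstrassP k) * deriv (lameFunction Λ k) x =
      (Λ.derivWeierstrassP x - Λ.derivWeierstrassP k) * lameFunction Λ k x := by
  have hΦ := analyticAt_lameFunction (k := k) hx
  have h1 := Λ.analyticOnNhd_weierstrassP x hx
  have h2 := analyticAt_derivWeierstrassP hx
  exact EventuallyEq.eq_of_nhds ((((analyticAt_const.mul (h1.sub analyticAt_const)).mul
    hΦ.deriv).frequently_eq_iff_eventually_eq ((h2.sub analyticAt_const).mul hΦ)).mp
    ((eventually_lame hx hk).mono fun y h => h.2).frequently)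

variable {U : TimeDomain} (hU : ∀ t ∈ U.carrier, t 1 ∉ Λ.lattice)

/-- The Lamé function as an element of `𝒪(U)`. -/
noncomputable def lameElement (k : ℂ) : analyticFunctions U :=
  functionOfX (lameFunction Λ k) fun t ht => analyticAt_lameFunction (hU t ht)

theorem dx_dx_lameElement (hk : k ∉ Λ.lattice) : dx (dx (lameElement hU k)) =
    (2 * pElement hU + algebraMap ℂ _ (Λ.weierstrassP k)) * lameElement hU k := by
  refine ext_evalAt fun t => ?_
  rw [lameElement, d_one_functionOfX, d_one_functionOfX, evalAt_functionOfX,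
    deriv_deriv_lameFunction (hU t.1 t.2) hk]
  have two : evalAt t 2 = 2 := map_ofNat (evalAt t) 2
  simp [pElement, two]

theorem pElement_sub_mul_dx_lameElement (hk : k ∉ Λ.lattice) :
    2 * (pElement hU - algebraMap ℂ _ (Λ.weierstrassP k)) * dx (lameElement hU k) =
    (pDerivElement hU - algebraMap ℂ _ (Λ.derivWeierstrassP k)) * lameElement hU k := by
  refine ext_evalAt fun t => ?_
  have h := weierstrassP_sub_mul_deriv_lameFunction (hU t.1 t.2) hk
  rw [lameElement, d_one_functionOfX]
  have two : evalAt t 2 = 2 := map_ofNat (evalAt t) 2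
  simpa [pElement, pDerivElement, two] using h

end Lame

/-! ### Higher derivatives of ℘ -/

section PolynomialRecursion

open Filter
open scoped Topology

variable (Λ : PeriodPair)

theorem iteratedDeriv_weierstrassP_add_two (n : ℕ) {z : ℂ} (hz : z ∉ Λ.lattice) :
    iteratedDeriv (n + 2) Λ.weierstrassP z =
      6 * ∑ i ∈ Finset.range (n + 1), n.choose i * iteratedDeriv i Λ.weierstrassP z *
        iteratedDeriv (n - i) Λ.weierstrassP z - if n = 0 then Λ.g₂ / 2 else 0 := by
  have hP := Λ.analyticOnNhd_weierstrassP z hz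
  have h : deriv (deriv Λ.weierstrassP) =ᶠ[𝓝 z]
      fun w => 6 * (Λ.weierstrassP w * Λ.weierstrassP w) + -(Λ.g₂ / 2) := by
    filter_upwards [eventually_notMem_lattice_of_notMem Λ hz] with w hw
    rw [Λ.deriv_weierstrassP, (hasDerivAt_derivWeierstrassP Λ hw).deriv]
    ring
  have h2 : AnalyticAt ℂ (fun w => 6 * (Λ.weierstrassP w * Λ.weierstrassP w)) z :=
    analyticAt_const.mul (hP.mul hP)
  rw [iteratedDeriv_succ', iteratedDeriv_succ', h.iteratedDeriv_eq,
    iteratedDeriv_fun_add h2.contDiffAt contDiffAt_const,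
    iteratedDeriv_const_mul_field, iteratedDeriv_fun_mul hP.contDiffAt hP.contDiffAt,
    iteratedDeriv_const]
  split_ifs <;> ring

theorem taylorSeries_sum {ι : Type*} (s : Finset ι) {f : ι → ℂ → ℂ}
    (hf : ∀ i ∈ s, AnalyticAt ℂ (f i) 0) :
    taylorSeries (fun z => ∑ i ∈ s, f i z) = ∑ i ∈ s, taylorSeries (f i) := by
  classical
  induction s using Finset.induction_on with
  | empty => simpa using taylorSeries_const 0
  | insert i s hi ih =>
    have hs : ∀ j ∈ s, AnalyticAt ℂ (f j) 0 := fun j hj => hf j (Finset.mem_insert_of_mem hj)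
    simp only [Finset.sum_insert hi]
    rw [taylorSeries_add (hf i (Finset.mem_insert_self i s)) (Finset.analyticAt_fun_sum _ hs),
      ih hs]

theorem taylorSeries_pow_id (n : ℕ) : taylorSeries (fun z => z ^ n) = PowerSeries.X ^ n := by
  induction n with
  | zero => simpa using taylorSeries_const 1
  | succ n ih =>
    simp only [pow_succ]
    have h : AnalyticAt ℂ (fun z : ℂ => z ^ n) 0 := by fun_prop
    refine (taylorSeries_mul h analyticAt_id).trans ?_
    rw [ih]
    exact congrArg _ taylorSeries_id

/-- The n-th derivative of ℘'' = 6℘² - g₂/2, expanded by the Leibniz rule and multiplied by zⁿ⁺⁴.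
The weights (i + 2) + (n - i + 2) add up exactly, so no poles appear. -/
theorem taylorSeries_regularizedP_add_two (n : ℕ) :
    taylorSeries (regularizedP Λ (n + 2)) =
      ∑ i ∈ Finset.range (n + 1), PowerSeries.C (6 * (n.choose i : ℂ)) *
        (taylorSeries (regularizedP Λ i) * taylorSeries (regularizedP Λ (n - i))) -
      PowerSeries.C (if n = 0 then Λ.g₂ / 2 else 0) * PowerSeries.X ^ (n + 4) := by
  have hr := analyticAt_regularizedP Λ
  have h1 : ∀ i ∈ Finset.range (n + 1), AnalyticAt ℂ (fun z => 6 * (n.choose i : ℂ) *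
      (regularizedP Λ i z * regularizedP Λ (n - i) z)) 0 := fun i _ =>
    analyticAt_const.mul ((hr i).mul (hr (n - i)))
  have h2 : AnalyticAt ℂ (fun z : ℂ => -(if n = 0 then Λ.g₂ / 2 else 0) * z ^ (n + 4)) 0 := by
    fun_prop
  have h3 : taylorSeries (fun z => ∑ i ∈ Finset.range (n + 1), 6 * (n.choose i : ℂ) *
      (regularizedP Λ i z * regularizedP Λ (n - i) z) +
      -(if n = 0 then Λ.g₂ / 2 else 0) * z ^ (n + 4)) = _ :=
    (taylorSeries_add (Finset.analyticAt_fun_sum _ h1) h2).trans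
      (congrArg₂ _ (taylorSeries_sum _ h1)
        (taylorSeries_mul analyticAt_const (analyticAt_id.pow (n + 4))))
  rw [taylorSeries_const, taylorSeries_pow_id, map_neg, neg_mul, ← sub_eq_add_neg] at h3
  refine Eq.trans ?_ (h3.trans ?_)
  · refine taylorSeries_congr_punctured (hr _) ((Finset.analyticAt_fun_sum _ h1).add h2) ?_
    filter_upwards [eventually_notMem_lattice Λ] with z hz
    rw [regularizedP_eq Λ _ hz, iteratedDeriv_weierstrassP_add_two Λ n hz, mul_sub, Finset.mul_sum,
      Finset.mul_sum, neg_mul, ← sub_eq_add_neg]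
    refine congrArg₂ _ (Finset.sum_congr rfl fun i hi => ?_) (by ring)
    rw [regularizedP_eq Λ _ hz, regularizedP_eq Λ _ hz]
    have e : n + 2 + 2 = (i + 2) + (n - i + 2) := by
      rw [Finset.mem_range] at hi; omega
    rw [e, pow_add]
    ring
  · congr 1
    refine Finset.sum_congr rfl fun i _ => ?_
    rw [← taylorSeries_mul (hr i) (hr (n - i)), ← taylorSeries_const]
    exact taylorSeries_mul analyticAt_const ((hr i).mul (hr (n - i)))

end PolynomialRecursion

/-! ### Differential operators conjugate to the derivatives of ℘ -/

section IntertwiningOperators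

open PDO

variable {Λ : PeriodPair} {U : TimeDomain} (hU : ∀ t ∈ U.carrier, t 1 ∉ Λ.lattice)

/-- `P` is the differential operator `V₀ p(∂ₓ) V₀⁻¹` with `p(λ) = (-1)ⁿ ℘⁽ⁿ⁾(λ⁻¹)`; its eigenvalue
on the Lamé function of parameter `k` is `℘⁽ⁿ⁾(k)`. -/
structure IntertwinesP (n : ℕ) (P : PDO (analyticFunctions U)) : Prop where
  isDiff : IsDiff P
  mul_eq : P * ofSeries (stationaryWaveSeries Λ U) = ofSeries (stationaryWaveSeries Λ U) *
    constSymbol U (n + 2) (PowerSeries.C ((-1) ^ n) * taylorSeries (regularizedP Λ n))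
  act_eq : ∀ k ∉ Λ.lattice, act P (lameElement hU k) =
    algebraMap ℂ _ (iteratedDeriv n Λ.weierstrassP k) * lameElement hU k

theorem intertwinesP_zero : IntertwinesP hU 0 (D ^ 2 - C (2 * pElement hU)) where
  isDiff := (isDiff_D.pow 2).sub (isDiff_C _)
  mul_eq := by
    rw [second_order_intertwining hU, pow_zero, map_one, one_mul]
  act_eq k hk := by
    rw [act_sub_left, pow_two, act_mul isDiff_D isDiff_D, act_D, act_D, act_C,
      dx_dx_lameElement hU hk, iteratedDeriv_zero]
    ring

theorem intertwinesP_one : IntertwinesP hU 1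
    (C 2 * D ^ 3 - C (6 * pElement hU) * D - C (3 * pDerivElement hU)) where
  isDiff := (((isDiff_C _).mul (isDiff_D.pow 3)).sub ((isDiff_C _).mul isDiff_D)).sub (isDiff_C _)
  mul_eq := by
    rw [third_order_intertwining hU, pow_one, map_neg, map_one, neg_one_mul]
  act_eq k hk := by
    have h : dx (dx (dx (lameElement hU k))) =
        (2 * pElement hU + algebraMap ℂ _ (Λ.weierstrassP k)) * dx (lameElement hU k) +
          2 * pDerivElement hU * lameElement hU k := by
      have two : dx (2 : analyticFunctions U) = 0 := by
        rw [← one_add_one_eq_two, dx_add, dx_one, add_zero]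
      rw [dx_dx_lameElement hU hk, dx_mul, dx_add, dx_mul, dx_algebraMap, dx_pElement, two]
      ring
    rw [act_sub_left, act_sub_left, act_mul (isDiff_C _) (isDiff_D.pow 3),
      act_mul (isDiff_C _) isDiff_D, pow_succ, pow_two, act_mul (isDiff_D.mul isDiff_D) isDiff_D,
      act_mul isDiff_D isDiff_D, act_D, act_D, act_D, act_C, act_C, act_C, h, iteratedDeriv_one,
      Λ.deriv_weierstrassP]
    -- The third derivative leaves -2(℘(x) - ℘(k))Φ' + ℘'(x)Φ; the first-order relation for Φ turns
    -- this into ℘'(k)Φ.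
    linear_combination -(pElement_sub_mul_dx_lameElement hU hk)

/-- Conjugation by V₀ and evaluation on Lamé functions both respect products, so the differential
equation for ℘, differentiated n times, can be imitated by operators. -/
theorem IntertwinesP.add_two {n : ℕ} {P : ℕ → PDO (analyticFunctions U)}
    (hP : ∀ i ≤ n, IntertwinesP hU i (P i)) :
    IntertwinesP hU (n + 2) (∑ i ∈ Finset.range (n + 1),
      C (algebraMap ℂ _ (6 * (n.choose i : ℂ))) * (P i * P (n - i)) -
        C (algebraMap ℂ _ (if n = 0 then Λ.g₂ / 2 else 0))) := by
  have hle : ∀ i ∈ Finset.range (n + 1), IntertwinesP hU i (P i) ∧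
      IntertwinesP hU (n - i) (P (n - i)) ∧ i ≤ n := fun i hi => by
    rw [Finset.mem_range] at hi
    exact ⟨hP i (by omega), hP _ (by omega), by omega⟩
  have hdiff : ∀ i ∈ Finset.range (n + 1),
      IsDiff (C (algebraMap ℂ _ (6 * (n.choose i : ℂ))) * (P i * P (n - i))) := fun i hi =>
    (isDiff_C _).mul ((hle i hi).1.isDiff.mul (hle i hi).2.1.isDiff)
  refine ⟨(IsDiff.sum _ _ hdiff).sub (isDiff_C _), ?_, fun k hk => ?_⟩
  · have e : PowerSeries.C ((-1) ^ (n + 2)) * taylorSeries (regularizedP Λ (n + 2)) =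
        ∑ i ∈ Finset.range (n + 1), PowerSeries.C (6 * (n.choose i : ℂ)) *
          ((PowerSeries.C ((-1) ^ i) * taylorSeries (regularizedP Λ i)) *
            (PowerSeries.C ((-1) ^ (n - i)) * taylorSeries (regularizedP Λ (n - i)))) -
        PowerSeries.C (if n = 0 then Λ.g₂ / 2 else 0) * (PowerSeries.X ^ (n + 4) * 1) := by
      rw [taylorSeries_regularizedP_add_two, mul_sub, Finset.mul_sum]
      congr 1
      · refine Finset.sum_congr rfl fun i hi => ?_
        have h1 : (-1 : ℂ) ^ (n + 2) = (-1) ^ i * (-1) ^ (n - i) := by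
          rw [← pow_add, show i + (n - i) = n by have := (hle i hi).2.2; omega, pow_add]
          norm_num
        rw [h1, map_mul]
        ring
      -- The constant g₂/2 occurs only for n = 0, where the sign (-1)ⁿ⁺² is +1.
      · split_ifs with h
        · subst h
          norm_num
        · simp
    rw [e, constSymbol_sub, constSymbol_sum, sub_mul, mul_sub, Finset.sum_mul, Finset.mul_sum]
    congr 1
    · refine Finset.sum_congr rfl fun i hi => ?_
      obtain ⟨h1, h2, h3⟩ := hle i hi
      have e : n + 2 + 2 = (i + 2) + (n - i + 2) := by omega
      rw [constSymbol_C_mul, ← mul_assoc (ofSeries _), ← C_mul_comm_of_dx (dx_algebraMap U _), e,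
        ← constSymbol_mul, mul_assoc, mul_assoc, mul_assoc, h2.mul_eq, ← mul_assoc (P i),
        h1.mul_eq, mul_assoc]
    · have e : constSymbol U (n + 2 + 2) (PowerSeries.X ^ (n + 4) * 1) = 1 := by
        have := constSymbol_X_pow_mul U 0 (n + 4) 1
        rw [zero_add] at this
        rw [this, constSymbol_one, pow_zero]
      rw [constSymbol_C_mul, e, mul_one]
      exact C_mul_comm_of_dx (dx_algebraMap U _) _
  · rw [act_sub_left, act_sum_left, act_C, iteratedDeriv_weierstrassP_add_two Λ n hk, map_sub,
      sub_mul, Finset.mul_sum, map_sum, Finset.sum_mul]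
    congr 1
    refine Finset.sum_congr rfl fun i hi => ?_
    obtain ⟨h1, h2, h3⟩ := hle i hi
    rw [act_mul (isDiff_C _) (h1.isDiff.mul h2.isDiff), act_C, act_mul h1.isDiff h2.isDiff,
      h2.act_eq k hk, mul_comm (algebraMap ℂ _ _) (lameElement hU k),
      act_mul_right_of_dx _ (dx_algebraMap U _), h1.act_eq k hk]
    simp only [map_mul]
    ring

theorem exists_intertwinesP (n : ℕ) : ∃ P, IntertwinesP hU n P := by
  induction n using Nat.strong_induction_on with
  | _ n ih =>
    match n with
    | 0 => exact ⟨_, intertwinesP_zero hU⟩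
    | 1 => exact ⟨_, intertwinesP_one hU⟩
    | n + 2 =>
      choose! P hP using ih
      exact ⟨_, IntertwinesP.add_two hU fun i hi => hP i (by omega)⟩

end IntertwiningOperators

/-! ### The time-dependent wave operator and the eigenfunctions Ψ -/

section TimeEvolution

open PDO

variable {Λ : PeriodPair} {U : TimeDomain} (hU : ∀ t ∈ U.carrier, t 1 ∉ Λ.lattice)

variable (Λ) in
/-- The series `∑_{j ≥ 1} q_{jn} zʲ / j`. -/
noncomputable def quadraticSeries (n : ℕ) : PowerSeries ℂ :=
  PowerSeries.mk fun j => quadraticCoeff Λ j n / j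

/-- The polar part of ℘⁽ᵐ⁾ is normalised to 1 and the Laurent tail is compared with the definition
of q. Subtracting a_m/(m + 1) removes the term of degree m + 2, so the tail starts strictly below
order zero. -/
theorem symbol_eq (m : ℕ) :
    PowerSeries.C (1 / ((m + 1).factorial : ℂ)) *
      (PowerSeries.C ((-1) ^ m) * taylorSeries (regularizedP Λ m)) -
      PowerSeries.C (laurentCoeff Λ m / (m + 1)) * (PowerSeries.X ^ (m + 2) * 1) =
    1 + PowerSeries.X ^ (m + 2) * quadraticSeries Λ (m + 2) := by
  have hm := Nat.cast_ne_zero (R := ℂ).mpr (Nat.factorial_ne_zero m)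
  have hm1 := Nat.cast_add_one_ne_zero (R := ℂ) m
  have hsq : ((-1 : ℂ) ^ m) * (-1) ^ m = 1 := by rw [← mul_pow]; norm_num
  have h1 : taylorSeries (regularizedP Λ m) = PowerSeries.C ((-1) ^ m * ((m + 1).factorial : ℂ)) +
      PowerSeries.X ^ (m + 2) * taylorSeries (iteratedDeriv m (Λ.weierstrassPExcept 0)) := by
    have hp : AnalyticAt ℂ (fun z : ℂ => z ^ (m + 2)) 0 := by fun_prop
    have hi := analyticAt_iteratedDeriv m (analyticAt_weierstrassPExcept_zero Λ)
    rw [← taylorSeries_const, ← taylorSeries_pow_id, ← taylorSeries_mul hp hi]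
    exact taylorSeries_add analyticAt_const (hp.mul hi)
  have h2 : PowerSeries.C (1 / ((m + 1).factorial : ℂ) * (-1) ^ m) *
      taylorSeries (iteratedDeriv m (Λ.weierstrassPExcept 0)) -
      PowerSeries.C (laurentCoeff Λ m / (m + 1)) = quadraticSeries Λ (m + 2) := by
    ext j
    have h3 : iteratedDeriv j (iteratedDeriv m (Λ.weierstrassPExcept 0)) 0 =
        laurentCoeff Λ (j + m) * (j + m).factorial := by
      rw [laurentCoeff, div_mul_cancel₀ _ (Nat.cast_ne_zero.mpr (Nat.factorial_ne_zero _)),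
        iteratedDeriv_eq_iterate, iteratedDeriv_eq_iterate, iteratedDeriv_eq_iterate,
        Function.iterate_add_apply]
    rw [map_sub, PowerSeries.coeff_C_mul, coeff_taylorSeries, h3, quadraticSeries,
      PowerSeries.coeff_mk, PowerSeries.coeff_C, Nat.factorial_succ]
    -- In degree zero the left side is ((-1)ᵐ - 1) a_m/(m + 1), which vanishes by the parity of ℘;
    -- the right side is 0 through division by zero.
    cases j with
    | zero =>
      rw [if_pos rfl, zero_add]
      simp only [Nat.factorial_zero, Nat.cast_zero, div_zero]
      rcases Nat.even_or_odd m with h | h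
      · rw [h.neg_one_pow]
        push_cast
        field_simp
        ring
      · rw [laurentCoeff_eq_zero_of_odd Λ h]
        simp
    | succ j =>
      have hj := Nat.cast_ne_zero (R := ℂ).mpr (Nat.factorial_ne_zero j)
      have hj1 := Nat.cast_add_one_ne_zero (R := ℂ) j
      rw [if_neg (Nat.succ_ne_zero j), quadraticCoeff_comm Λ (by omega) (by omega), quadraticCoeff,
        show m + 2 + (j + 1) - 2 = j + 1 + m by omega, show m + 2 - 1 = m + 1 by omega,
        show j + 1 - 1 = j by omega, Nat.factorial_succ m, Nat.factorial_succ j]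
      push_cast
      field_simp
      ring
  have h4 : PowerSeries.C (1 / ((m + 1).factorial : ℂ)) * (PowerSeries.C ((-1) ^ m) *
      PowerSeries.C ((-1) ^ m * ((m + 1).factorial : ℂ))) = 1 := by
    rw [← map_mul, ← map_mul, ← map_one PowerSeries.C]
    refine congrArg _ ?_
    rw [← mul_assoc ((-1 : ℂ) ^ m), hsq, one_mul]
    exact one_div_mul_cancel (Nat.cast_ne_zero.mpr (Nat.factorial_ne_zero _))
  rw [h1, ← h2, map_mul PowerSeries.C (1 / ((m + 1).factorial : ℂ))]
  linear_combination h4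

/-- The eigenvalue of the `n`-th flow on the Lamé function of parameter `k`. -/
noncomputable def flowEigenvalue (Λ : PeriodPair) (k : ℂ) (n : ℕ) : ℂ :=
  iteratedDeriv (n - 2 : ℕ) Λ.weierstrassP k / ((n - 1 : ℕ).factorial : ℂ) -
    laurentCoeff Λ (n - 2 : ℕ) / (n - 1 : ℕ)

theorem exists_flowOperator {n : ℕ} (hn : 2 ≤ n) : ∃ M : PDO (analyticFunctions U),
    IsDiff M ∧ M * ofSeries (stationaryWaveSeries Λ U) = ofSeries (stationaryWaveSeries Λ U) *
      (D ^ n + ofSeries (constSeries U (quadraticSeries Λ n))) ∧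
    ∀ k ∉ Λ.lattice, act M (lameElement hU k) =
      algebraMap ℂ _ (flowEigenvalue Λ k n) * lameElement hU k := by
  obtain ⟨m, rfl⟩ := Nat.exists_eq_add_of_le' hn
  obtain ⟨P, hP⟩ := exists_intertwinesP hU m
  refine ⟨C (algebraMap ℂ _ (1 / ((m + 1).factorial : ℂ))) * P -
    C (algebraMap ℂ _ (laurentCoeff Λ m / (m + 1))), ((isDiff_C _).mul hP.isDiff).sub (isDiff_C _),
    ?_, fun k hk => ?_⟩
  · have e1 : constSymbol U (m + 2) (PowerSeries.X ^ (m + 2) * 1) = 1 := by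
      have := constSymbol_X_pow_mul U 0 (m + 2) 1
      rw [zero_add] at this
      rw [this, constSymbol_one, pow_zero]
    have e2 : constSymbol U (m + 2) (PowerSeries.X ^ (m + 2) * quadraticSeries Λ (m + 2)) =
        ofSeries (constSeries U (quadraticSeries Λ (m + 2))) := by
      have := constSymbol_X_pow_mul U 0 (m + 2) (quadraticSeries Λ (m + 2))
      rw [zero_add] at this
      rw [this, constSymbol, pow_zero, mul_one]
    rw [← e2, ← constSymbol_one, ← constSymbol_add, ← symbol_eq, constSymbol_sub,
      constSymbol_C_mul, constSymbol_C_mul _ _ (laurentCoeff Λ m / _), e1, sub_mul, mul_sub, mul_assoc, hP.mul_eq, mul_one,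
      ← mul_assoc, C_mul_comm_of_dx (dx_algebraMap U _), C_mul_comm_of_dx (dx_algebraMap U _),
      mul_assoc]
  · have e1 : m + 2 - 2 = m := by omega
    have e2 : m + 2 - 1 = m + 1 := by omega
    rw [act_sub_left, act_mul (isDiff_C _) hP.isDiff, act_C, act_C, hP.act_eq k hk, flowEigenvalue,
      e1, e2, ← mul_assoc, ← map_mul, ← sub_mul, ← map_sub]
    congr 2
    push_cast
    ring

theorem isMonic_stationaryWave (hU : ∀ t ∈ U.carrier, t 1 ∉ Λ.lattice) : IsMonic (ofSeries (stationaryWaveSeries Λ U)) :=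
  isMonic_ofSeries (by
    rw [stationaryWaveSeries, map_mul, map_mul, constantCoeff_shiftSeries,
      PowerSeries.constantCoeff_C, constantCoeff_expSeries, mul_one,
      Ring.mul_inverse_cancel _ (isUnit_sigmaElement Λ hU)])

/-- The conjugate of the tail has order at most -1, so the differential operator found above and `L₀
^ n` have the same differential part. -/
theorem exists_plus_pow_eq {n : ℕ} (hn : 2 ≤ n) :
    plus (Ad (ofSeries (stationaryWaveSeries Λ U)) D ^ n) *
      ofSeries (stationaryWaveSeries Λ U) = ofSeries (stationaryWaveSeries Λ U) *
        (D ^ n + ofSeries (constSeries U (quadraticSeries Λ n))) ∧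
    ∀ k ∉ Λ.lattice, act (plus (Ad (ofSeries (stationaryWaveSeries Λ U)) D ^ n))
      (lameElement hU k) = algebraMap ℂ _ (flowEigenvalue Λ k n) * lameElement hU k := by
  obtain ⟨M, hM, h1, h2⟩ := exists_flowOperator hU hn
  have hV := isMonic_stationaryWave hU
  have h3 := eq_ad_of_mul hV.isUnit h1
  have hE : OrdLE (ofSeries (constSeries U (quadraticSeries Λ n))) (-1) := fun i hi => by
    rw [coeff_ofSeries]
    split_ifs with h
    · obtain rfl : i = 0 := by omega
      simp [constSeries, quadraticSeries]
    · rfl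
  have h4 : plus (Ad (ofSeries (stationaryWaveSeries Λ U)) D ^ n) = M := by
    refine plus_eq_of hM ?_
    rw [← ad_pow hV.isUnit, h3]
    have e : Ad (ofSeries (stationaryWaveSeries Λ U)) (D ^ n) -
        Ad (ofSeries (stationaryWaveSeries Λ U))
          (D ^ n + ofSeries (constSeries U (quadraticSeries Λ n))) =
        -(ofSeries (stationaryWaveSeries Λ U) * ofSeries (constSeries U (quadraticSeries Λ n)) *
          Ring.inverse (ofSeries (stationaryWaveSeries Λ U))) := by
      simp only [Ad, mul_add, add_mul]
      abel
    rw [e, ← zero_sub]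
    exact (ordLE_zero _).sub (by simpa using (hV.1.mul hE).mul hV.inverse.1)
  rw [h4]
  exact ⟨h1, h2⟩

theorem d_stationaryWaveSeries (hU : ∀ t ∈ U.carrier, t 1 ∉ Λ.lattice) {n : ℕ+}
    (hn : n ≠ 1) : coeffDerivation (FlowAlgebra.d n) (stationaryWaveSeries Λ U) = 0 := by
  have h1 : FlowAlgebra.d n (sigmaElement Λ U) = 0 := d_functionOfX _ hn
  have h2 : FlowAlgebra.d n (Ring.inverse (sigmaElement Λ U)) = 0 := by
    have hs := isUnit_sigmaElement Λ hU
    have h := congrArg (FlowAlgebra.d n) (Ring.mul_inverse_cancel _ hs)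
    rw [Derivation.leibniz, h1, smul_zero, add_zero, Derivation.map_one_eq_zero, smul_eq_mul] at h
    exact (hs.mul_right_eq_zero).mp h
  have h3 : coeffDerivation (FlowAlgebra.d n) (linearSeries U (stationaryExponent Λ)) = 0 := by
    rw [coeffDerivation_linearSeries]
    ext1 j
    simp [stationaryExponent, hn]
  have h4 : shiftSeries (0 : analyticFunctions U) = 0 := by
    rw [shiftSeries_eq_C fun n => map_zero _, map_zero]
  rw [stationaryWaveSeries, Derivation.leibniz, Derivation.leibniz,
    coeffDerivation_expSeries _ (constantCoeff_linearSeries_stationaryExponent Λ U), h3,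
    coeffDerivation_C, coeffDerivation_shiftSeries, h1, h2, h4]
  simp

variable (Λ U) in
theorem dxSeries_expSeries_timeExponent :
    dxSeries (expSeries (linearSeries U (timeExponent Λ))) = 0 := by
  have h : dxSeries (linearSeries U (timeExponent Λ)) = 0 := by
    rw [dxSeries, coeffDerivation_linearSeries]
    ext1 j
    simp [timeExponent]
  rw [coeffDerivation_expSeries _ (constantCoeff_linearSeries_timeExponent Λ U), h, zero_mul]

theorem d_expSeries_timeExponent {n : ℕ+} (hn : n ≠ 1) :
    coeffDerivation (FlowAlgebra.d n) (expSeries (linearSeries U (timeExponent Λ))) =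
      constSeries U (quadraticSeries Λ n) * expSeries (linearSeries U (timeExponent Λ)) := by
  rw [coeffDerivation_expSeries _ (constantCoeff_linearSeries_timeExponent Λ U),
    coeffDerivation_linearSeries, constSeries, quadraticSeries]
  congr 3
  funext j
  rw [timeExponent, if_neg hn]

variable (Λ U) in
/-- The wave operator `V = V₀ exp(…)` of `L₀`. -/
noncomputable def timeWave : PDO (analyticFunctions U) :=
  ofSeries (stationaryWaveSeries Λ U) * ofSeries (expSeries (linearSeries U (timeExponent Λ)))

theorem isMonic_timeWave (hU : ∀ t ∈ U.carrier, t 1 ∉ Λ.lattice) : IsMonic (timeWave Λ U) :=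
  (isMonic_stationaryWave hU).mul (isMonic_ofSeries (constantCoeff_expSeries _))

/-- The exponential factor has coefficients independent of x, so it commutes with ∂ and L₀ is
unchanged. Its tₙ-derivative inserts the constant-coefficient tail, which is the discrepancy between
Bₙ V₀ and V₀ ∂ⁿ. -/
theorem isWaveOperator_timeWave (hU : ∀ t ∈ U.carrier, t 1 ∉ Λ.lattice) :
    IsWaveOperator (timeWave Λ U) (Ad (ofSeries (stationaryWaveSeries Λ U)) D) := by
  have hV₀ := isMonic_stationaryWave hU
  have hV := isMonic_timeWave hU
  have hL : Ad (ofSeries (stationaryWaveSeries Λ U)) D = Ad (timeWave Λ U) D := by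
    refine eq_ad_of_mul hV.isUnit ?_
    have h := D_pow_mul_ofSeries (dxSeries_expSeries_timeExponent Λ U) 1
    rw [pow_one] at h
    rw [timeWave, ← mul_assoc, ad_mul_self hV₀.isUnit, mul_assoc, h, mul_assoc]
  refine ⟨hV.1, hV.2, hL, fun n hn => ?_⟩
  have hn1 : n ≠ 1 := by
    rintro rfl
    exact absurd hn (by decide)
  have h1 := (exists_plus_pow_eq hU (n := n) (by exact_mod_cast hn)).1
  rw [ad_pow hV.isUnit, ← hL, timeWave, ← mul_assoc, h1, dt_mul, dt_ofSeries, dt_ofSeries,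
    d_stationaryWaveSeries hU hn1, ofSeries_zero, zero_mul, zero_add, d_expSeries_timeExponent hn1,
    ← ofSeries_mul (dxSeries_expSeries_timeExponent Λ U), mul_assoc _ _ (D ^ (n : ℕ)),
    ← D_pow_mul_ofSeries (dxSeries_expSeries_timeExponent Λ U)]
  noncomm_ring

theorem isTauOfWave_timeWave (hU : ∀ t ∈ U.carrier, t 1 ∉ Λ.lattice) :
    IsTauOfWave (timeWave Λ U) (expFunction (-quadraticElement Λ U) * sigmaElement Λ U) := by
  rw [isTauOfWave_iff, shiftSeries_tau Λ hU, timeWave,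
    ofSeries_mul (dxSeries_expSeries_timeExponent Λ U), waveSeries_ofSeries]
  exact ⟨(isUnit_expFunction _).mul (isUnit_sigmaElement Λ hU), rfl⟩

/-- The function `Ψ(x, t; k)` as an element of `𝒪(U)`. -/
noncomputable def planeWaveElement (k : ℂ) : analyticFunctions U :=
  lameElement hU k * expFunction (linearFunction U (Finsupp.linearCombination ℂ fun n : ℕ+ =>
    if n = 1 then 0 else flowEigenvalue Λ k n))

theorem evalAt_planeWaveElement (k : ℂ) (t : U.carrier) :
    evalAt t (planeWaveElement hU k) = lamePlaneWave Λ k t.1 := by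
  rw [planeWaveElement, lamePlaneWave, map_mul, evalAt_expFunction, evalAt_linearFunction,
    Finsupp.linearCombination_apply]
  refine congrArg₂ _ rfl (congrArg _ ?_)
  congr 1
  funext n u
  rw [smul_eq_mul, flowEigenvalue]
  split_ifs
  · rw [mul_zero]
  · rw [mul_comm]

/-- The Lamé factor does not depend on tₙ for n ≥ 2, and the exponential factor does not depend on
x. Hence ∂ₙ and Bₙ both multiply Ψ by the same eigenvalue. -/
theorem isEigenfunction_planeWaveElement {k : ℂ} (hk : k ∉ Λ.lattice) :
    IsEigenfunction (Ad (ofSeries (stationaryWaveSeries Λ U)) D) (planeWaveElement hU k) := by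
  intro n hn
  have hn1 : n ≠ 1 := by
    rintro rfl
    exact absurd hn (by decide)
  have h1 := (exists_plus_pow_eq hU (n := n) (by exact_mod_cast hn)).2 k hk
  have h2 : FlowAlgebra.d n (lameElement hU k) = 0 := d_functionOfX _ hn1
  have h3 : ∀ i : ℕ+, FlowAlgebra.d i (expFunction (linearFunction U
      (Finsupp.linearCombination ℂ fun n : ℕ+ => if n = 1 then 0 else flowEigenvalue Λ k n))) =
      algebraMap ℂ _ (if i = 1 then 0 else flowEigenvalue Λ k i) * expFunction (linearFunction U
      (Finsupp.linearCombination ℂ fun n : ℕ+ => if n = 1 then 0 else flowEigenvalue Λ k n)) := by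
    intro i
    rw [d_expFunction, d_linearFunction, Finsupp.linearCombination_single, one_smul]
  have h4 : dx (expFunction (linearFunction U
      (Finsupp.linearCombination ℂ fun n : ℕ+ => if n = 1 then 0 else flowEigenvalue Λ k n))) =
      0 := by
    rw [dx, h3, if_pos rfl, map_zero, zero_mul]
  rw [planeWaveElement, act_mul_right_of_dx _ h4, h1, Derivation.leibniz, h2, h3, if_neg hn1,
    smul_zero, add_zero, smul_eq_mul]
  ring

theorem IsEigenfunction.sum_algebraMap_mul {L : PDO (analyticFunctions U)} {ι : Type*}
    (s : Finset ι) (γ : ι → ℂ) {φ : ι → analyticFunctions U}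
    (h : ∀ i ∈ s, IsEigenfunction L (φ i)) :
    IsEigenfunction L (∑ i ∈ s, φ i * algebraMap ℂ _ (γ i)) := by
  intro n hn
  rw [act_sum_right, map_sum]
  refine Finset.sum_congr rfl fun i hi => ?_
  rw [act_mul_right_of_dx _ (dx_algebraMap U _), Derivation.leibniz, d_algebraMap, smul_zero,
    zero_add, h i hi n hn, smul_eq_mul, mul_comm]

end TimeEvolution

/-! ### Assembly of the two parts -/

theorem mainTheorem5 :
    (∀ (A : Type*) [CommRing A] [Algebra ℚ A] [FlowAlgebra A]
      (L W : PDO A) (τ : A) (N : ℕ) (φ : Fin N → A),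
      IsKPSolution L → IsWaveOperator W L → IsTauOfWave W τ →
      (∀ i, IsEigenfunction L (φ i)) → DarbouxDefined N φ →
      IsUnit (darboux N φ) ∧
      IsKPSolution (PDO.Ad (darboux N φ) L) ∧
      IsWaveOperator (darboux N φ * W * PDO.monomial 1 (-(N : ℤ))) (PDO.Ad (darboux N φ) L) ∧
      IsTauFunction (PDO.Ad (darboux N φ) L) (wronskian φ * τ) ∧
      ∀ τ' : A, IsTauOfWave (darboux N φ * W * PDO.monomial 1 (-(N : ℤ))) τ' ↔
        ∃ c : A, IsUnit c ∧ (∀ n, FlowAlgebra.d n c = 0) ∧ τ' = c * (wronskian φ * τ)) ∧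
    (∀ (Λ : PeriodPair) (U : TimeDomain), (∀ t ∈ U.carrier, t 1 ∉ Λ.lattice) →
      ∃ (V₀ : PDO (analyticFunctions U)) (τV : analyticFunctions U),
        (∀ n : ℤ, 0 < n → V₀.coeff n = 0) ∧
        (∀ (n : ℕ) (t : U.carrier),
          (V₀.coeff (-(n : ℤ))).1 t = stationaryWaveCoeff Λ n (t.1 1)) ∧
        (∀ t : U.carrier,
          τV.1 t = Complex.exp (-quadraticQ Λ t.1) * weierstrassSigma Λ (t.1 1)) ∧
        IsUnit V₀ ∧
        IsKPSolution (PDO.Ad V₀ PDO.D) ∧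
        IsTauFunction (PDO.Ad V₀ PDO.D) τV ∧
        (∀ (N M : ℕ) (k : Fin M → ℂ) (γ : Fin N → Fin M → ℂ), (∀ j, k j ∉ Λ.lattice) →
          ∃ φ : Fin N → analyticFunctions U,
            (∀ i (t : U.carrier), (φ i).1 t = ∑ j, γ i j * lamePlaneWave Λ (k j) t.1) ∧
            ∀ i, IsEigenfunction (PDO.Ad V₀ PDO.D) (φ i)) ∧
        ∀ (N : ℕ) (φ : Fin N → analyticFunctions U),
          (∀ i, IsEigenfunction (PDO.Ad V₀ PDO.D) (φ i)) → DarbouxDefined N φ →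
          IsUnit (darboux N φ) ∧
          IsKPSolution (PDO.Ad (darboux N φ) (PDO.Ad V₀ PDO.D)) ∧
          ∃ τ' : analyticFunctions U,
            (∀ t : U.carrier, τ'.1 t = Complex.exp (-quadraticQ Λ t.1) *
              weierstrassSigma Λ (t.1 1) * (wronskian φ).1 t) ∧
            IsTauFunction (PDO.Ad (darboux N φ) (PDO.Ad V₀ PDO.D)) τ') := by
  refine ⟨?_, fun Λ U hU => ?_⟩
  · intro A _ _ _ L W τ N φ _ hW hτ hφ hd
    obtain ⟨h1, h2, -⟩ := darboux_main hW hτ N φ hφ hd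
    exact ⟨isUnit_darboux N φ hd, h1.isKPSolution, h1, ⟨_, h1, h2⟩,
      fun τ' => isTauOfWave_iff_of_isTauOfWave h2 τ'⟩
  -- V₀ dresses ∂ to L₀, but the wave operator carrying τ_V is V₀ times the time-dependent
  -- exponential; the Darboux results are applied to the latter.
  · have hW := isWaveOperator_timeWave hU
    have hτ := isTauOfWave_timeWave hU
    have hV₀ := isMonic_stationaryWave hU
    have hτV : ∀ t : U.carrier, (expFunction (-quadraticElement Λ U) * sigmaElement Λ U).1 t =
        Complex.exp (-quadraticQ Λ t.1) * weierstrassSigma Λ (t.1 1) := fun t => by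
      rw [← evalAt_apply, map_mul, evalAt_expFunction, map_neg, evalAt_quadraticElement]
      rfl
    refine ⟨PDO.ofSeries (stationaryWaveSeries Λ U),
      expFunction (-quadraticElement Λ U) * sigmaElement Λ U, hV₀.1, fun n t => ?_, hτV,
      hV₀.isUnit, hW.isKPSolution, ⟨_, hW, hτ⟩, fun N M k γ hk => ?_, fun N φ hφ hd => ?_⟩
    · rw [PDO.coeff_ofSeries_neg]
      exact evalAt_coeff_stationaryWaveSeries Λ hU n t
    · refine ⟨fun i => ∑ j, planeWaveElement hU (k j) * algebraMap ℂ _ (γ i j), fun i t => ?_,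
        fun i => IsEigenfunction.sum_algebraMap_mul _ _ fun j _ =>
          isEigenfunction_planeWaveElement hU (hk j)⟩
      rw [← evalAt_apply, map_sum]
      refine Finset.sum_congr rfl fun j _ => ?_
      rw [map_mul, evalAt_planeWaveElement, evalAt_algebraMap, mul_comm]
    · obtain ⟨h1, h2, -⟩ := darboux_main hW hτ N φ hφ hd
      refine ⟨isUnit_darboux N φ hd, h1.isKPSolution, _, fun t => ?_, _, h1, h2⟩
      rw [← hτV, mul_comm]
      rfl
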